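/- Let $\mathfrak{X}$ be a Cantor space (a space homeomorphic to the Cantor set) and let $G$ be the group of all self-homeomorphisms of $\mathfrak{X}$, topologized so that the subgroups $G\{\mathfrak{A}_1\}\cap\cdots\cap G\{\mathfrak{A}_n\}$, with $\mathfrak{A}_1,\dots,\mathfrak{A}_n$ clopen in $\mathfrak{X}$ and $G\{\mathfrak{A}\}=\{g : g\mathfrak{A}=\mathfrak{A}\}$, form a neighbourhood basis of the identity. A finitary $G$-set is a set with an action of $G$ that has open stabilizers and finitely many orbits. For a finite set $A$, let $Y(A)$ be the finitary $G$-set of continuous maps $\mathfrak{X}\to A$ ($A$ discrete), and for $n\ge 1$ let $X(n)$ be the set of surjective continuous maps $\mathfrak{X}\to\{1,\dots,n\}$. A map $f\colon A\to B$ of finite sets induces $Y(f)\colon Y(A)\to Y(B)$ by composition. A measure for $G$ valued in a commutative ring $k$ assigns to each map $f\colon X\to Y$ of finitary $G$-sets with $Y$ transitive an element $\mu(f)\in k$ such that: $\mu(f)=1$ if $f$ is an isomorphism; $\mu(f)=\mu(f|_{X_1})+\mu(f|_{X_2})$ if $X=X_1\amalg X_2$ as $G$-sets; $\mu(g\circ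 f)=\mu(g)\mu(f)$ for a map $g\colon Y\to Z$ of transitive $G$-sets; and $\mu(f')=\mu(f)$ if $f'$ is the base change of $f$ along a map $Y'\to Y$ of transitive $G$-sets. It is regular if $\mu(f)$ is a unit for each map $f$ of transitive $G$-sets. Write $\mu(X)=\mu(X\to\mathrm{pt})$. For a finitary $G$-set $X$ let $\mathcal{F}(X)$ be the space of $G$-invariant functions $X\to k$; a map $f\colon X\to Y$ induces a linear map $f_*\colon\mathcal{F}(X)\to\mathcal{F}(Y)$ with $f_*(1_W)=\mu(W\to f(W))\,1_{f(W)}$ for each orbit $W$ of $X$. The category $\underline{\mathrm{Perm}}_k(G;\mu)$ has an object $\mathrm{Vec}_X$ for each finitary $G$-set $X$; morphisms $\mathrm{Vec}_X\to\mathrm{Vec}_Y$ are elements of $\mathcal{F}(Y\times X)$; the composite of $A\in\mathcal{F}(Y\times X)$ and $B\in\mathcal{F}(Z\times Y)$ is $(p_{13})_*$ of the function $(z,y,x)\mapsto B(z,y)A(y,x)$; and the tensor product is $\mathrm{Vec}_X\otimes\mathrm{Vec}_Y=\mathrm{Vec}_{X\times Y}$ on objects and the Kronecker product on morphisms. Let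 $\mathbb{B}=\{0,1\}$ be the Boolean semiring ($1+1=1$). Let $\mathcal{W}$ be the symmetric monoidal category with an object $W(A)$ for each finite set $A$, with the $B\times A$ matrices over $\mathbb{B}$ as the morphisms $W(A)\to W(B)$, composed by matrix multiplication, and with $W(A)\otimes W(B)=W(A\times B)$ and the Kronecker product of matrices. Let $k[\mathcal{W}]^\sharp$ be the additive-Karoubi envelope of the $k$-linearization $k[\mathcal{W}]$, and let $[W(A)]$ be its object given by $W(A)$. The zero matrices induce an idempotent endomorphism $[0]$ of each object $X$ of $k[\mathcal{W}]^\sharp$; let $X_1$ be the image of $1-[0]$, and let $k[\mathcal{W}]^\sharp_1$ be the full subcategory of the objects $X$ with $X=X_1$ (equivalently, with $[0]=0$ on $X$), which is a tensor category for the tensor product of $k[\mathcal{W}]^\sharp$, with unit object $[W(\mathrm{pt})]_1$. Theorem. There is a unique regular $\mathbb{Q}$-valued measure $\nu$ for $G$ with $\nu(X(n))=(-1)^{n-1}$ for all $n\ge 1$. Let $k$ be a field of characteristic $0$, and regard $\nu$ as valued in $k$. Then: (a) $\underline{\mathrm{Perm}}_k(G;\nu)^{\mathrm{kar}}$ (the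 Karoubi envelope) and $k[\mathcal{W}]^\sharp_1$ are additive, and there is an equivalence of tensor categories, i.e. a $k$-linear symmetric monoidal equivalence, $$\underline{\mathrm{Perm}}_k(G;\nu)^{\mathrm{kar}}\;\cong\;k[\mathcal{W}]^\sharp_1$$ under which $\mathrm{Vec}_{Y(A)}$ corresponds to $[W(A)]_1$ for every finite set $A$. (b) For every map $f\colon A\to B$ of finite sets, $Y(f)_*(1_{Y(A)})=1_{Y(f(A))}$, where $Y(f(A))\subset Y(B)$ is the set of maps with values in the image of $f$. -/

import Mathlib

open CategoryTheory MonoidalCategory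
noncomputable section
namespace CantorPerm
open Idempotents
set_option linter.unusedSectionVars false
section Karoubi
universe v u w
variable {C : Type u} [Category.{v} C]

/-- An isomorphism of `C` compatible with the idempotents gives an isomorphism of `Karoubi C`. -/
abbrev karIso {P Q : Karoubi C} (e : P.X ≅ Q.X) (h : P.p ≫ e.hom = e.hom ≫ Q.p) : P ≅ Q where
  hom := ⟨P.p ≫ e.hom, by simp [← h]⟩
  inv := ⟨e.inv ≫ P.p, by
    have : Q.p ≫ e.inv = e.inv ≫ P.p := by rw [Iso.eq_inv_comp, ← Category.assoc, ← h]; simp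
    rw [Category.assoc, P.idem, ← this, Q.idem_assoc]⟩
  hom_inv_id := by ext; simp
  inv_hom_id := by ext; simp [reassoc_of% h, h]

instance karLinear (k : Type w) [Semiring k] [Preadditive C] [Linear k C] :
    Linear k (Karoubi C) where
  homModule P Q :=
    { smul := fun r f => ⟨r • f.f, by simp⟩
      one_smul := fun f => Karoubi.hom_ext _ _ (one_smul k f.f)
      mul_smul := fun r s f => Karoubi.hom_ext _ _ (mul_smul r s f.f)
      smul_zero := fun r => Karoubi.hom_ext _ _ (smul_zero r)
      smul_add := fun r f g => Karoubi.hom_ext _ _ (smul_add r f.f g.f)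
      add_smul := fun r s f => Karoubi.hom_ext _ _ (add_smul r s f.f)
      zero_smul := fun f => Karoubi.hom_ext _ _ (zero_smul k f.f) }
  smul_comp P Q R r f g := Karoubi.hom_ext _ _ (Linear.smul_comp _ _ _ r f.f g.f)
  comp_smul P Q R f r g := Karoubi.hom_ext _ _ (Linear.comp_smul _ _ _ f.f r g.f)

variable [MonoidalCategory C]

/-- The tensor product of idempotents. -/
abbrev karTensorObj (P Q : Karoubi C) : Karoubi C := ⟨P.X ⊗ Q.X, P.p ⊗ₘ Q.p, by simp⟩

/-- The tensor product of morphisms of `Karoubi C` is that of the underlying morphisms of `C`. -/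
abbrev karTensorHom {P P' Q Q' : Karoubi C} (f : P ⟶ P') (g : Q ⟶ Q') :
    karTensorObj P Q ⟶ karTensorObj P' Q' := ⟨f.f ⊗ₘ g.f, by simp⟩

instance karMonoidalStruct : MonoidalCategoryStruct (Karoubi C) where
  tensorObj := karTensorObj
  tensorHom := karTensorHom
  whiskerLeft P _ _ f := karTensorHom (𝟙 P) f
  whiskerRight f P := karTensorHom f (𝟙 P)
  tensorUnit := ⟨𝟙_ C, 𝟙 _, by simp⟩
  associator P Q R := karIso (α_ P.X Q.X R.X) (associator_naturality P.p Q.p R.p)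
  leftUnitor P := karIso (λ_ P.X) (by simp)
  rightUnitor P := karIso (ρ_ P.X) (by simp)

instance karMonoidal : MonoidalCategory (Karoubi C) :=
  MonoidalCategory.ofTensorHom
    (id_tensorHom_id := fun P Q => rfl)
    (id_tensorHom := fun _ _ _ _ => rfl)
    (tensorHom_id := fun _ _ => rfl)
    (tensorHom_comp_tensorHom := fun f₁ f₂ g₁ g₂ =>
      Karoubi.hom_ext _ _ (tensorHom_comp_tensorHom f₁.f f₂.f g₁.f g₂.f))
    (associator_naturality := fun {P₁ P₂ P₃ Q₁ Q₂ Q₃} f₁ f₂ f₃ => Karoubi.hom_ext _ _ (by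
      change ((f₁.f ⊗ₘ f₂.f) ⊗ₘ f₃.f) ≫ ((Q₁.p ⊗ₘ Q₂.p) ⊗ₘ Q₃.p) ≫ (α_ _ _ _).hom =
        (((P₁.p ⊗ₘ P₂.p) ⊗ₘ P₃.p) ≫ (α_ _ _ _).hom) ≫ (f₁.f ⊗ₘ f₂.f ⊗ₘ f₃.f)
      rw [Category.assoc, ← associator_naturality]
      simp only [tensorHom_comp_tensorHom_assoc, tensorHom_comp_tensorHom, Karoubi.comp_p,
        Karoubi.p_comp]))
    (leftUnitor_naturality := fun {P Q} f => Karoubi.hom_ext _ _ (by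
      change (𝟙 (𝟙_ C) ⊗ₘ f.f) ≫ (𝟙 (𝟙_ C) ⊗ₘ Q.p) ≫ (λ_ Q.X).hom =
        ((𝟙 (𝟙_ C) ⊗ₘ P.p) ≫ (λ_ P.X).hom) ≫ f.f
      simp))
    (rightUnitor_naturality := fun {P Q} f => Karoubi.hom_ext _ _ (by
      change (f.f ⊗ₘ 𝟙 (𝟙_ C)) ≫ (Q.p ⊗ₘ 𝟙 (𝟙_ C)) ≫ (ρ_ Q.X).hom =
        ((P.p ⊗ₘ 𝟙 (𝟙_ C)) ≫ (ρ_ P.X).hom) ≫ f.f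
      simp))
    (pentagon := fun W X Y Z => Karoubi.hom_ext _ _ (by
      change ((((W.p ⊗ₘ X.p) ⊗ₘ Y.p) ≫ (α_ W.X X.X Y.X).hom) ⊗ₘ Z.p) ≫
        (((W.p ⊗ₘ (X.p ⊗ₘ Y.p)) ⊗ₘ Z.p) ≫ (α_ W.X (X.X ⊗ Y.X) Z.X).hom) ≫
        (W.p ⊗ₘ (((X.p ⊗ₘ Y.p) ⊗ₘ Z.p) ≫ (α_ X.X Y.X Z.X).hom)) =
        ((((W.p ⊗ₘ X.p) ⊗ₘ Y.p) ⊗ₘ Z.p) ≫ (α_ (W.X ⊗ X.X) Y.X Z.X).hom) ≫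
        (((W.p ⊗ₘ X.p) ⊗ₘ (Y.p ⊗ₘ Z.p)) ≫ (α_ W.X X.X (Y.X ⊗ Z.X)).hom)
      have h1 : (((W.p ⊗ₘ X.p) ⊗ₘ Y.p) ≫ (α_ W.X X.X Y.X).hom) ⊗ₘ Z.p =
          (((W.p ⊗ₘ X.p) ⊗ₘ Y.p) ⊗ₘ Z.p) ≫ ((α_ W.X X.X Y.X).hom ▷ Z.X) := by
        rw [← tensorHom_id, tensorHom_comp_tensorHom, Category.comp_id]
      have h2 : (W.p ⊗ₘ (((X.p ⊗ₘ Y.p) ⊗ₘ Z.p) ≫ (α_ X.X Y.X Z.X).hom)) =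
          (W.p ⊗ₘ ((X.p ⊗ₘ Y.p) ⊗ₘ Z.p)) ≫ (W.X ◁ (α_ X.X Y.X Z.X).hom) := by
        rw [← id_tensorHom, tensorHom_comp_tensorHom, Category.comp_id]
      have h3 : ((α_ W.X X.X Y.X).hom ▷ Z.X) ≫ ((W.p ⊗ₘ (X.p ⊗ₘ Y.p)) ⊗ₘ Z.p) =
          (((W.p ⊗ₘ X.p) ⊗ₘ Y.p) ⊗ₘ Z.p) ≫ ((α_ W.X X.X Y.X).hom ▷ Z.X) := by
        rw [← tensorHom_id, tensorHom_comp_tensorHom, tensorHom_comp_tensorHom, Category.comp_id,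
          Category.id_comp, associator_naturality]
      rw [h1, h2]
      simp only [Category.assoc]
      rw [reassoc_of% h3, ← associator_naturality_assoc, ← associator_naturality_assoc,
        reassoc_of% h3]
      simp only [tensorHom_comp_tensorHom_assoc, tensorHom_comp_tensorHom, Karoubi.idem, pentagon]))
    (triangle := fun X Y => Karoubi.hom_ext _ _ (by
      change (((X.p ⊗ₘ 𝟙 (𝟙_ C)) ⊗ₘ Y.p) ≫ (α_ X.X (𝟙_ C) Y.X).hom) ≫
        (X.p ⊗ₘ ((𝟙 (𝟙_ C) ⊗ₘ Y.p) ≫ (λ_ Y.X).hom)) = ((X.p ⊗ₘ 𝟙 (𝟙_ C)) ≫ (ρ_ X.X).hom) ⊗ₘ Y.p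
      have h1 : (X.p ⊗ₘ ((𝟙 (𝟙_ C) ⊗ₘ Y.p) ≫ (λ_ Y.X).hom)) =
          (X.p ⊗ₘ (𝟙 (𝟙_ C) ⊗ₘ Y.p)) ≫ (X.X ◁ (λ_ Y.X).hom) := by
        rw [← id_tensorHom, tensorHom_comp_tensorHom, Category.comp_id]
      rw [h1, Category.assoc, ← associator_naturality_assoc, triangle]
      simp only [tensorHom_comp_tensorHom_assoc, tensorHom_comp_tensorHom, Karoubi.idem,
        Category.comp_id]
      rw [← tensorHom_id, tensorHom_comp_tensorHom, Category.comp_id]))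

theorem kar_tensor_p (P Q : Karoubi C) : (P ⊗ Q).p = P.p ⊗ₘ Q.p := rfl
theorem kar_whiskerLeft_f (P : Karoubi C) {Q Q' : Karoubi C} (g : Q ⟶ Q') :
    (P ◁ g).f = P.p ⊗ₘ g.f := rfl
theorem kar_whiskerRight_f {P P' : Karoubi C} (f : P ⟶ P') (Q : Karoubi C) :
    (f ▷ Q).f = f.f ⊗ₘ Q.p := rfl

instance karMonoidalPreadditive [Preadditive C] [MonoidalPreadditive C] :
    MonoidalPreadditive (Karoubi C) where
  whiskerLeft_zero := Karoubi.hom_ext _ _ (MonoidalPreadditive.tensor_zero _)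
  zero_whiskerRight := Karoubi.hom_ext _ _ (MonoidalPreadditive.zero_tensor _)
  whiskerLeft_add f g := Karoubi.hom_ext _ _ (MonoidalPreadditive.tensor_add _ f.f g.f)
  add_whiskerRight f g := Karoubi.hom_ext _ _ (MonoidalPreadditive.add_tensor f.f g.f _)

instance karMonoidalLinear (k : Type w) [Semiring k] [Preadditive C] [Linear k C]
    [MonoidalPreadditive C] [MonoidalLinear k C] : MonoidalLinear k (Karoubi C) where
  whiskerLeft_smul P _ _ r f := Karoubi.hom_ext _ _ (by
    change P.p ⊗ₘ (r • f.f) = r • (P.p ⊗ₘ f.f)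
    simp [MonoidalCategory.tensorHom_def])
  smul_whiskerRight r _ _ f P := Karoubi.hom_ext _ _ (by
    change (r • f.f) ⊗ₘ P.p = r • (f.f ⊗ₘ P.p)
    simp [MonoidalCategory.tensorHom_def])

variable [SymmetricCategory C]

instance karSymmetric : SymmetricCategory (Karoubi C) where
  braiding P Q := karIso (β_ P.X Q.X) (BraidedCategory.braiding_naturality P.p Q.p)
  braiding_naturality_right P Q R f := Karoubi.hom_ext _ _ (by
    change (P.p ⊗ₘ f.f) ≫ (P.p ⊗ₘ R.p) ≫ (β_ _ _).hom =
      ((P.p ⊗ₘ Q.p) ≫ (β_ _ _).hom) ≫ (f.f ⊗ₘ P.p)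
    rw [Category.assoc, ← BraidedCategory.braiding_naturality]
    simp only [tensorHom_comp_tensorHom_assoc, Karoubi.comp_p, Karoubi.p_comp])
  braiding_naturality_left {P Q} f R := Karoubi.hom_ext _ _ (by
    change (f.f ⊗ₘ R.p) ≫ (Q.p ⊗ₘ R.p) ≫ (β_ _ _).hom =
      ((P.p ⊗ₘ R.p) ≫ (β_ _ _).hom) ≫ (R.p ⊗ₘ f.f)
    rw [Category.assoc, ← BraidedCategory.braiding_naturality]
    simp only [tensorHom_comp_tensorHom_assoc, Karoubi.comp_p, Karoubi.p_comp])
  hexagon_forward P Q R := Karoubi.hom_ext _ _ (by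
    change (((P.p ⊗ₘ Q.p) ⊗ₘ R.p) ≫ (α_ P.X Q.X R.X).hom) ≫
      ((P.p ⊗ₘ (Q.p ⊗ₘ R.p)) ≫ (β_ P.X (Q.X ⊗ R.X)).hom) ≫
      (((Q.p ⊗ₘ R.p) ⊗ₘ P.p) ≫ (α_ Q.X R.X P.X).hom) =
      (((P.p ⊗ₘ Q.p) ≫ (β_ P.X Q.X).hom) ⊗ₘ R.p) ≫
      (((Q.p ⊗ₘ P.p) ⊗ₘ R.p) ≫ (α_ Q.X P.X R.X).hom) ≫
      (Q.p ⊗ₘ ((P.p ⊗ₘ R.p) ≫ (β_ P.X R.X).hom))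
    have h1 : ((P.p ⊗ₘ Q.p) ≫ (β_ P.X Q.X).hom) ⊗ₘ R.p =
        ((P.p ⊗ₘ Q.p) ⊗ₘ R.p) ≫ ((β_ P.X Q.X).hom ▷ R.X) := by
      rw [← tensorHom_id, tensorHom_comp_tensorHom, Category.comp_id]
    have h2 : Q.p ⊗ₘ ((P.p ⊗ₘ R.p) ≫ (β_ P.X R.X).hom) =
        (Q.p ⊗ₘ (P.p ⊗ₘ R.p)) ≫ (Q.X ◁ (β_ P.X R.X).hom) := by
      rw [← id_tensorHom, tensorHom_comp_tensorHom, Category.comp_id]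
    have h3 : ((β_ P.X Q.X).hom ▷ R.X) ≫ ((Q.p ⊗ₘ P.p) ⊗ₘ R.p) =
        ((P.p ⊗ₘ Q.p) ⊗ₘ R.p) ≫ ((β_ P.X Q.X).hom ▷ R.X) := by
      rw [← tensorHom_id, tensorHom_comp_tensorHom, tensorHom_comp_tensorHom, Category.comp_id,
        Category.id_comp, BraidedCategory.braiding_naturality]
    rw [h1, h2]
    simp only [Category.assoc]
    rw [← BraidedCategory.braiding_naturality_assoc, ← associator_naturality_assoc,
      ← associator_naturality_assoc, ← associator_naturality_assoc, reassoc_of% h3, reassoc_of% h3,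
      BraidedCategory.hexagon_forward])
  hexagon_reverse P Q R := Karoubi.hom_ext _ _ (by
    have e : ∀ {X Y Z : C} {p : X ⟶ X} {q : Y ⟶ Y} {r : Z ⟶ Z},
        (α_ X Y Z).inv ≫ ((p ⊗ₘ q) ⊗ₘ r) = (p ⊗ₘ (q ⊗ₘ r)) ≫ (α_ X Y Z).inv := by
      intros; rw [Iso.inv_comp_eq, ← associator_naturality_assoc, Iso.hom_inv_id, Category.comp_id]
    change ((α_ P.X Q.X R.X).inv ≫ ((P.p ⊗ₘ Q.p) ⊗ₘ R.p)) ≫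
      (((P.p ⊗ₘ Q.p) ⊗ₘ R.p) ≫ (β_ (P.X ⊗ Q.X) R.X).hom) ≫
      ((α_ R.X P.X Q.X).inv ≫ ((R.p ⊗ₘ P.p) ⊗ₘ Q.p)) =
      (P.p ⊗ₘ ((Q.p ⊗ₘ R.p) ≫ (β_ Q.X R.X).hom)) ≫
      ((α_ P.X R.X Q.X).inv ≫ ((P.p ⊗ₘ R.p) ⊗ₘ Q.p)) ≫
      (((P.p ⊗ₘ R.p) ≫ (β_ P.X R.X).hom) ⊗ₘ Q.p)
    have h1 : P.p ⊗ₘ ((Q.p ⊗ₘ R.p) ≫ (β_ Q.X R.X).hom) =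
        (P.p ⊗ₘ (Q.p ⊗ₘ R.p)) ≫ (P.X ◁ (β_ Q.X R.X).hom) := by
      rw [← id_tensorHom, tensorHom_comp_tensorHom, Category.comp_id]
    have h2 : ((P.p ⊗ₘ R.p) ≫ (β_ P.X R.X).hom) ⊗ₘ Q.p =
        ((P.p ⊗ₘ R.p) ⊗ₘ Q.p) ≫ ((β_ P.X R.X).hom ▷ Q.X) := by
      rw [← tensorHom_id, tensorHom_comp_tensorHom, Category.comp_id]
    have h3 : (P.X ◁ (β_ Q.X R.X).hom) ≫ (P.p ⊗ₘ (R.p ⊗ₘ Q.p)) =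
        (P.p ⊗ₘ (Q.p ⊗ₘ R.p)) ≫ (P.X ◁ (β_ Q.X R.X).hom) := by
      rw [← id_tensorHom, tensorHom_comp_tensorHom, tensorHom_comp_tensorHom, Category.comp_id,
        Category.id_comp, BraidedCategory.braiding_naturality]
    rw [h1, h2, e, e, e]
    simp only [Category.assoc]
    have ea := @e P.X Q.X R.X P.p Q.p R.p
    have eb := @e P.X R.X Q.X P.p R.p Q.p
    rw [← BraidedCategory.braiding_naturality_assoc, reassoc_of% ea, reassoc_of% ea,
      reassoc_of% eb, reassoc_of% h3, reassoc_of% h3, BraidedCategory.hexagon_reverse])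
  symmetry P Q := Karoubi.hom_ext _ _ (by
    change ((P.p ⊗ₘ Q.p) ≫ (β_ _ _).hom) ≫ ((Q.p ⊗ₘ P.p) ≫ (β_ _ _).hom) = P.p ⊗ₘ Q.p
    rw [Category.assoc, ← BraidedCategory.braiding_naturality_assoc]
    simp)

end Karoubi
section Free
universe v u w

/-- The bilinear extension of a map `α → β → γ` to free modules. -/
def finsuppBilin (k : Type w) [CommRing k] {α β γ : Type v} (φ : α → β → γ) :
    (α →₀ k) →ₗ[k] (β →₀ k) →ₗ[k] (γ →₀ k) :=
  Finsupp.lift ((β →₀ k) →ₗ[k] (γ →₀ k)) k α fun a =>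
    Finsupp.lift (γ →₀ k) k β fun b => Finsupp.single (φ a b) 1

theorem finsuppBilin_single (k : Type w) [CommRing k] {α β γ : Type v} (φ : α → β → γ)
    (a : α) (b : β) (r s : k) :
    finsuppBilin k φ (Finsupp.single a r) (Finsupp.single b s) =
      Finsupp.single (φ a b) (r * s) := by
  simp [finsuppBilin, Finsupp.lift_apply]

variable {k : Type w} [CommRing k] {C : Type u} [Category.{v} C]

/-- The multiple `r [f]` of the basis element `[f]` of a morphism space of the linearization. -/
def fsingle {X Y : C} (f : X ⟶ Y) (r : k) : Free.of k X ⟶ Free.of k Y := Finsupp.single f r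

theorem fsingle_comp {X Y Z : C} (f : X ⟶ Y) (g : Y ⟶ Z) (r s : k) :
    fsingle f r ≫ fsingle g s = fsingle (f ≫ g) (r * s) := Free.single_comp_single k C f g r s

theorem fsingle_id (X : C) : fsingle (𝟙 X) (1 : k) = 𝟙 (Free.of k X) := rfl

theorem fsingle_smul {X Y : C} (f : X ⟶ Y) (r s : k) : s • fsingle f r = fsingle f (s * r) :=
  Finsupp.smul_single s f r

@[elab_as_elim]
theorem free_induction {X Y : C} {P : (Free.of k X ⟶ Free.of k Y) → Prop}
    (f : Free.of k X ⟶ Free.of k Y) (h0 : P 0) (ha : ∀ f g, P f → P g → P (f + g))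
    (hs : ∀ (a : X ⟶ Y) (r : k), P (fsingle a r)) : P f :=
  Finsupp.induction_linear (motive := P) f h0 ha hs

/-- The isomorphism `[e]` of the linearization attached to an isomorphism `e`. -/
abbrev fIso {X Y : C} (e : X ≅ Y) : Free.of k X ≅ Free.of k Y where
  hom := fsingle e.hom 1
  inv := fsingle e.inv 1
  hom_inv_id := by rw [fsingle_comp, e.hom_inv_id, one_mul, fsingle_id]
  inv_hom_id := by rw [fsingle_comp, e.inv_hom_id, one_mul, fsingle_id]

variable [MonoidalCategory C]

/-- The tensor product of morphisms of the linearization: the bilinear extension of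
`[f] ⊗ [g] = [f ⊗ g]`. -/
def freeTensorHom {X Y X' Y' : C} (f : Free.of k X ⟶ Free.of k Y) (g : Free.of k X' ⟶ Free.of k Y') :
    Free.of k (X ⊗ X') ⟶ Free.of k (Y ⊗ Y') :=
  finsuppBilin k (fun (a : X ⟶ Y) (b : X' ⟶ Y') => a ⊗ₘ b) f g

section
variable {X Y X' Y' : C}

theorem freeTensorHom_fsingle (f : X ⟶ Y) (g : X' ⟶ Y') (r s : k) :
    freeTensorHom (fsingle f r) (fsingle g s) = fsingle (f ⊗ₘ g) (r * s) :=
  finsuppBilin_single k _ f g r s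

theorem freeTensorHom_add (f : Free.of k X ⟶ Free.of k Y) (g g' : Free.of k X' ⟶ Free.of k Y') :
    freeTensorHom f (g + g') = freeTensorHom f g + freeTensorHom f g' :=
  map_add (finsuppBilin k _ f) g g'

theorem freeTensorHom_smul (f : Free.of k X ⟶ Free.of k Y) (r : k)
    (g : Free.of k X' ⟶ Free.of k Y') :
    freeTensorHom f (r • g) = r • freeTensorHom f g := map_smul (finsuppBilin k _ f) r g

theorem freeTensorHom_zero (f : Free.of k X ⟶ Free.of k Y) :
    freeTensorHom f (0 : Free.of k X' ⟶ Free.of k Y') = 0 :=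
  map_zero (finsuppBilin k _ f)

theorem add_freeTensorHom (f f' : Free.of k X ⟶ Free.of k Y) (g : Free.of k X' ⟶ Free.of k Y') :
    freeTensorHom (f + f') g = freeTensorHom f g + freeTensorHom f' g :=
  LinearMap.map_add₂ (finsuppBilin k _) f f' g

theorem smul_freeTensorHom (f : Free.of k X ⟶ Free.of k Y) (r : k)
    (g : Free.of k X' ⟶ Free.of k Y') :
    freeTensorHom (r • f) g = r • freeTensorHom f g := LinearMap.map_smul₂ (finsuppBilin k _) r f g

theorem zero_freeTensorHom (g : Free.of k X' ⟶ Free.of k Y') :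
    freeTensorHom (0 : Free.of k X ⟶ Free.of k Y) g = 0 :=
  LinearMap.map_zero₂ (finsuppBilin k _) g

theorem freeTensorHom_id_left (f : X ⟶ Y) (r : k) (Z : C) :
    freeTensorHom (𝟙 (Free.of k Z)) (fsingle f r) = fsingle (Z ◁ f) r := by
  rw [← fsingle_id, freeTensorHom_fsingle, one_mul, id_tensorHom]

theorem freeTensorHom_id_right (f : X ⟶ Y) (r : k) (Z : C) :
    freeTensorHom (fsingle f r) (𝟙 (Free.of k Z)) = fsingle (f ▷ Z) r := by
  rw [← fsingle_id, freeTensorHom_fsingle, mul_one, tensorHom_id]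

end

theorem free_tensorHom_comp {X₁ Y₁ Z₁ X₂ Y₂ Z₂ : C} (f₁ : Free.of k X₁ ⟶ Free.of k Y₁)
    (f₂ : Free.of k X₂ ⟶ Free.of k Y₂) (g₁ : Free.of k Y₁ ⟶ Free.of k Z₁)
    (g₂ : Free.of k Y₂ ⟶ Free.of k Z₂) : freeTensorHom f₁ f₂ ≫ freeTensorHom g₁ g₂ =
      freeTensorHom (f₁ ≫ g₁) (f₂ ≫ g₂) := by
  induction f₁ using free_induction with
  | h0 => simp only [zero_freeTensorHom, Limits.zero_comp]
  | ha a b ha hb => simp only [add_freeTensorHom, Preadditive.add_comp, ha, hb]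
  | hs f₁ r₁ =>
  induction f₂ using free_induction with
  | h0 => simp only [freeTensorHom_zero, Limits.zero_comp]
  | ha a b ha hb => simp only [freeTensorHom_add, Preadditive.add_comp, ha, hb]
  | hs f₂ r₂ =>
  induction g₁ using free_induction with
  | h0 => simp only [zero_freeTensorHom, Limits.comp_zero]
  | ha a b ha hb => simp only [add_freeTensorHom, Preadditive.comp_add, ha, hb]
  | hs g₁ s₁ =>
  induction g₂ using free_induction with
  | h0 => simp only [freeTensorHom_zero, Limits.comp_zero]
  | ha a b ha hb => simp only [freeTensorHom_add, Preadditive.comp_add, ha, hb]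
  | hs g₂ s₂ =>
  simp only [freeTensorHom_fsingle, fsingle_comp, tensorHom_comp_tensorHom, mul_mul_mul_comm]

theorem free_associator_naturality {X₁ X₂ X₃ Y₁ Y₂ Y₃ : C} (f₁ : Free.of k X₁ ⟶ Free.of k Y₁)
    (f₂ : Free.of k X₂ ⟶ Free.of k Y₂) (f₃ : Free.of k X₃ ⟶ Free.of k Y₃) :
    freeTensorHom (freeTensorHom f₁ f₂) f₃ ≫ fsingle (α_ Y₁ Y₂ Y₃).hom 1 =
      fsingle (α_ X₁ X₂ X₃).hom 1 ≫ freeTensorHom f₁ (freeTensorHom f₂ f₃) := by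
  induction f₁ using free_induction with
  | h0 => simp only [zero_freeTensorHom, Limits.zero_comp, Limits.comp_zero]
  | ha a b ha hb =>
    simp only [add_freeTensorHom, Preadditive.add_comp, Preadditive.comp_add, ha, hb]
  | hs f₁ r₁ =>
  induction f₂ using free_induction with
  | h0 => simp only [freeTensorHom_zero, zero_freeTensorHom, Limits.zero_comp, Limits.comp_zero]
  | ha a b ha hb =>
    simp only [freeTensorHom_add, add_freeTensorHom, Preadditive.add_comp, Preadditive.comp_add,
      ha, hb]
  | hs f₂ r₂ =>
  induction f₃ using free_induction with
  | h0 => simp only [freeTensorHom_zero, Limits.zero_comp, Limits.comp_zero]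
  | ha a b ha hb =>
    simp only [freeTensorHom_add, Preadditive.add_comp, Preadditive.comp_add, ha, hb]
  | hs f₃ r₃ =>
  simp only [freeTensorHom_fsingle, fsingle_comp, associator_naturality, mul_one, one_mul,
    mul_assoc]

theorem free_leftUnitor_naturality {X Y : C} (f : Free.of k X ⟶ Free.of k Y) :
    freeTensorHom (𝟙 (Free.of k (𝟙_ C))) f ≫ fsingle (λ_ Y).hom 1 = fsingle (λ_ X).hom 1 ≫ f := by
  induction f using free_induction with
  | h0 => simp only [freeTensorHom_zero, Limits.zero_comp, Limits.comp_zero]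
  | ha a b ha hb =>
    simp only [freeTensorHom_add, Preadditive.add_comp, Preadditive.comp_add, ha, hb]
  | hs f r => simp only [freeTensorHom_id_left, fsingle_comp, leftUnitor_naturality, mul_comm]

theorem free_rightUnitor_naturality {X Y : C} (f : Free.of k X ⟶ Free.of k Y) :
    freeTensorHom f (𝟙 (Free.of k (𝟙_ C))) ≫ fsingle (ρ_ Y).hom 1 = fsingle (ρ_ X).hom 1 ≫ f := by
  induction f using free_induction with
  | h0 => simp only [zero_freeTensorHom, Limits.zero_comp, Limits.comp_zero]
  | ha a b ha hb =>
    simp only [add_freeTensorHom, Preadditive.add_comp, Preadditive.comp_add, ha, hb]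
  | hs f r => simp only [freeTensorHom_id_right, fsingle_comp, rightUnitor_naturality, mul_comm]

theorem free_pentagon (W X Y Z : C) :
    freeTensorHom (fsingle (α_ W X Y).hom (1 : k)) (𝟙 (Free.of k Z)) ≫
      fsingle (α_ W (X ⊗ Y) Z).hom 1 ≫
        freeTensorHom (𝟙 (Free.of k W)) (fsingle (α_ X Y Z).hom 1) =
      fsingle (α_ (W ⊗ X) Y Z).hom 1 ≫ fsingle (α_ W X (Y ⊗ Z)).hom 1 := by
  simp only [freeTensorHom_id_left, freeTensorHom_id_right, fsingle_comp, pentagon, mul_one]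

theorem free_triangle (X Y : C) :
    fsingle (α_ X (𝟙_ C) Y).hom (1 : k) ≫
      freeTensorHom (𝟙 (Free.of k X)) (fsingle (λ_ Y).hom 1) =
      freeTensorHom (fsingle (ρ_ X).hom 1) (𝟙 (Free.of k Y)) := by
  simp only [freeTensorHom_id_left, freeTensorHom_id_right, fsingle_comp, triangle, mul_one]

theorem free_tensor_id (X Y : C) :
    freeTensorHom (𝟙 (Free.of k X)) (𝟙 (Free.of k Y)) = 𝟙 (Free.of k (X ⊗ Y)) := by
  rw [← fsingle_id Y, freeTensorHom_id_left, whiskerLeft_id, fsingle_id]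

/-- The tensor product of the linearization is given on objects by that of `C`. -/
instance freeMonoidalStruct : MonoidalCategoryStruct (Free k C) where
  tensorObj (X Y : C) := Free.of k (X ⊗ Y)
  tensorHom {X₁ Y₁ X₂ Y₂ : C} f g := freeTensorHom (X := X₁) (Y := Y₁) (X' := X₂) (Y' := Y₂) f g
  whiskerLeft (X : C) {Y₁ Y₂ : C} f :=
    freeTensorHom (X := X) (Y := X) (X' := Y₁) (Y' := Y₂) (𝟙 (Free.of k X)) f
  whiskerRight {X₁ X₂ : C} f (Y : C) :=
    freeTensorHom (X := X₁) (Y := X₂) (X' := Y) (Y' := Y) f (𝟙 (Free.of k Y))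
  tensorUnit := Free.of k (C := C) (𝟙_ C)
  associator X Y Z := fIso (C := C) (associator (C := C) X Y Z)
  leftUnitor X := fIso (C := C) (leftUnitor (C := C) X)
  rightUnitor X := fIso (C := C) (rightUnitor (C := C) X)

instance freeMonoidal : MonoidalCategory (Free k C) :=
  MonoidalCategory.ofTensorHom
    (id_tensorHom_id := free_tensor_id (C := C))
    (id_tensorHom := fun _ _ _ _ => rfl)
    (tensorHom_id := fun _ _ => rfl)
    (tensorHom_comp_tensorHom := free_tensorHom_comp (C := C))
    (associator_naturality := free_associator_naturality (C := C))
    (leftUnitor_naturality := free_leftUnitor_naturality (C := C))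
    (rightUnitor_naturality := free_rightUnitor_naturality (C := C))
    (pentagon := free_pentagon (C := C))
    (triangle := free_triangle (C := C))

instance freeMonoidalPreadditive : MonoidalPreadditive (Free k C) where
  whiskerLeft_zero := freeTensorHom_zero (C := C) _
  zero_whiskerRight := zero_freeTensorHom (C := C) _
  whiskerLeft_add f g := freeTensorHom_add (C := C) _ f g
  add_whiskerRight f g := add_freeTensorHom (C := C) f g _

instance freeMonoidalLinear : MonoidalLinear k (Free k C) where
  whiskerLeft_smul _ _ _ r f := freeTensorHom_smul (C := C) _ r f
  smul_whiskerRight r _ _ f _ := smul_freeTensorHom (C := C) f r _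

variable [SymmetricCategory C]

theorem free_braiding_naturality_right (X : C) {Y Z : C} (f : Free.of k Y ⟶ Free.of k Z) :
    freeTensorHom (𝟙 (Free.of k X)) f ≫ fsingle (β_ X Z).hom 1 =
      fsingle (β_ X Y).hom 1 ≫ freeTensorHom f (𝟙 (Free.of k X)) := by
  induction f using free_induction with
  | h0 => simp only [freeTensorHom_zero, zero_freeTensorHom, Limits.zero_comp, Limits.comp_zero]
  | ha a b ha hb =>
    simp only [freeTensorHom_add, add_freeTensorHom, Preadditive.add_comp, Preadditive.comp_add,
      ha, hb]
  | hs f r =>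
    simp only [freeTensorHom_id_left, freeTensorHom_id_right, fsingle_comp,
      BraidedCategory.braiding_naturality_right, mul_comm]

theorem free_braiding_naturality_left {X Y : C} (f : Free.of k X ⟶ Free.of k Y) (Z : C) :
    freeTensorHom f (𝟙 (Free.of k Z)) ≫ fsingle (β_ Y Z).hom 1 =
      fsingle (β_ X Z).hom 1 ≫ freeTensorHom (𝟙 (Free.of k Z)) f := by
  induction f using free_induction with
  | h0 => simp only [freeTensorHom_zero, zero_freeTensorHom, Limits.zero_comp, Limits.comp_zero]
  | ha a b ha hb =>
    simp only [freeTensorHom_add, add_freeTensorHom, Preadditive.add_comp, Preadditive.comp_add,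
      ha, hb]
  | hs f r =>
    simp only [freeTensorHom_id_left, freeTensorHom_id_right, fsingle_comp,
      BraidedCategory.braiding_naturality_left, mul_comm]

theorem free_hexagon_forward (X Y Z : C) :
    fsingle (α_ X Y Z).hom (1 : k) ≫ fsingle (β_ X (Y ⊗ Z)).hom 1 ≫ fsingle (α_ Y Z X).hom 1 =
      freeTensorHom (fsingle (β_ X Y).hom 1) (𝟙 (Free.of k Z)) ≫ fsingle (α_ Y X Z).hom 1 ≫
        freeTensorHom (𝟙 (Free.of k Y)) (fsingle (β_ X Z).hom 1) := by
  simp only [freeTensorHom_id_left, freeTensorHom_id_right, fsingle_comp,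
    BraidedCategory.hexagon_forward, mul_one]

theorem free_hexagon_reverse (X Y Z : C) :
    fsingle (α_ X Y Z).inv (1 : k) ≫ fsingle (β_ (X ⊗ Y) Z).hom 1 ≫ fsingle (α_ Z X Y).inv 1 =
      freeTensorHom (𝟙 (Free.of k X)) (fsingle (β_ Y Z).hom 1) ≫ fsingle (α_ X Z Y).inv 1 ≫
        freeTensorHom (fsingle (β_ X Z).hom 1) (𝟙 (Free.of k Y)) := by
  simp only [freeTensorHom_id_left, freeTensorHom_id_right, fsingle_comp,
    BraidedCategory.hexagon_reverse, mul_one]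

theorem free_symmetry (X Y : C) :
    fsingle (β_ X Y).hom (1 : k) ≫ fsingle (β_ Y X).hom 1 = 𝟙 (Free.of k (X ⊗ Y)) := by
  rw [fsingle_comp, SymmetricCategory.symmetry, mul_one, fsingle_id]

instance freeSymmetric : SymmetricCategory (Free k C) where
  braiding X Y := fIso (C := C) (BraidedCategory.braiding (C := C) X Y)
  braiding_naturality_right X _ _ f := free_braiding_naturality_right (C := C) X f
  braiding_naturality_left f Z := free_braiding_naturality_left (C := C) f Z
  hexagon_forward := free_hexagon_forward (C := C)
  hexagon_reverse := free_hexagon_reverse (C := C)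
  symmetry := free_symmetry (C := C)

end Free
section Mat
universe v u w
variable {C : Type u} [Category.{v} C] [Preadditive C]

instance matLinear (k : Type w) [Semiring k] [Linear k C] : Linear k (Mat_ C) where
  homModule M N :=
    { smul := fun r f => (fun i j => r • f i j : Mat_.Hom M N)
      one_smul := fun f => Mat_.hom_ext _ _ fun i j => one_smul k (f i j)
      mul_smul := fun r s f => Mat_.hom_ext _ _ fun i j => mul_smul r s (f i j)
      smul_zero := fun r => Mat_.hom_ext _ _ fun i j => smul_zero r
      smul_add := fun r f g => Mat_.hom_ext _ _ fun i j => smul_add r (f i j) (g i j)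
      add_smul := fun r s f => Mat_.hom_ext _ _ fun i j => add_smul r s (f i j)
      zero_smul := fun f => Mat_.hom_ext _ _ fun i j => zero_smul k (f i j) }
  smul_comp M N K r f g := Mat_.hom_ext _ _ fun i j => by
    change ∑ l, (r • f i l) ≫ g l j = r • ∑ l, f i l ≫ g l j
    simp [Finset.smul_sum]
  comp_smul M N K f r g := Mat_.hom_ext _ _ fun i j => by
    change ∑ l, f i l ≫ (r • g l j) = r • ∑ l, f i l ≫ g l j
    simp [Finset.smul_sum]

/-- A matrix of morphisms, as a morphism of `Mat_ C`. -/
abbrev matMk {M N : Mat_ C} (f : ∀ i j, M.X i ⟶ N.X j) : M ⟶ N := (f : Mat_.Hom M N)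

open scoped Classical in
/-- The matrix with entry `f i` in position `(i, σ i)` and zeros elsewhere. -/
def mono {M N : Mat_ C} (σ : M.ι → N.ι) (f : ∀ i, M.X i ⟶ N.X (σ i)) : M ⟶ N :=
  matMk fun i j => if h : σ i = j then f i ≫ eqToHom (congrArg N.X h) else 0

theorem mono_self {M N : Mat_ C} (σ : M.ι → N.ι) (f : ∀ i, M.X i ⟶ N.X (σ i)) (i : M.ι) :
    mono σ f i (σ i) = f i :=
  (dif_pos rfl).trans (by simp)

theorem mono_ne {M N : Mat_ C} (σ : M.ι → N.ι) (f : ∀ i, M.X i ⟶ N.X (σ i)) {i : M.ι} {j : N.ι}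
    (h : σ i ≠ j) : mono σ f i j = 0 := dif_neg h

theorem mono_comp_apply {M N K : Mat_ C} (σ : M.ι → N.ι) (f : ∀ i, M.X i ⟶ N.X (σ i)) (g : N ⟶ K)
    (i : M.ι) (l : K.ι) : (mono σ f ≫ g) i l = f i ≫ g (σ i) l := by
  rw [Mat_.comp_apply, Finset.sum_eq_single (σ i), mono_self]
  · intro j _ hj
    rw [mono_ne _ _ hj.symm, Limits.zero_comp]
  · simp

theorem comp_mono_apply {M N K : Mat_ C} (σ : N.ι ≃ K.ι) (f : ∀ i, N.X i ⟶ K.X (σ i)) (g : M ⟶ N)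
    (i : M.ι) (j : N.ι) : (g ≫ mono σ f) i (σ j) = g i j ≫ f j := by
  rw [Mat_.comp_apply, Finset.sum_eq_single j, mono_self]
  · intro l _ hl
    rw [mono_ne _ _ (fun h => hl (σ.injective h)), Limits.comp_zero]
  · simp

theorem mono_comp_mono {M N K : Mat_ C} (σ : M.ι → N.ι) (f : ∀ i, M.X i ⟶ N.X (σ i))
    (τ : N.ι → K.ι) (g : ∀ i, N.X i ⟶ K.X (τ i)) :
    mono σ f ≫ mono τ g = mono (fun i => τ (σ i)) (fun i => f i ≫ g (σ i)) := by
  refine Mat_.hom_ext _ _ fun i l => ?_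
  rw [mono_comp_apply]
  by_cases h : τ (σ i) = l
  · subst h; rw [mono_self, mono_self (fun i => τ (σ i))]
  · rw [mono_ne _ _ h, mono_ne (fun i => τ (σ i)) _ h, Limits.comp_zero]

theorem mono_id (M : Mat_ C) : mono (fun i => i) (fun i => 𝟙 (M.X i)) = 𝟙 M := by
  refine Mat_.hom_ext _ _ fun i l => ?_
  by_cases h : i = l
  · subst h; rw [mono_self (fun i => i), Mat_.id_apply_self]
  · rw [mono_ne (fun i => i) _ h, Mat_.id_apply_of_ne _ _ _ h]

theorem mono_congr {M N : Mat_ C} (σ : M.ι → N.ι) {f g : ∀ i, M.X i ⟶ N.X (σ i)}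
    (h : ∀ i, f i = g i) : mono σ f = mono σ g := by rw [funext h]

theorem hom_ext_equiv {M N : Mat_ C} {ι : Type} (σ : ι ≃ N.ι) {f g : M ⟶ N}
    (h : ∀ i j, f i (σ j) = g i (σ j)) : f = g :=
  Mat_.hom_ext _ _ fun i j => by
    obtain ⟨j, rfl⟩ := σ.surjective j
    exact h i j

variable [MonoidalCategory C]

/-- The tensor product of `Mat_ C` is the family of the tensor products, -/
abbrev matTensorObj (M N : Mat_ C) : Mat_ C := ⟨M.ι × N.ι, fun p => M.X p.1 ⊗ N.X p.2⟩

/-- and on morphisms the Kronecker product. -/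
abbrev matTensorHom {M N M' N' : Mat_ C} (f : M ⟶ N) (g : M' ⟶ N') :
    matTensorObj M M' ⟶ matTensorObj N N' := matMk fun p q => f p.1 q.1 ⊗ₘ g p.2 q.2

abbrev matUnit : Mat_ C := ⟨Unit, fun _ => 𝟙_ C⟩

abbrev matAssoc (M N K : Mat_ C) :
    matTensorObj (matTensorObj M N) K ≅ matTensorObj M (matTensorObj N K) where
  hom := mono (fun p => (p.1.1, (p.1.2, p.2))) (fun p => (α_ (M.X p.1.1) (N.X p.1.2) (K.X p.2)).hom)
  inv := mono (fun p => ((p.1, p.2.1), p.2.2))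
    (fun p => (α_ (M.X p.1) (N.X p.2.1) (K.X p.2.2)).inv)
  hom_inv_id := by
    rw [mono_comp_mono, ← mono_id]
    exact mono_congr _ fun i => Iso.hom_inv_id _
  inv_hom_id := by
    rw [mono_comp_mono, ← mono_id]
    exact mono_congr _ fun i => Iso.inv_hom_id _

abbrev matLeft (M : Mat_ C) : matTensorObj matUnit M ≅ M where
  hom := mono (fun p => p.2) (fun p => (λ_ (M.X p.2)).hom)
  inv := mono (fun i => ((), i)) (fun i => (λ_ (M.X i)).inv)
  hom_inv_id := by
    rw [mono_comp_mono, ← mono_id]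
    exact mono_congr _ fun i => Iso.hom_inv_id _
  inv_hom_id := by
    rw [mono_comp_mono, ← mono_id]
    exact mono_congr _ fun i => Iso.inv_hom_id _

abbrev matRight (M : Mat_ C) : matTensorObj M matUnit ≅ M where
  hom := mono (fun p => p.1) (fun p => (ρ_ (M.X p.1)).hom)
  inv := mono (fun i => (i, ())) (fun i => (ρ_ (M.X i)).inv)
  hom_inv_id := by
    rw [mono_comp_mono, ← mono_id]
    exact mono_congr _ fun i => Iso.hom_inv_id _
  inv_hom_id := by
    rw [mono_comp_mono, ← mono_id]
    exact mono_congr _ fun i => Iso.inv_hom_id _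

variable [MonoidalPreadditive C]

theorem mono_tensor_mono {M N M' N' : Mat_ C} (σ : M.ι → N.ι) (f : ∀ i, M.X i ⟶ N.X (σ i))
    (σ' : M'.ι → N'.ι) (f' : ∀ i, M'.X i ⟶ N'.X (σ' i)) :
    matTensorHom (mono σ f) (mono σ' f') =
      mono (M := matTensorObj M M') (N := matTensorObj N N') (fun p => (σ p.1, σ' p.2))
        (fun p => f p.1 ⊗ₘ f' p.2) := by
  refine Mat_.hom_ext _ _ ?_
  rintro ⟨i, i'⟩ ⟨j, j'⟩
  change mono σ f i j ⊗ₘ mono σ' f' i' j' = _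
  by_cases h : σ i = j
  · by_cases h' : σ' i' = j'
    · subst h h'
      rw [mono_self, mono_self]
      exact (mono_self (M := matTensorObj M M') (N := matTensorObj N N')
        (fun p => (σ p.1, σ' p.2)) (fun p => f p.1 ⊗ₘ f' p.2) (i, i')).symm
    · rw [mono_ne σ' _ h', MonoidalPreadditive.tensor_zero]
      exact (mono_ne (M := matTensorObj M M') (N := matTensorObj N N') (fun p => (σ p.1, σ' p.2))
        (fun p => f p.1 ⊗ₘ f' p.2) (i := (i, i')) (j := (j, j')) (fun e => h' (congrArg Prod.snd e))).symm
  · rw [mono_ne σ _ h, MonoidalPreadditive.zero_tensor]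
    exact (mono_ne (M := matTensorObj M M') (N := matTensorObj N N') (fun p => (σ p.1, σ' p.2))
      (fun p => f p.1 ⊗ₘ f' p.2) (i := (i, i')) (j := (j, j')) (fun e => h (congrArg Prod.fst e))).symm

theorem id_tensor_mono (M : Mat_ C) {M' N' : Mat_ C} 
    (σ' : M'.ι → N'.ι) (f' : ∀ i, M'.X i ⟶ N'.X (σ' i)) :
    matTensorHom (𝟙 M) (mono σ' f') =
      mono (M := matTensorObj M M') (N := matTensorObj M N') (fun p => (p.1, σ' p.2))
        (fun p => M.X p.1 ◁ f' p.2) := by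
  rw [← mono_id, mono_tensor_mono]
  exact mono_congr _ fun i => id_tensorHom _ _

theorem mono_tensor_id {M N : Mat_ C} (σ : M.ι → N.ι) (f : ∀ i, M.X i ⟶ N.X (σ i)) (M' : Mat_ C) :
    matTensorHom (mono σ f) (𝟙 M') =
      mono (M := matTensorObj M M') (N := matTensorObj N M') (fun p => (σ p.1, p.2))
        (fun p => f p.1 ▷ M'.X p.2) := by
  rw [← mono_id, mono_tensor_mono]
  exact mono_congr _ fun i => tensorHom_id _ _

instance matMonoidalStruct : MonoidalCategoryStruct (Mat_ C) where
  tensorObj := matTensorObj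
  tensorHom := matTensorHom
  whiskerLeft M _ _ f := matTensorHom (𝟙 M) f
  whiskerRight f M := matTensorHom f (𝟙 M)
  tensorUnit := matUnit
  associator := matAssoc
  leftUnitor := matLeft
  rightUnitor := matRight

theorem tensorHom_sum {ι : Type} {X Y X' Y' : C} (s : Finset ι) (f : X ⟶ Y) (g : ι → (X' ⟶ Y')) :
    f ⊗ₘ (∑ i ∈ s, g i) = ∑ i ∈ s, f ⊗ₘ g i := by
  simp only [MonoidalCategory.tensorHom_def, whiskerLeft_sum, Preadditive.comp_sum]

theorem sum_tensorHom {ι : Type} {X Y X' Y' : C} (s : Finset ι) (f : ι → (X ⟶ Y)) (g : X' ⟶ Y') :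
    (∑ i ∈ s, f i) ⊗ₘ g = ∑ i ∈ s, f i ⊗ₘ g := by
  simp only [MonoidalCategory.tensorHom_def, sum_whiskerRight, Preadditive.sum_comp]

theorem mat_tensor_comp {X₁ Y₁ Z₁ X₂ Y₂ Z₂ : Mat_ C} (f₁ : X₁ ⟶ Y₁) (f₂ : X₂ ⟶ Y₂)
    (g₁ : Y₁ ⟶ Z₁) (g₂ : Y₂ ⟶ Z₂) : matTensorHom f₁ f₂ ≫ matTensorHom g₁ g₂ =
      matTensorHom (f₁ ≫ g₁) (f₂ ≫ g₂) := by
  refine Mat_.hom_ext _ _ ?_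
  rintro ⟨i, i'⟩ ⟨l, l'⟩
  change ∑ j : Y₁.ι × Y₂.ι, (f₁ i j.1 ⊗ₘ f₂ i' j.2) ≫ (g₁ j.1 l ⊗ₘ g₂ j.2 l') =
    (∑ j, f₁ i j ≫ g₁ j l) ⊗ₘ (∑ j, f₂ i' j ≫ g₂ j l')
  simp only [sum_tensorHom, tensorHom_sum, tensorHom_comp_tensorHom, Fintype.sum_prod_type_right]

theorem mat_tensor_id (X Y : Mat_ C) : matTensorHom (𝟙 X) (𝟙 Y) = 𝟙 (matTensorObj X Y) := by
  rw [← mono_id Y, id_tensor_mono, ← mono_id]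
  exact mono_congr _ fun i => whiskerLeft_id _ _

theorem mat_associator_naturality {X₁ X₂ X₃ Y₁ Y₂ Y₃ : Mat_ C} (f₁ : X₁ ⟶ Y₁)
    (f₂ : X₂ ⟶ Y₂) (f₃ : X₃ ⟶ Y₃) :
    matTensorHom (matTensorHom f₁ f₂) f₃ ≫ (matAssoc Y₁ Y₂ Y₃).hom =
      (matAssoc X₁ X₂ X₃).hom ≫ matTensorHom f₁ (matTensorHom f₂ f₃) := by
  refine hom_ext_equiv (Equiv.prodAssoc Y₁.ι Y₂.ι Y₃.ι) fun i j => ?_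
  rw [mono_comp_apply]
  refine (comp_mono_apply (N := matTensorObj (matTensorObj Y₁ Y₂) Y₃)
    (K := matTensorObj Y₁ (matTensorObj Y₂ Y₃)) (Equiv.prodAssoc Y₁.ι Y₂.ι Y₃.ι) _ _ i j).trans ?_
  exact associator_naturality _ _ _

theorem mat_leftUnitor_naturality {X Y : Mat_ C} (f : X ⟶ Y) :
    matTensorHom (𝟙 matUnit) f ≫ (matLeft Y).hom = (matLeft X).hom ≫ f := by
  refine hom_ext_equiv (Equiv.punitProd Y.ι) fun i j => ?_
  rw [mono_comp_apply]
  refine (comp_mono_apply (N := matTensorObj matUnit Y) (Equiv.punitProd Y.ι) _ _ i j).trans ?_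
  change (((𝟙 matUnit : matUnit (C := C) ⟶ _) () ()) ⊗ₘ f i.2 j.2) ≫ (λ_ _).hom = _
  rw [Mat_.id_apply_self, id_tensorHom]
  exact leftUnitor_naturality _

theorem mat_rightUnitor_naturality {X Y : Mat_ C} (f : X ⟶ Y) :
    matTensorHom f (𝟙 matUnit) ≫ (matRight Y).hom = (matRight X).hom ≫ f := by
  refine hom_ext_equiv (Equiv.prodPUnit Y.ι) fun i j => ?_
  rw [mono_comp_apply]
  refine (comp_mono_apply (N := matTensorObj Y matUnit) (Equiv.prodPUnit Y.ι) _ _ i j).trans ?_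
  change (f i.1 j.1 ⊗ₘ ((𝟙 matUnit : matUnit (C := C) ⟶ _) () ())) ≫ (ρ_ _).hom = _
  rw [Mat_.id_apply_self, tensorHom_id]
  exact rightUnitor_naturality _

theorem mat_pentagon (W X Y Z : Mat_ C) :
    matTensorHom (matAssoc W X Y).hom (𝟙 Z) ≫ (matAssoc W (matTensorObj X Y) Z).hom ≫
      matTensorHom (𝟙 W) (matAssoc X Y Z).hom =
    (matAssoc (matTensorObj W X) Y Z).hom ≫ (matAssoc W X (matTensorObj Y Z)).hom := by
  rw [mono_tensor_id, id_tensor_mono, mono_comp_mono, mono_comp_mono, mono_comp_mono]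
  exact mono_congr _ fun i => pentagon _ _ _ _

theorem mat_triangle (X Y : Mat_ C) :
    (matAssoc X matUnit Y).hom ≫ matTensorHom (𝟙 X) (matLeft Y).hom =
      matTensorHom (matRight X).hom (𝟙 Y) := by
  rw [mono_tensor_id, id_tensor_mono, mono_comp_mono]
  exact mono_congr _ fun i => triangle _ _

instance matMonoidal : MonoidalCategory (Mat_ C) :=
  MonoidalCategory.ofTensorHom
    (id_tensorHom_id := mat_tensor_id)
    (id_tensorHom := fun _ _ _ _ => rfl)
    (tensorHom_id := fun _ _ => rfl)
    (tensorHom_comp_tensorHom := mat_tensor_comp)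
    (associator_naturality := mat_associator_naturality)
    (leftUnitor_naturality := mat_leftUnitor_naturality)
    (rightUnitor_naturality := mat_rightUnitor_naturality)
    (pentagon := mat_pentagon)
    (triangle := mat_triangle)

instance matMonoidalPreadditive : MonoidalPreadditive (Mat_ C) where
  whiskerLeft_zero := Mat_.hom_ext _ _ fun _ _ => MonoidalPreadditive.tensor_zero _
  zero_whiskerRight := Mat_.hom_ext _ _ fun _ _ => MonoidalPreadditive.zero_tensor _
  whiskerLeft_add f g := Mat_.hom_ext _ _ fun _ _ =>
    MonoidalPreadditive.tensor_add _ (f _ _) (g _ _)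
  add_whiskerRight f g := Mat_.hom_ext _ _ fun _ _ =>
    MonoidalPreadditive.add_tensor (f _ _) (g _ _) _

theorem tensorHom_smul' (k : Type w) [Semiring k] [Linear k C] [MonoidalLinear k C]
    {X Y X' Y' : C} (f : X ⟶ Y) (r : k) (g : X' ⟶ Y') : f ⊗ₘ (r • g) = r • (f ⊗ₘ g) := by
  simp [MonoidalCategory.tensorHom_def]

theorem smul_tensorHom' (k : Type w) [Semiring k] [Linear k C] [MonoidalLinear k C]
    {X Y X' Y' : C} (f : X ⟶ Y) (r : k) (g : X' ⟶ Y') : (r • f) ⊗ₘ g = r • (f ⊗ₘ g) := by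
  simp [MonoidalCategory.tensorHom_def]

instance matMonoidalLinear (k : Type w) [Semiring k] [Linear k C] [MonoidalLinear k C] :
    MonoidalLinear k (Mat_ C) where
  whiskerLeft_smul _ _ _ r f := Mat_.hom_ext _ _ fun _ _ => tensorHom_smul' k _ r (f _ _)
  smul_whiskerRight r _ _ f _ := Mat_.hom_ext _ _ fun _ _ => smul_tensorHom' k (f _ _) r _

variable [SymmetricCategory C]

abbrev matBraiding (M N : Mat_ C) : matTensorObj M N ≅ matTensorObj N M where
  hom := mono (fun p => (p.2, p.1)) (fun p => (β_ (M.X p.1) (N.X p.2)).hom)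
  inv := mono (fun p => (p.2, p.1)) (fun p => (β_ (M.X p.2) (N.X p.1)).inv)
  hom_inv_id := by
    rw [mono_comp_mono, ← mono_id]
    exact mono_congr _ fun i => Iso.hom_inv_id _
  inv_hom_id := by
    rw [mono_comp_mono, ← mono_id]
    exact mono_congr _ fun i => Iso.inv_hom_id _

theorem mat_braiding_naturality {X₁ X₂ Y₁ Y₂ : Mat_ C} (f₁ : X₁ ⟶ Y₁) (f₂ : X₂ ⟶ Y₂) :
    matTensorHom f₁ f₂ ≫ (matBraiding Y₁ Y₂).hom =
      (matBraiding X₁ X₂).hom ≫ matTensorHom f₂ f₁ := by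
  refine hom_ext_equiv (Equiv.prodComm Y₁.ι Y₂.ι) fun i j => ?_
  rw [mono_comp_apply]
  refine (comp_mono_apply (N := matTensorObj Y₁ Y₂) (K := matTensorObj Y₂ Y₁)
    (Equiv.prodComm Y₁.ι Y₂.ι) _ _ i j).trans ?_
  exact BraidedCategory.braiding_naturality _ _

theorem mat_hexagon_forward (X Y Z : Mat_ C) :
    (matAssoc X Y Z).hom ≫ (matBraiding X (matTensorObj Y Z)).hom ≫ (matAssoc Y Z X).hom =
      matTensorHom (matBraiding X Y).hom (𝟙 Z) ≫ (matAssoc Y X Z).hom ≫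
        matTensorHom (𝟙 Y) (matBraiding X Z).hom := by
  rw [mono_tensor_id, id_tensor_mono, mono_comp_mono, mono_comp_mono, mono_comp_mono,
    mono_comp_mono]
  exact mono_congr _ fun i => BraidedCategory.hexagon_forward _ _ _

theorem mat_hexagon_reverse (X Y Z : Mat_ C) :
    (matAssoc X Y Z).inv ≫ (matBraiding (matTensorObj X Y) Z).hom ≫ (matAssoc Z X Y).inv =
      matTensorHom (𝟙 X) (matBraiding Y Z).hom ≫ (matAssoc X Z Y).inv ≫
        matTensorHom (matBraiding X Z).hom (𝟙 Y) := by
  rw [mono_tensor_id, id_tensor_mono, mono_comp_mono, mono_comp_mono, mono_comp_mono,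
    mono_comp_mono]
  exact mono_congr _ fun i => BraidedCategory.hexagon_reverse _ _ _

theorem mat_symmetry (X Y : Mat_ C) :
    (matBraiding X Y).hom ≫ (matBraiding Y X).hom = 𝟙 (matTensorObj X Y) := by
  rw [mono_comp_mono, ← mono_id]
  exact mono_congr _ fun i => SymmetricCategory.symmetry _ _

instance matSymmetric : SymmetricCategory (Mat_ C) where
  braiding := matBraiding
  braiding_naturality_right X _ _ f := mat_braiding_naturality (𝟙 X) f
  braiding_naturality_left f Z := mat_braiding_naturality f (𝟙 Z)
  hexagon_forward := mat_hexagon_forward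
  hexagon_reverse := mat_hexagon_reverse
  symmetry := mat_symmetry

end Mat
section LocalUnit
universe v u w
variable {D : Type u} [Category.{v} D] [MonoidalCategory D]

/-- An object property closed under tensor products, together with an object `U` having the
property and a morphism `j : U ⟶ 𝟙` that becomes invertible after tensoring with any object that
has the property. The full subcategory is then monoidal with the tensor product of `D` and with
unit object `U`. -/
structure LocalUnit (P : ObjectProperty D) where
  tensor : ∀ X Y, P X → P Y → P (X ⊗ Y)
  U : D
  prop : P U
  j : U ⟶ 𝟙_ D
  isoL : ∀ X, P X → IsIso (j ▷ X)
  isoR : ∀ X, P X → IsIso (X ◁ j)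

variable {P : ObjectProperty D} (u : LocalUnit P)

namespace LocalUnit

abbrev left (X : P.FullSubcategory) : u.U ⊗ X.obj ≅ X.obj :=
  have := u.isoL X.obj X.property
  asIso (u.j ▷ X.obj) ≪≫ λ_ X.obj

abbrev right (X : P.FullSubcategory) : X.obj ⊗ u.U ≅ X.obj :=
  have := u.isoR X.obj X.property
  asIso (X.obj ◁ u.j) ≪≫ ρ_ X.obj

abbrev monoidalStruct : MonoidalCategoryStruct P.FullSubcategory where
  tensorObj X Y := ⟨X.obj ⊗ Y.obj, u.tensor _ _ X.property Y.property⟩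
  tensorHom f g := ObjectProperty.homMk (f.hom ⊗ₘ g.hom)
  whiskerLeft X _ _ f := ObjectProperty.homMk (X.obj ◁ f.hom)
  whiskerRight f X := ObjectProperty.homMk (f.hom ▷ X.obj)
  tensorUnit := ⟨u.U, u.prop⟩
  associator X Y Z := P.isoMk (α_ X.obj Y.obj Z.obj)
  leftUnitor X := P.isoMk (u.left X)
  rightUnitor X := P.isoMk (u.right X)

abbrev monoidal : MonoidalCategory P.FullSubcategory :=
  letI := u.monoidalStruct
  MonoidalCategory.ofTensorHom
    (id_tensorHom_id := fun X Y => ObjectProperty.hom_ext _ (id_tensorHom_id X.obj Y.obj))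
    (id_tensorHom := fun X _ _ f => ObjectProperty.hom_ext _ (id_tensorHom X.obj f.hom))
    (tensorHom_id := fun f X => ObjectProperty.hom_ext _ (tensorHom_id f.hom X.obj))
    (tensorHom_comp_tensorHom := fun f₁ f₂ g₁ g₂ => ObjectProperty.hom_ext _
      (tensorHom_comp_tensorHom f₁.hom f₂.hom g₁.hom g₂.hom))
    (associator_naturality := fun f₁ f₂ f₃ => ObjectProperty.hom_ext _
      (associator_naturality f₁.hom f₂.hom f₃.hom))
    (leftUnitor_naturality := fun {X Y} f => ObjectProperty.hom_ext _ (by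
      change (𝟙 u.U ⊗ₘ f.hom) ≫ (u.j ▷ Y.obj) ≫ (λ_ Y.obj).hom =
        ((u.j ▷ X.obj) ≫ (λ_ X.obj).hom) ≫ f.hom
      rw [id_tensorHom, whisker_exchange_assoc, Category.assoc, leftUnitor_naturality]))
    (rightUnitor_naturality := fun {X Y} f => ObjectProperty.hom_ext _ (by
      change (f.hom ⊗ₘ 𝟙 u.U) ≫ (Y.obj ◁ u.j) ≫ (ρ_ Y.obj).hom =
        ((X.obj ◁ u.j) ≫ (ρ_ X.obj).hom) ≫ f.hom
      rw [tensorHom_id, ← whisker_exchange_assoc, Category.assoc, rightUnitor_naturality]))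
    (pentagon := fun W X Y Z => ObjectProperty.hom_ext _ (by
      change ((α_ _ _ _).hom ⊗ₘ 𝟙 _) ≫ (α_ _ _ _).hom ≫ (𝟙 _ ⊗ₘ (α_ _ _ _).hom) = _
      rw [tensorHom_id, id_tensorHom]
      exact pentagon W.obj X.obj Y.obj Z.obj))
    (triangle := fun X Y => ObjectProperty.hom_ext _ (by
      change (α_ X.obj u.U Y.obj).hom ≫ (𝟙 X.obj ⊗ₘ ((u.j ▷ Y.obj) ≫ (λ_ Y.obj).hom)) =
        ((X.obj ◁ u.j) ≫ (ρ_ X.obj).hom) ⊗ₘ 𝟙 Y.obj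
      rw [tensorHom_id, id_tensorHom, MonoidalCategory.whiskerLeft_comp, comp_whiskerRight,
        ← triangle]
      simp))

theorem monoidalPreadditive [Preadditive D] [MonoidalPreadditive D] :
    letI := u.monoidal
    MonoidalPreadditive P.FullSubcategory :=
  letI := u.monoidal
  { whiskerLeft_zero := ObjectProperty.hom_ext _ MonoidalPreadditive.whiskerLeft_zero
    zero_whiskerRight := ObjectProperty.hom_ext _ MonoidalPreadditive.zero_whiskerRight
    whiskerLeft_add := fun f g => ObjectProperty.hom_ext _
      (MonoidalPreadditive.whiskerLeft_add f.hom g.hom)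
    add_whiskerRight := fun f g => ObjectProperty.hom_ext _
      (MonoidalPreadditive.add_whiskerRight f.hom g.hom) }

theorem monoidalLinear (k : Type w) [Semiring k] [Preadditive D] [Linear k D]
    [MonoidalPreadditive D] [MonoidalLinear k D] :
    letI := u.monoidal
    haveI := u.monoidalPreadditive
    MonoidalLinear k P.FullSubcategory :=
  letI := u.monoidal
  haveI := u.monoidalPreadditive
  { whiskerLeft_smul := fun X _ _ r f => ObjectProperty.hom_ext _
      (MonoidalLinear.whiskerLeft_smul X.obj r f.hom)
    smul_whiskerRight := fun r _ _ f X => ObjectProperty.hom_ext _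
      (MonoidalLinear.smul_whiskerRight r f.hom X.obj) }

abbrev symmetric [SymmetricCategory D] :
    letI := u.monoidal
    SymmetricCategory P.FullSubcategory :=
  letI := u.monoidal
  { braiding := fun X Y => P.isoMk (β_ X.obj Y.obj)
    braiding_naturality_right := fun X _ _ f => ObjectProperty.hom_ext _
      (BraidedCategory.braiding_naturality_right X.obj f.hom)
    braiding_naturality_left := fun f Z => ObjectProperty.hom_ext _
      (BraidedCategory.braiding_naturality_left f.hom Z.obj)
    hexagon_forward := fun X Y Z => ObjectProperty.hom_ext _
      (BraidedCategory.hexagon_forward X.obj Y.obj Z.obj)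
    hexagon_reverse := fun X Y Z => ObjectProperty.hom_ext _
      (BraidedCategory.hexagon_reverse X.obj Y.obj Z.obj)
    symmetry := fun X Y => ObjectProperty.hom_ext _ (SymmetricCategory.symmetry X.obj Y.obj) }

end LocalUnit
end LocalUnit
section W

/-- The Boolean semiring: the elements `0` and `1`, with `1 + 1 = 1`. -/
def BoolSemiring : Type := Bool

instance : DecidableEq BoolSemiring := inferInstanceAs (DecidableEq Bool)
instance : Fintype BoolSemiring := inferInstanceAs (Fintype Bool)

instance : Zero BoolSemiring := ⟨false⟩
instance : One BoolSemiring := ⟨true⟩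
instance : Add BoolSemiring := ⟨or⟩
instance : Mul BoolSemiring := ⟨and⟩

instance : CommSemiring BoolSemiring where
  nsmul := nsmulRec
  zero_add := by decide
  add_zero := by decide
  add_comm := by decide
  add_assoc := by decide
  zero_mul := by decide
  mul_zero := by decide
  one_mul := by decide
  mul_one := by decide
  mul_comm := by decide
  mul_assoc := by decide
  left_distrib := by decide
  right_distrib := by decide

/-- The objects `W(A)`, for `A` a finite set, of the category of finite free modules over the
Boolean semiring. -/
structure WCat : Type 1 where
  of ::
  A : Type
  [fintype : Fintype A]

attribute [instance] WCat.fintype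

open scoped Classical in
/-- A morphism `W(A) ⟶ W(B)` is a `B × A` matrix, and composition is matrix multiplication. -/
instance : Category WCat where
  Hom X Y := Matrix Y.A X.A BoolSemiring
  id X := (1 : Matrix X.A X.A BoolSemiring)
  comp {X Y Z} (f : Matrix Y.A X.A BoolSemiring) (g : Matrix Z.A Y.A BoolSemiring) :=
    (g * f : Matrix Z.A X.A BoolSemiring)
  id_comp _ := Matrix.mul_one _
  comp_id _ := Matrix.one_mul _
  assoc _ _ _ := (Matrix.mul_assoc _ _ _).symm

namespace WCat

/-- A matrix as a morphism. -/
abbrev mk {X Y : WCat} (f : Matrix Y.A X.A BoolSemiring) : X ⟶ Y := f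

/-- The underlying matrix of a morphism. -/
abbrev mat {X Y : WCat} (f : X ⟶ Y) : Matrix Y.A X.A BoolSemiring := f

theorem comp_eq {X Y Z : WCat} (f : X ⟶ Y) (g : Y ⟶ Z) : mat (f ≫ g) = mat g * mat f := rfl

theorem id_apply_self (X : WCat) (a : X.A) : mat (𝟙 X) a a = 1 := by
  classical exact Matrix.one_apply_eq a

open scoped Classical in
/-- The morphism given by the permutation matrix of a bijection. -/
def perm {X Y : WCat} (e : X.A ≃ Y.A) : X ⟶ Y :=
  mk ((1 : Matrix Y.A Y.A BoolSemiring).submatrix id e)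

theorem comp_perm {X Y Z : WCat} (f : X ⟶ Y) (e : Y.A ≃ Z.A) :
    f ≫ perm e = mk ((mat f).submatrix e.symm id) := by
  classical
  change (1 : Matrix Z.A Z.A BoolSemiring).submatrix id e * mat f = _
  ext i j
  simp [Matrix.mul_apply, Matrix.one_apply, ← Equiv.symm_apply_eq]

theorem perm_comp {X Y Z : WCat} (e : X.A ≃ Y.A) (f : Y ⟶ Z) :
    perm e ≫ f = mk ((mat f).submatrix id e) := by
  classical
  change mat f * (1 : Matrix Y.A Y.A BoolSemiring).submatrix id e = _
  ext i j
  simp [Matrix.mul_apply, Matrix.one_apply]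

theorem perm_perm {X Y Z : WCat} (e : X.A ≃ Y.A) (f : Y.A ≃ Z.A) :
    (perm e : X ⟶ Y) ≫ (perm f : Y ⟶ Z) = perm (e.trans f) := by
  rw [perm_comp]; rfl

theorem perm_refl (X : WCat) : perm (Equiv.refl X.A) = 𝟙 X := rfl

abbrev permIso {X Y : WCat} (e : X.A ≃ Y.A) : X ≅ Y where
  hom := perm e
  inv := perm e.symm
  hom_inv_id := by rw [perm_perm, Equiv.self_trans_symm, perm_refl]
  inv_hom_id := by rw [perm_perm, Equiv.symm_trans_self, perm_refl]

/-- The tensor product is given on objects by `W(A) ⊗ W(B) = W(A × B)`, -/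
abbrev tensor (X Y : WCat) : WCat := of (X.A × Y.A)

/-- and on morphisms by the Kronecker product. -/
def kron {X Y X' Y' : WCat} (f : X ⟶ Y) (g : X' ⟶ Y') : tensor X X' ⟶ tensor Y Y' :=
  mk (Matrix.kroneckerMap (· * ·) (mat f) (mat g))

theorem perm_kron {X Y X' Y' : WCat} (e : X.A ≃ Y.A) (f : X'.A ≃ Y'.A) :
    kron (perm e : X ⟶ Y) (perm f : X' ⟶ Y') =
      perm (X := tensor X X') (Y := tensor Y Y') (e.prodCongr f) := by
  classical
  change Matrix.kroneckerMap (· * ·) _ _ = Matrix.submatrix _ _ _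
  ext ⟨i, i'⟩ ⟨j, j'⟩
  simp [perm, Matrix.one_apply, Prod.ext_iff, ite_and]
  split_ifs <;> rfl

theorem kron_id (X Y : WCat) : kron (𝟙 X) (𝟙 Y) = 𝟙 (tensor X Y) := by
  rw [← perm_refl, ← perm_refl, perm_kron]; rfl

theorem kron_comp {X₁ Y₁ Z₁ X₂ Y₂ Z₂ : WCat} (f₁ : X₁ ⟶ Y₁) (f₂ : X₂ ⟶ Y₂)
    (g₁ : Y₁ ⟶ Z₁) (g₂ : Y₂ ⟶ Z₂) : kron f₁ f₂ ≫ kron g₁ g₂ = kron (f₁ ≫ g₁) (f₂ ≫ g₂) :=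
  (Matrix.mul_kronecker_mul (mat g₁) (mat f₁) (mat g₂) (mat f₂)).symm

instance : MonoidalCategoryStruct WCat where
  tensorObj := tensor
  tensorHom := kron
  whiskerLeft X _ _ f := kron (𝟙 X) f
  whiskerRight f X := kron f (𝟙 X)
  tensorUnit := of Unit
  associator X Y Z := permIso (X := tensor (tensor X Y) Z) (Y := tensor X (tensor Y Z))
    (Equiv.prodAssoc X.A Y.A Z.A)
  leftUnitor X := permIso (X := tensor (of Unit) X) (Equiv.punitProd X.A)
  rightUnitor X := permIso (X := tensor X (of Unit)) (Equiv.prodPUnit X.A)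

instance : MonoidalCategory WCat :=
  MonoidalCategory.ofTensorHom
    (id_tensorHom_id := kron_id)
    (id_tensorHom := fun _ _ _ _ => rfl)
    (tensorHom_id := fun _ _ => rfl)
    (tensorHom_comp_tensorHom := kron_comp)
    (associator_naturality := fun f₁ f₂ f₃ => by
      change kron (kron f₁ f₂) f₃ ≫ perm _ = perm _ ≫ kron f₁ (kron f₂ f₃)
      rw [comp_perm, perm_comp]
      exact Matrix.ext fun i j => mul_assoc _ _ _)
    (leftUnitor_naturality := fun f => by
      change kron (𝟙 _) f ≫ perm _ = perm _ ≫ f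
      rw [comp_perm, perm_comp]
      refine Matrix.ext fun i j => ?_
      change mat (𝟙 (of Unit)) () () * mat f i j.2 = mat f i j.2
      rw [id_apply_self, one_mul])
    (rightUnitor_naturality := fun f => by
      change kron f (𝟙 _) ≫ perm _ = perm _ ≫ f
      rw [comp_perm, perm_comp]
      refine Matrix.ext fun i j => ?_
      change mat f i j.1 * mat (𝟙 (of Unit)) () () = mat f i j.1
      rw [id_apply_self, mul_one])
    (pentagon := fun W X Y Z => by
      change kron (perm _) (perm (Equiv.refl _)) ≫ perm _ ≫ kron (perm (Equiv.refl _)) (perm _)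
        = perm _ ≫ perm _
      rw [perm_kron, perm_kron, perm_perm, perm_perm, perm_perm]
      rfl)
    (triangle := fun X Y => by
      change perm _ ≫ kron (perm (Equiv.refl _)) (perm _) = kron (perm _) (perm (Equiv.refl _))
      rw [perm_kron, perm_kron, perm_perm]
      rfl)

instance : SymmetricCategory WCat where
  braiding X Y := permIso (X := tensor X Y) (Y := tensor Y X) (Equiv.prodComm X.A Y.A)
  braiding_naturality_right X _ _ f := by
    change kron (𝟙 X) f ≫ perm _ = perm _ ≫ kron f (𝟙 X)
    rw [comp_perm, perm_comp]
    exact Matrix.ext fun i j => mul_comm _ _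
  braiding_naturality_left f Z := by
    change kron f (𝟙 Z) ≫ perm _ = perm _ ≫ kron (𝟙 Z) f
    rw [comp_perm, perm_comp]
    exact Matrix.ext fun i j => mul_comm _ _
  hexagon_forward X Y Z := by
    change perm _ ≫ perm _ ≫ perm _ = kron (perm _) (perm (Equiv.refl _)) ≫ perm _ ≫
      kron (perm (Equiv.refl _)) (perm _)
    rw [perm_kron, perm_kron, perm_perm, perm_perm, perm_perm, perm_perm]
    rfl
  hexagon_reverse X Y Z := by
    change perm (Equiv.symm _) ≫ perm _ ≫ perm (Equiv.symm _) =
      kron (perm (Equiv.refl _)) (perm _) ≫ perm (Equiv.symm _) ≫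
        kron (perm _) (perm (Equiv.refl _))
    rw [perm_kron, perm_kron, perm_perm, perm_perm, perm_perm, perm_perm]
    rfl
  symmetry X Y := by
    change perm _ ≫ perm _ = perm (Equiv.refl _)
    rw [perm_perm]
    rfl

/-- The morphism `W(A) ⟶ W(B)` given by the zero matrix. -/
def zero (X Y : WCat) : X ⟶ Y := mk 0

theorem zero_comp {X Y Z : WCat} (f : Y ⟶ Z) : zero X Y ≫ f = zero X Z := Matrix.mul_zero _

theorem comp_zero {X Y Z : WCat} (f : X ⟶ Y) : f ≫ zero Y Z = zero X Z := Matrix.zero_mul _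

theorem zero_tensor (X Y : WCat) : zero X X ⊗ₘ 𝟙 Y = zero (X ⊗ Y) (X ⊗ Y) :=
  Matrix.zero_kronecker _

theorem tensor_zero (X Y : WCat) : 𝟙 X ⊗ₘ zero Y Y = zero (X ⊗ Y) (X ⊗ Y) :=
  Matrix.kronecker_zero _

end WCat
end W
section One
open Idempotents
universe w
variable (k : Type w) [Field k]

/-- The additive-Karoubi envelope of the `k`-linearization of `WCat`: the idempotent completion of
the category of matrices over the linearization. -/
abbrev WSharp : Type _ := Karoubi (Mat_ (Free k WCat))

variable {k}

/-- The endomorphism `[0]` of an object of the linearization of `WCat`. -/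
def zeroFree (X : Free k WCat) : X ⟶ X := fsingle (C := WCat) (WCat.zero X X) (1 : k)

/-- The endomorphism `[0]` of an object of the additive envelope: the diagonal matrix with
entries `[0]`. -/
def zeroMat (M : Mat_ (Free k WCat)) : M ⟶ M := mono (fun i => i) fun i => zeroFree (M.X i)

theorem zeroFree_comm' {X Y : WCat} (f : Free.of k X ⟶ Free.of k Y) :
    fsingle (WCat.zero X X) (1 : k) ≫ f = f ≫ fsingle (WCat.zero Y Y) (1 : k) := by
  induction f using free_induction with
  | h0 => simp only [Limits.zero_comp, Limits.comp_zero]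
  | ha a b ha hb => simp only [Preadditive.add_comp, Preadditive.comp_add, ha, hb]
  | hs a r => simp only [fsingle_comp, WCat.zero_comp, WCat.comp_zero, mul_comm]

theorem zeroFree_comm {X Y : Free k WCat} (f : X ⟶ Y) : zeroFree X ≫ f = f ≫ zeroFree Y :=
  zeroFree_comm' (X := X) (Y := Y) f

theorem zeroFree_idem' (X : WCat) :
    fsingle (WCat.zero X X) (1 : k) ≫ fsingle (WCat.zero X X) 1 = fsingle (WCat.zero X X) 1 := by
  rw [fsingle_comp, WCat.zero_comp, mul_one]

theorem zeroFree_idem (X : Free k WCat) : zeroFree X ≫ zeroFree X = zeroFree X :=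
  zeroFree_idem' (k := k) X

theorem zeroFree_tensor' (X Y : WCat) : freeTensorHom (fsingle (WCat.zero X X) (1 : k))
    (𝟙 (Free.of k Y)) = fsingle (WCat.zero (X ⊗ Y) (X ⊗ Y)) 1 := by
  rw [freeTensorHom_id_right, ← tensorHom_id, WCat.zero_tensor]

theorem zeroFree_tensor (X Y : Free k WCat) : zeroFree X ⊗ₘ 𝟙 Y = zeroFree (X ⊗ Y) :=
  zeroFree_tensor' (k := k) X Y

theorem tensor_zeroFree' (X Y : WCat) : freeTensorHom (𝟙 (Free.of k X))
    (fsingle (WCat.zero Y Y) (1 : k)) = fsingle (WCat.zero (X ⊗ Y) (X ⊗ Y)) 1 := by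
  rw [freeTensorHom_id_left, ← id_tensorHom, WCat.tensor_zero]

theorem tensor_zeroFree (X Y : Free k WCat) : 𝟙 X ⊗ₘ zeroFree Y = zeroFree (X ⊗ Y) :=
  tensor_zeroFree' (k := k) X Y

theorem zeroMat_comm {M N : Mat_ (Free k WCat)} (f : M ⟶ N) : zeroMat M ≫ f = f ≫ zeroMat N := by
  refine Mat_.hom_ext _ _ fun i j => ?_
  refine (mono_comp_apply _ _ _ _ _).trans ?_
  refine Eq.trans ?_ (comp_mono_apply (Equiv.refl N.ι) _ _ _ _).symm
  exact zeroFree_comm _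

theorem zeroMat_idem (M : Mat_ (Free k WCat)) : zeroMat M ≫ zeroMat M = zeroMat M :=
  (mono_comp_mono _ _ _ _).trans (mono_congr _ fun _ => zeroFree_idem _)

theorem zeroMat_tensor (M N : Mat_ (Free k WCat)) : zeroMat M ⊗ₘ 𝟙 N = zeroMat (M ⊗ N) :=
  (mono_tensor_id _ _ _).trans (mono_congr _ fun _ => (tensorHom_id _ _).symm.trans
    (zeroFree_tensor _ _))

theorem tensor_zeroMat (M N : Mat_ (Free k WCat)) : 𝟙 M ⊗ₘ zeroMat N = zeroMat (M ⊗ N) :=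
  (id_tensor_mono _ _ _).trans (mono_congr _ fun _ => (id_tensorHom _ _).symm.trans
    (tensor_zeroFree _ _))

/-- The endomorphism `[0]` of an object of the additive-Karoubi envelope. -/
def zeroEnd (X : WSharp k) : X ⟶ X :=
  ⟨X.p ≫ zeroMat X.X, by rw [Category.assoc, zeroMat_comm, X.idem_assoc, X.idem_assoc]⟩

theorem zeroEnd_f (X : WSharp k) : (zeroEnd X).f = X.p ≫ zeroMat X.X := rfl

variable (k) in
/-- The objects `X` of the additive-Karoubi envelope with `X = X₁`, that is, those on which
`[0]` is zero. -/
def IsOne : ObjectProperty (WSharp k) := fun X => zeroEnd X = 0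

variable (k) in
/-- The summand `k[W]^♯₁`, as a full subcategory of the additive-Karoubi envelope `k[W]^♯`. -/
abbrev WSharpOne : Type _ := (IsOne k).FullSubcategory

theorem isOne_iff (X : WSharp k) : IsOne k X ↔ X.p ≫ zeroMat X.X = 0 :=
  Karoubi.hom_ext_iff

/-- The image `X₁` of the idempotent `1 - [0]` of `X`. -/
def onePart (X : WSharp k) : WSharpOne k where
  obj := ⟨X.X, X.p ≫ (𝟙 _ - zeroMat X.X), by
    have h : (𝟙 X.X - zeroMat X.X) ≫ X.p = X.p ≫ (𝟙 X.X - zeroMat X.X) := by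
      rw [Preadditive.sub_comp, Preadditive.comp_sub, zeroMat_comm, Category.id_comp,
        Category.comp_id]
    have h' : (𝟙 X.X - zeroMat X.X) ≫ (𝟙 X.X - zeroMat X.X) = 𝟙 X.X - zeroMat X.X := by
      rw [Preadditive.sub_comp, Category.id_comp, Preadditive.comp_sub, Category.comp_id,
        zeroMat_idem, sub_self, sub_zero]
    rw [Category.assoc, reassoc_of% h, h', X.idem_assoc]⟩
  property := by
    rw [isOne_iff]
    change (X.p ≫ (𝟙 _ - zeroMat X.X)) ≫ zeroMat X.X = 0
    rw [Category.assoc, Preadditive.sub_comp, zeroMat_idem, Category.id_comp, sub_self,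
      Limits.comp_zero]

theorem onePart_p (X : WSharp k) : (onePart X).obj.p = X.p ≫ (𝟙 _ - zeroMat X.X) := rfl

theorem isOne_tensor (X Y : WSharp k) (hX : IsOne k X) : IsOne k (X ⊗ Y) := by
  rw [isOne_iff] at hX ⊢
  change (X.p ⊗ₘ Y.p) ≫ zeroMat (X.X ⊗ Y.X) = 0
  rw [← zeroMat_tensor, tensorHom_comp_tensorHom, hX, MonoidalPreadditive.zero_tensor]

theorem one_sub_zero_tensor (M : Mat_ (Free k WCat)) {N : Mat_ (Free k WCat)} (p : N ⟶ N)
    (h : p ≫ zeroMat N = 0) : (𝟙 M - zeroMat M) ⊗ₘ p = 𝟙 M ⊗ₘ p := by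
  have h0 : zeroMat M ⊗ₘ p = 0 := by
    have h1 : zeroMat M ⊗ₘ p = (zeroMat M ⊗ₘ 𝟙 N) ≫ (𝟙 M ⊗ₘ p) := by
      rw [tensorHom_comp_tensorHom, Category.id_comp, Category.comp_id]
    rw [h1, zeroMat_tensor, ← tensor_zeroMat, tensorHom_comp_tensorHom, zeroMat_comm, h,
      MonoidalPreadditive.tensor_zero]
  have h2 := MonoidalPreadditive.add_tensor (𝟙 M - zeroMat M) (zeroMat M) p
  rw [sub_add_cancel, h0, add_zero] at h2
  exact h2.symm

theorem tensor_one_sub_zero (M : Mat_ (Free k WCat)) {N : Mat_ (Free k WCat)} (p : N ⟶ N)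
    (h : p ≫ zeroMat N = 0) : p ⊗ₘ (𝟙 M - zeroMat M) = p ⊗ₘ 𝟙 M := by
  have h0 : p ⊗ₘ zeroMat M = 0 := by
    have h1 : p ⊗ₘ zeroMat M = (𝟙 N ⊗ₘ zeroMat M) ≫ (p ⊗ₘ 𝟙 M) := by
      rw [tensorHom_comp_tensorHom, Category.id_comp, Category.comp_id]
    rw [h1, tensor_zeroMat, ← zeroMat_tensor, tensorHom_comp_tensorHom, zeroMat_comm, h,
      MonoidalPreadditive.zero_tensor]
  have h2 := MonoidalPreadditive.tensor_add p (𝟙 M - zeroMat M) (zeroMat M)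
  rw [sub_add_cancel, h0, add_zero] at h2
  exact h2.symm

variable (k) in
/-- The inclusion of the image of `1 - [0]` into the unit object. -/
def oneIncl : (onePart (𝟙_ (WSharp k))).obj ⟶ 𝟙_ (WSharp k) :=
  ⟨(onePart (𝟙_ (WSharp k))).obj.p, by
    have h : (onePart (𝟙_ (WSharp k))).obj.p ≫ (𝟙_ (WSharp k)).p =
        (onePart (𝟙_ (WSharp k))).obj.p := Category.comp_id _
    exact (congrArg (fun t => (onePart (𝟙_ (WSharp k))).obj.p ≫ t) h).trans (Karoubi.idem _)⟩

theorem oneIncl_f : (oneIncl k).f = 𝟙 (𝟙_ (Mat_ (Free k WCat))) - zeroMat _ :=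
  Category.id_comp _

theorem oneIncl_whiskerRight (X : WSharp k) (hX : IsOne k X) : (oneIncl k ▷ X).f = (𝟙 _ ⊗ₘ X.p) := by
  rw [kar_whiskerRight_f, oneIncl_f]
  exact one_sub_zero_tensor _ _ ((isOne_iff _).1 hX)

theorem whiskerLeft_oneIncl (X : WSharp k) (hX : IsOne k X) : (X ◁ oneIncl k).f = (X.p ⊗ₘ 𝟙 _) := by
  rw [kar_whiskerLeft_f, oneIncl_f]
  exact tensor_one_sub_zero _ _ ((isOne_iff _).1 hX)

theorem kar_isIso_of_p {C : Type*} [Category C] {A : C} {p q : A ⟶ A} (hp : p ≫ p = p)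
    (hq : q ≫ q = q) (f : Karoubi.mk A p hp ⟶ Karoubi.mk A q hq) (h1 : f.f = p) (h2 : p = q) :
    IsIso f := by
  subst h2
  have : f = 𝟙 _ := Karoubi.hom_ext _ _ h1
  rw [this]
  infer_instance

variable (k) in
/-- The unit object `𝟙₁` of `k[W]^♯₁`, with its inclusion into the unit object of `k[W]^♯`. -/
def oneUnit : LocalUnit (IsOne k) where
  tensor X Y hX _ := isOne_tensor X Y hX
  U := (onePart (𝟙_ (WSharp k))).obj
  prop := (onePart (𝟙_ (WSharp k))).property
  j := oneIncl k
  isoL X hX := by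
    have h := one_sub_zero_tensor (𝟙_ _) X.p ((isOne_iff X).1 hX)
    have h' : ((onePart (𝟙_ (WSharp k))).obj.p ⊗ₘ X.p) = (𝟙 _ ⊗ₘ X.p) :=
      (congrArg (fun t => t ⊗ₘ X.p) (oneIncl_f (k := k))).trans h
    exact kar_isIso_of_p _ _ _ ((oneIncl_whiskerRight X hX).trans h'.symm) h'
  isoR X hX := by
    have h := tensor_one_sub_zero (𝟙_ _) X.p ((isOne_iff X).1 hX)
    have h' : (X.p ⊗ₘ (onePart (𝟙_ (WSharp k))).obj.p) = (X.p ⊗ₘ 𝟙 _) :=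
      (congrArg (fun t => X.p ⊗ₘ t) (oneIncl_f (k := k))).trans h
    exact kar_isIso_of_p _ _ _ ((whiskerLeft_oneIncl X hX).trans h'.symm) h'

instance wMonoidal : MonoidalCategory (WSharpOne k) := (oneUnit k).monoidal
instance wSymmetric : SymmetricCategory (WSharpOne k) := (oneUnit k).symmetric
instance wMonoidalPreadditive : MonoidalPreadditive (WSharpOne k) := (oneUnit k).monoidalPreadditive
instance wMonoidalLinear : MonoidalLinear k (WSharpOne k) := (oneUnit k).monoidalLinear k

/-- The object `[W(A)]` of `k[W]^♯`. -/
def objW (k : Type w) [Field k] (A : Type) [Fintype A] : WSharp k :=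
  (toKaroubi _).obj ((Mat_.embedding _).obj (Free.of k (WCat.of A)))

/-- The object `[W(A)]₁` of `k[W]^♯₁`. -/
def objWOne (k : Type w) [Field k] (A : Type) [Fintype A] : WSharpOne k := onePart (objW k A)

end One
section GSets
open MulAction
universe w

/-- Roelcke precompactness: `U \ G / V` is finite for all open subgroups `U` and `V`. -/
class RoelckePrecompact (G : Type) [Group G] [TopologicalSpace G] : Prop where
  finite_doubleCoset : ∀ U V : Subgroup G, IsOpen (U : Set G) → IsOpen (V : Set G) →
    Finite (DoubleCoset.Quotient (U : Set G) (V : Set G))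

/-- A finitary smooth `G`-set: every stabilizer is open, and there are finitely many orbits. -/
structure FinGSet (G : Type) [Group G] [TopologicalSpace G] : Type 1 where
  carrier : Type
  [action : MulAction G carrier]
  smooth : ∀ x : carrier, IsOpen (stabilizer G x : Set G)
  finitary : Finite (orbitRel.Quotient G carrier)

variable {G : Type} [Group G] [TopologicalSpace G]

namespace FinGSet

instance : CoeSort (FinGSet G) Type := ⟨FinGSet.carrier⟩

instance (X : FinGSet G) : MulAction G X := X.action

instance (X : FinGSet G) : Fintype (orbitRel.Quotient G X) :=
  have := X.finitary
  Fintype.ofFinite _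

/-- A transitive `G`-set: non-empty, with a single orbit. -/
def Transitive (X : FinGSet G) : Prop := Nonempty X ∧ IsPretransitive G X

/-- The `G`-set given by a `G`-stable subset. -/
def sub (X : FinGSet G) (S : SubMulAction G X) : FinGSet G where
  carrier := S
  smooth x := by
    have h : stabilizer G x = stabilizer G (x : X) := by
      ext g
      simp only [mem_stabilizer_iff, Subtype.ext_iff, SubMulAction.val_smul]
    rw [h]
    exact X.smooth x
  finitary := by
    let F : orbitRel.Quotient G S → orbitRel.Quotient G X :=
      Quotient.map' (fun x : S => (x : X)) (by
        rintro a b ⟨g, rfl⟩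
        exact ⟨g, rfl⟩)
    have := X.finitary
    refine Finite.of_injective F ?_
    intro a b
    induction a using Quotient.inductionOn'
    induction b using Quotient.inductionOn'
    intro h
    obtain ⟨g, hg⟩ := Quotient.exact' h
    exact Quotient.sound' ⟨g, Subtype.ext hg⟩

/-- The orbit of a point, as a `G`-stable subset. -/
def orb (X : FinGSet G) (x : X) : SubMulAction G X where
  carrier := orbit G x
  smul_mem' g y h := by
    obtain ⟨a, rfl⟩ := h
    exact ⟨g * a, mul_smul g a x⟩

theorem mem_orb {X : FinGSet G} {x y : X} : y ∈ X.orb x ↔ ∃ g : G, g • x = y := Iff.rfl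

theorem mem_orb_self {X : FinGSet G} (x : X) : x ∈ X.orb x := ⟨1, one_smul _ _⟩

theorem mem_orb_symm {X : FinGSet G} {x y : X} : y ∈ X.orb x ↔ x ∈ X.orb y := by
  constructor <;> rintro ⟨g, rfl⟩ <;> exact ⟨g⁻¹, inv_smul_smul _ _⟩

theorem smul_mem_orb {X : FinGSet G} {x y : X} {g : G} : g • y ∈ X.orb x ↔ y ∈ X.orb x := by
  constructor
  · intro h
    simpa using (X.orb x).smul_mem g⁻¹ h
  · exact (X.orb x).smul_mem g

theorem orb_eq {X : FinGSet G} {x y : X} (h : y ∈ X.orb x) : X.orb y = X.orb x := by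
  obtain ⟨g, rfl⟩ := h
  exact SetLike.coe_injective (orbit_smul g x)

theorem orb_le {X : FinGSet G} {S : SubMulAction G X} {x y : X} (hx : x ∈ S) (hy : y ∈ X.orb x) :
    y ∈ S := by
  obtain ⟨g, rfl⟩ := hy
  exact S.smul_mem g hx

theorem map_mem_orb {X Y : FinGSet G} (f : X →[G] Y) {x y : X} (h : y ∈ X.orb x) :
    f y ∈ Y.orb (f x) := by
  obtain ⟨g, rfl⟩ := h
  exact ⟨g, (map_smul f g x).symm⟩

theorem orb_transitive (X : FinGSet G) (x : X) : (X.sub (X.orb x)).Transitive := by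
  refine ⟨⟨⟨x, mem_orb_self x⟩⟩, ⟨?_⟩⟩
  rintro ⟨_, a, rfl⟩ ⟨_, b, rfl⟩
  exact ⟨b * a⁻¹, Subtype.ext (by
    change (b * a⁻¹) • a • x = b • x
    rw [smul_smul, inv_mul_cancel_right])⟩

/-- The restriction of a map of `G`-sets to `G`-stable subsets. -/
def restrict {X Y : FinGSet G} (f : X →[G] Y) (S : SubMulAction G X) (T : SubMulAction G Y)
    (h : ∀ x ∈ S, f x ∈ T) : X.sub S →[G] Y.sub T where
  toFun x := ⟨f x.1, h x.1 x.2⟩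
  map_smul' g x := Subtype.ext (map_smul f g x.1)

/-- The map from the orbit of `x` onto the orbit of `f x` induced by a map `f` of `G`-sets. -/
def orbMap {X Y : FinGSet G} (f : X →[G] Y) (x : X) : X.sub (X.orb x) →[G] Y.sub (Y.orb (f x)) :=
  restrict f _ _ fun _ h => map_mem_orb f h

/-- The product of two finitary smooth `G`-sets. -/
def prod [RoelckePrecompact G] (X Y : FinGSet G) : FinGSet G where
  carrier := X × Y
  smooth x := by
    have h : (stabilizer G x : Set G) =
        (stabilizer G x.1 : Set G) ∩ (stabilizer G x.2 : Set G) := by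
      ext g
      simp only [SetLike.mem_coe, mem_stabilizer_iff, Prod.ext_iff, Prod.smul_fst, Prod.smul_snd,
        Set.mem_inter_iff]
    rw [h]
    exact (X.smooth _).inter (Y.smooth _)
  finitary := by
    have := X.finitary
    have := Y.finitary
    have key : ∀ (x : X) (y : Y), Set.Finite
        (Set.range fun g : G => (Quotient.mk'' (x, g • y) : orbitRel.Quotient G (X × Y))) := by
      intro x y
      have := RoelckePrecompact.finite_doubleCoset (stabilizer G x) (stabilizer G y)
        (X.smooth x) (Y.smooth y)
      let F : DoubleCoset.Quotient (stabilizer G x : Set G) (stabilizer G y : Set G) →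
          orbitRel.Quotient G (X × Y) :=
        Quotient.lift (fun g => Quotient.mk'' (x, g • y)) (by
          intro a b h
          obtain ⟨u, hu, v, hv, rfl⟩ := DoubleCoset.rel_iff.1 h
          refine Quotient.sound' ⟨u⁻¹, ?_⟩
          refine Prod.ext ?_ ?_
          · exact inv_smul_eq_iff.2 (mem_stabilizer_iff.1 hu).symm
          · change u⁻¹ • (u * a * v) • y = a • y
            rw [smul_smul, mul_assoc, inv_mul_cancel_left, mul_smul, mem_stabilizer_iff.1 hv])
      refine (Set.finite_range F).subset ?_
      rintro _ ⟨g, rfl⟩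
      exact ⟨Quotient.mk'' g, rfl⟩
    have : Set.Finite (⋃ q : orbitRel.Quotient G X × orbitRel.Quotient G Y, Set.range fun g : G =>
        (Quotient.mk'' (q.1.out, g • q.2.out) : orbitRel.Quotient G (X × Y))) :=
      Set.finite_iUnion fun q => key _ _
    refine Set.finite_univ_iff.1 (this.subset ?_)
    intro q _
    induction q using Quotient.inductionOn' with | _ q =>
    obtain ⟨x, y⟩ := q
    obtain ⟨a, ha⟩ := Quotient.exact (Quotient.out_eq (Quotient.mk'' x : orbitRel.Quotient G X))
    obtain ⟨b, hb⟩ := Quotient.exact (Quotient.out_eq (Quotient.mk'' y : orbitRel.Quotient G Y))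
    refine Set.mem_iUnion.2 ⟨(Quotient.mk'' x, Quotient.mk'' y), a * b⁻¹, ?_⟩
    refine Quotient.sound' ⟨a, ?_⟩
    refine Prod.ext ha ?_
    change a • y = (a * b⁻¹) • _
    refine Eq.trans ?_ (congrArg (fun t => (a * b⁻¹) • t) hb)
    change a • y = (a * b⁻¹) • b • y
    rw [smul_smul, inv_mul_cancel_right]

/-- The one-point `G`-set. -/
def pt (G : Type) [Group G] [TopologicalSpace G] : FinGSet G where
  carrier := Unit
  action := { smul := fun _ x => x, one_smul := fun _ => rfl, mul_smul := fun _ _ _ => rfl }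
  smooth x := by
    let _ : MulAction G Unit :=
      { smul := fun _ x => x, one_smul := fun _ => rfl, mul_smul := fun _ _ _ => rfl }
    have h : (stabilizer G x : Set G) = Set.univ := Set.eq_univ_of_forall fun _ => rfl
    rw [h]
    exact isOpen_univ
  finitary := Quotient.finite _

end FinGSet
end GSets
section Measures
open MulAction
universe w w'
variable {G : Type} [Group G] [TopologicalSpace G]

/-- A measure for `G` valued in `k`: a rule assigning a value to each map `f : X → Y` of finitary
smooth `G`-sets with `Y` transitive. -/
structure GMeasure (G : Type) [Group G] [TopologicalSpace G] (k : Type w) [CommRing k] where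
  val : ∀ {X Y : FinGSet G}, Y.Transitive → (X →[G] Y) → k
  iso : ∀ {X Y : FinGSet G} (hY : Y.Transitive) (f : X →[G] Y), Function.Bijective f → val hY f = 1
  /-- Additivity for a decomposition of `X` as the disjoint union of `X₁` and `X₂`. -/
  add : ∀ {X X₁ X₂ Y : FinGSet G} (hY : Y.Transitive) (f : X →[G] Y) (i₁ : X₁ →[G] X)
    (i₂ : X₂ →[G] X), Function.Injective i₁ → Function.Injective i₂ →
    IsCompl (Set.range i₁) (Set.range i₂) → val hY f = val hY (f.comp i₁) + val hY (f.comp i₂)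
  comp : ∀ {X Y Z : FinGSet G} (hY : Y.Transitive) (hZ : Z.Transitive) (f : X →[G] Y)
    (g : Y →[G] Z), val hZ (g.comp f) = val hZ g * val hY f
  /-- Invariance under base change: `X'`, with its maps `f'` to `Y'` and `p` to `X`, is the fibre
  product of `X` and `Y'` over `Y`. -/
  baseChange : ∀ {X Y X' Y' : FinGSet G} (hY : Y.Transitive) (hY' : Y'.Transitive) (f : X →[G] Y)
    (h : Y' →[G] Y) (f' : X' →[G] Y') (p : X' →[G] X), (∀ x', f (p x') = h (f' x')) →
    (∀ x y', f x = h y' → ∃! x', p x' = x ∧ f' x' = y') → val hY' f' = val hY f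

namespace GMeasure
variable {k : Type w} [CommRing k] (μ : GMeasure G k)

/-- A measure is regular if its value on every map of transitive `G`-sets is a unit. -/
def Regular : Prop := ∀ (X Y : FinGSet G) (_ : X.Transitive) (hY : Y.Transitive) (f : X →[G] Y),
  IsUnit (μ.val hY f)

/-- The measure obtained by applying a ring homomorphism to all values. -/
def map {k' : Type w'} [CommRing k'] (φ : k →+* k') : GMeasure G k' where
  val hY f := φ (μ.val hY f)
  iso hY f hf := by rw [μ.iso hY f hf, map_one]
  add hY f i₁ i₂ h₁ h₂ h := by rw [μ.add hY f i₁ i₂ h₁ h₂ h, map_add]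
  comp hY hZ f g := by rw [μ.comp hY hZ f g, map_mul]
  baseChange hY hY' f h f' p hc hu := by rw [μ.baseChange hY hY' f h f' p hc hu]

theorem pt_transitive : (FinGSet.pt G).Transitive :=
  ⟨⟨()⟩, ⟨fun _ _ => ⟨1, rfl⟩⟩⟩

/-- The map to the one-point `G`-set. -/
def toPt (X : FinGSet G) : X →[G] FinGSet.pt G where
  toFun _ := ()
  map_smul' _ _ := rfl

/-- The measure `μ(X)` of a `G`-set `X`, that is, the value on the map to the one-point set. -/
def value (X : FinGSet G) : k := μ.val pt_transitive (toPt X)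

end GMeasure

namespace FinGSet
variable {k : Type w} [CommRing k]

/-- Invariance of a function on a `G`-set. -/
def Inv {X : FinGSet G} (φ : X → k) : Prop := ∀ (g : G) (x : X), φ (g • x) = φ x

theorem Inv.of_mem {X : FinGSet G} {φ : X → k} (h : Inv φ) {x y : X} (hy : y ∈ X.orb x) :
    φ y = φ x := by
  obtain ⟨g, rfl⟩ := hy
  exact h g x

theorem Inv.comp {X Y : FinGSet G} {φ : Y → k} (h : Inv φ) (f : X →[G] Y) :
    Inv fun x => φ (f x) := fun g x => by
  change φ (f (g • x)) = φ (f x)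
  rw [map_smul, h]

theorem Inv.mul {X : FinGSet G} {φ ψ : X → k} (h : Inv φ) (h' : Inv ψ) :
    Inv fun x => φ x * ψ x := fun g x => by
  change φ (g • x) * ψ (g • x) = _
  rw [h, h']

/-- The sum over the orbits of a `G`-set of the values of an invariant function. -/
def orbSum (X : FinGSet G) (φ : X → k) : k := ∑ q : orbitRel.Quotient G X, φ q.out

theorem mem_orb_out {X : FinGSet G} (q : orbitRel.Quotient G X) (x : X) :
    x ∈ X.orb q.out ↔ q = Quotient.mk'' x := by
  constructor
  · intro h
    rw [← Quotient.out_eq q]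
    exact (Quotient.sound h).symm
  · rintro rfl
    exact Quotient.exact (Quotient.out_eq (Quotient.mk'' x : orbitRel.Quotient G X)).symm

open scoped Classical in
theorem orbSum_ite {X : FinGSet G} {φ : X → k} (hφ : Inv φ) (x : X) :
    X.orbSum (fun y => if x ∈ X.orb y then φ y else 0) = φ x := by
  unfold orbSum
  simp only [mem_orb_out]
  rw [Finset.sum_ite_eq' Finset.univ (Quotient.mk'' x : orbitRel.Quotient G X)]
  rw [if_pos (Finset.mem_univ _)]
  exact (hφ.of_mem ((mem_orb_out _ x).2 rfl)).symm

theorem orbSum_comm {X Y : FinGSet G} (F : X → Y → k) :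
    X.orbSum (fun x => Y.orbSum (F x)) = Y.orbSum (fun y => X.orbSum fun x => F x y) :=
  Finset.sum_comm

theorem orbSum_congr {X : FinGSet G} {φ ψ : X → k} (h : ∀ x, φ x = ψ x) :
    X.orbSum φ = X.orbSum ψ := Finset.sum_congr rfl fun _ _ => h _

theorem orbSum_add {X : FinGSet G} (φ ψ : X → k) :
    X.orbSum (fun x => φ x + ψ x) = X.orbSum φ + X.orbSum ψ := Finset.sum_add_distrib

theorem orbSum_mul {X : FinGSet G} {φ : X → k} (c : k) :
    X.orbSum (fun x => φ x * c) = X.orbSum φ * c := Finset.sum_mul .. |>.symm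

theorem mul_orbSum {X : FinGSet G} {φ : X → k} (c : k) :
    X.orbSum (fun x => c * φ x) = c * X.orbSum φ := Finset.mul_sum .. |>.symm

open scoped Classical in
theorem orbSum_fiber {X Y : FinGSet G} (f : X →[G] Y) (φ : X → k) :
    X.orbSum φ = Y.orbSum fun y => X.orbSum fun x => if f x ∈ Y.orb y then φ x else 0 := by
  rw [orbSum_comm]
  refine orbSum_congr fun x => ?_
  exact (orbSum_ite (φ := fun _ => φ x) (fun _ _ => rfl) (f x)).symm

end FinGSet

namespace GMeasure
open FinGSet
variable {k : Type w} [CommRing k] (μ : GMeasure G k)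

/-- The value of the restriction of `f` to `G`-stable subsets `S` and `T`. -/
def on {X Y : FinGSet G} (f : X →[G] Y) (S : SubMulAction G X) (T : SubMulAction G Y)
    (hT : (Y.sub T).Transitive) (h : ∀ x ∈ S, f x ∈ T) : k :=
  μ.val hT (restrict f S T h)

theorem on_congr {X Y : FinGSet G} (f : X →[G] Y) {S S' : SubMulAction G X}
    {T T' : SubMulAction G Y} (hT : (Y.sub T).Transitive) (h : ∀ x ∈ S, f x ∈ T) (eS : S = S')
    (eT : T = T') : μ.on f S T hT h = μ.on f S' T' (eT ▸ hT) (by subst eS; subst eT; exact h) := by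
  subst eS; subst eT; rfl

/-- The value of the map from the orbit of `x` to the orbit of `f x`. -/
def orbVal {X Y : FinGSet G} (f : X →[G] Y) (x : X) : k := μ.val (orb_transitive Y (f x)) (orbMap f x)

theorem orbVal_eq {X Y : FinGSet G} (f : X →[G] Y) (x : X) (S : SubMulAction G X)
    (T : SubMulAction G Y) (hT : (Y.sub T).Transitive) (h : ∀ x ∈ S, f x ∈ T) (eS : X.orb x = S)
    (eT : Y.orb (f x) = T) : μ.orbVal f x = μ.on f S T hT h := by
  subst eS; subst eT; rfl

theorem orbVal_inv {X Y : FinGSet G} (f : X →[G] Y) : Inv (μ.orbVal f) := by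
  intro g x
  have h1 : X.orb (g • x) = X.orb x := orb_eq ⟨g, rfl⟩
  have h2 : Y.orb (f (g • x)) = Y.orb (f x) := orb_eq ⟨g, (map_smul f g x).symm⟩
  exact μ.orbVal_eq f _ _ _ (orb_transitive Y (f x)) (fun _ h => map_mem_orb f h) h1 h2

theorem val_empty {X Y : FinGSet G} (hY : Y.Transitive) (f : X →[G] Y) (hX : IsEmpty X) :
    μ.val hY f = 0 := by
  have := μ.add hY f (MulActionHom.id G) (MulActionHom.id G) (fun _ _ h => h) (fun _ _ h => h)
    (by
      have : Subsingleton (Set X) := ⟨fun a b => Set.ext fun x => isEmptyElim x⟩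
      exact ⟨disjoint_iff.2 (Subsingleton.elim _ _), codisjoint_iff.2 (Subsingleton.elim _ _)⟩)
  rw [MulActionHom.comp_id] at this
  simpa using this

theorem on_union {X Y : FinGSet G} (f : X →[G] Y) (S S₁ S₂ : SubMulAction G X) (T : SubMulAction G Y)
    (hT : (Y.sub T).Transitive) (h : ∀ x ∈ S, f x ∈ T) (h₁ : ∀ x ∈ S₁, x ∈ S)
    (h₂ : ∀ x ∈ S₂, x ∈ S) (hu : ∀ x ∈ S, x ∈ S₁ ∨ x ∈ S₂) (hd : ∀ x ∈ S₁, x ∉ S₂) :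
    μ.on f S T hT h = μ.on f S₁ T hT (fun x hx => h x (h₁ x hx)) +
      μ.on f S₂ T hT (fun x hx => h x (h₂ x hx)) := by
  refine μ.add hT _ (restrict (MulActionHom.id G) S₁ S h₁) (restrict (MulActionHom.id G) S₂ S h₂)
    (fun a b hab => ?_) (fun a b hab => ?_) ⟨?_, ?_⟩
  · exact Subtype.ext (congrArg (fun t : S => (t : X)) hab)
  · exact Subtype.ext (congrArg (fun t : S => (t : X)) hab)
  · rw [Set.disjoint_iff_forall_ne]
    rintro _ ⟨a, rfl⟩ _ ⟨b, rfl⟩ hab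
    have : a.1 = b.1 := congrArg (fun t : S => (t : X)) hab
    exact hd a.1 a.2 (this ▸ b.2)
  · refine codisjoint_iff.2 (Set.eq_univ_of_forall ?_)
    rintro ⟨x, hx⟩
    rcases hu x hx with h | h
    · exact Or.inl ⟨⟨x, h⟩, rfl⟩
    · exact Or.inr ⟨⟨x, h⟩, rfl⟩

/-- The union of a set of orbits. -/
def orbs (X : FinGSet G) (s : Finset (orbitRel.Quotient G X)) : SubMulAction G X where
  carrier := {x | Quotient.mk'' x ∈ s}
  smul_mem' g x h := by
    have : (Quotient.mk'' (g • x) : orbitRel.Quotient G X) = Quotient.mk'' x :=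
      Quotient.sound' ⟨g, rfl⟩
    change _ ∈ s
    rw [this]
    exact h

open scoped Classical in
theorem on_eq_sum {X Y : FinGSet G} (f : X →[G] Y) (T : SubMulAction G Y)
    (hT : (Y.sub T).Transitive) (s : Finset (orbitRel.Quotient G X)) : ∀ (S : SubMulAction G X)
    (h : ∀ x ∈ S, f x ∈ T) (_ : ∀ x, x ∈ S ↔ Quotient.mk'' x ∈ s),
    μ.on f S T hT h = ∑ q ∈ s, μ.orbVal f q.out := by
  induction s using Finset.induction_on with
  | empty =>
    intro S h hS
    rw [Finset.sum_empty]
    exact μ.val_empty _ _ ⟨fun x => absurd ((hS x.1).1 x.2) (Finset.notMem_empty _)⟩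
  | insert q s hq ih =>
    intro S h hS
    have h1 : ∀ x ∈ X.orb q.out, x ∈ S := fun x hx => by
      rw [hS, ← (mem_orb_out q x).1 hx]
      exact Finset.mem_insert_self _ _
    have h2 : ∀ x ∈ orbs X s, x ∈ S := fun x hx => by
      rw [hS]
      exact Finset.mem_insert_of_mem hx
    rw [μ.on_union f S (X.orb q.out) (orbs X s) T hT h h1 h2 ?_ ?_, Finset.sum_insert hq,
      ih (orbs X s) _ (fun _ => Iff.rfl)]
    · congr 1
      refine (μ.orbVal_eq f _ _ _ hT _ rfl ?_).symm
      obtain ⟨_, hT'⟩ := hT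
      have hm : f q.out ∈ T := h _ (h1 _ (mem_orb_self _))
      refine SetLike.ext fun y => ⟨fun hy => orb_le hm hy, fun hy => ?_⟩
      obtain ⟨g, hg⟩ := hT'.exists_smul_eq ⟨f q.out, hm⟩ ⟨y, hy⟩
      exact ⟨g, congrArg (fun t : T => (t : Y)) hg⟩
    · intro x hx
      rcases Finset.mem_insert.1 ((hS x).1 hx) with h | h
      · exact Or.inl ((mem_orb_out q x).2 h.symm)
      · exact Or.inr h
    · intro x hx hx'
      apply hq
      rw [(mem_orb_out q x).1 hx]
      exact hx'

open scoped Classical in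
theorem on_eq_orbSum {X Y : FinGSet G} (f : X →[G] Y) (S : SubMulAction G X) (T : SubMulAction G Y)
    (hT : (Y.sub T).Transitive) (h : ∀ x ∈ S, f x ∈ T) :
    μ.on f S T hT h = X.orbSum fun x => if x ∈ S then μ.orbVal f x else 0 := by
  rw [μ.on_eq_sum f T hT (Finset.univ.filter fun q => q.out ∈ S) S h, Finset.sum_filter]
  · rfl
  · intro x
    rw [Finset.mem_filter]
    have hx := (mem_orb_out _ x).2 (rfl : (Quotient.mk'' x : orbitRel.Quotient G X) = _)
    exact ⟨fun h => ⟨Finset.mem_univ _, orb_le h (mem_orb_symm.1 hx)⟩, fun h => orb_le h.2 hx⟩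

theorem orbVal_comp {X Y Z : FinGSet G} (f : X →[G] Y) (g : Y →[G] Z) (x : X) :
    μ.orbVal (g.comp f) x = μ.orbVal g (f x) * μ.orbVal f x :=
  μ.comp (orb_transitive Y (f x)) (orb_transitive Z (g (f x))) (orbMap f x) (orbMap g (f x))

theorem orbVal_injective {X Y : FinGSet G} (f : X →[G] Y) (hf : Function.Injective f) (x : X) :
    μ.orbVal f x = 1 := by
  refine μ.iso _ _ ⟨fun a b h => Subtype.ext (hf (congrArg Subtype.val h)), ?_⟩
  rintro ⟨_, g, rfl⟩
  exact ⟨⟨g • x, g, rfl⟩, Subtype.ext (map_smul f g x)⟩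

/-- The square with maps `p : X' → X`, `f' : X' → Y'`, `f : X → Y`, `h : Y' → Y` is cartesian. -/
structure Cartesian {X Y X' Y' : FinGSet G} (f : X →[G] Y) (h : Y' →[G] Y) (f' : X' →[G] Y')
    (p : X' →[G] X) : Prop where
  comm : ∀ x', f (p x') = h (f' x')
  unique : ∀ x y', f x = h y' → ∃! x', p x' = x ∧ f' x' = y'

open scoped Classical in
theorem orbSum_cartesian {X Y X' Y' : FinGSet G} {f : X →[G] Y} {h : Y' →[G] Y} {f' : X' →[G] Y'}
    {p : X' →[G] X} (c : Cartesian f h f' p) (x : X) (y' : Y') :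
    (X'.orbSum fun x' => if p x' ∈ X.orb x ∧ f' x' ∈ Y'.orb y' then μ.orbVal f' x' else 0) =
      if h y' ∈ Y.orb (f x) then μ.orbVal f x else 0 := by
  split_ifs with hy
  · let P : SubMulAction G X' :=
      { carrier := {x' | p x' ∈ X.orb x ∧ f' x' ∈ Y'.orb y'}
        smul_mem' := fun g x' hx' => by
          change _ ∧ _
          rw [map_smul, map_smul, smul_mem_orb, smul_mem_orb]
          exact hx' }
    have e := μ.on_eq_orbSum f' P (Y'.orb y') (orb_transitive _ _) (fun _ h => h.2)
    refine Eq.trans ?_ (e.symm.trans ?_)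
    · exact orbSum_congr fun x' => if_congr Iff.rfl rfl rfl
    refine μ.baseChange _ _ (orbMap f x) (restrict h (Y'.orb y') (Y.orb (f x))
      fun z hz => orb_le hy (map_mem_orb h hz)) _ (restrict p P (X.orb x) fun _ h => h.1)
      (fun x' => Subtype.ext (c.comm x'.1)) ?_
    intro a b hab
    obtain ⟨x', ⟨h1, h2⟩, h3⟩ := c.unique a.1 b.1 (congrArg Subtype.val hab)
    refine ⟨⟨x', ?_, ?_⟩, ⟨Subtype.ext h1, Subtype.ext h2⟩, ?_⟩
    · rw [h1]; exact a.2
    · rw [h2]; exact b.2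
    · rintro z ⟨hz1, hz2⟩
      exact Subtype.ext (h3 z.1 ⟨congrArg Subtype.val hz1, congrArg Subtype.val hz2⟩)
  · refine (orbSum_congr (ψ := fun _ => 0) fun x' => if_neg ?_).trans Finset.sum_const_zero
    rintro ⟨h1, h2⟩
    apply hy
    have h3 := map_mem_orb f h1
    rw [c.comm] at h3
    exact orb_le h3 (mem_orb_symm.1 (map_mem_orb h h2))

open scoped Classical in
/-- The push-forward along `f`, sending the indicator function of an orbit `W` to `μ(f : W → f(W))`
times the indicator function of the orbit `f(W)`. -/
def push {X Y : FinGSet G} (f : X →[G] Y) (φ : X → k) (y : Y) : k :=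
  X.orbSum fun x => if y ∈ Y.orb (f x) then φ x * μ.orbVal f x else 0

open scoped Classical in
theorem push_inv {X Y : FinGSet G} (f : X →[G] Y) (φ : X → k) : Inv (μ.push f φ) := by
  intro g y
  exact orbSum_congr fun x => if_congr smul_mem_orb rfl rfl

theorem push_congr {X Y : FinGSet G} (f : X →[G] Y) {φ ψ : X → k} (h : ∀ x, φ x = ψ x) (y : Y) :
    μ.push f φ y = μ.push f ψ y := by
  rw [show φ = ψ from funext h]

theorem push_add {X Y : FinGSet G} (f : X →[G] Y) (φ ψ : X → k) (y : Y) :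
    μ.push f (fun x => φ x + ψ x) y = μ.push f φ y + μ.push f ψ y := by
  unfold push
  rw [← orbSum_add]
  refine orbSum_congr fun x => ?_
  split_ifs
  · rw [add_mul]
  · rw [add_zero]

theorem push_smul {X Y : FinGSet G} (f : X →[G] Y) (c : k) (φ : X → k) (y : Y) :
    μ.push f (fun x => c * φ x) y = c * μ.push f φ y := by
  unfold push
  rw [← mul_orbSum]
  refine orbSum_congr fun x => ?_
  split_ifs
  · rw [mul_assoc]
  · rw [mul_zero]

theorem push_comp {X Y Z : FinGSet G} (f : X →[G] Y) (g : Y →[G] Z) (φ : X → k) (z : Z) :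
    μ.push g (μ.push f φ) z = μ.push (g.comp f) φ z := by
  classical
  unfold push
  have : ∀ y : Y, (if z ∈ Z.orb (g y) then (X.orbSum fun x => if y ∈ Y.orb (f x) then
      φ x * μ.orbVal f x else 0) * μ.orbVal g y else 0) = X.orbSum fun x =>
      if f x ∈ Y.orb y then
        (if z ∈ Z.orb (g (f x)) then φ x * μ.orbVal f x * μ.orbVal g (f x) else 0) else 0 := by
    intro y
    split_ifs with hz
    · rw [← orbSum_mul]
      refine orbSum_congr fun x => ?_
      rw [mem_orb_symm (x := f x)]
      split_ifs with h1 h2 h3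
      · rw [(μ.orbVal_inv g).of_mem h1]
      · rw [orb_eq (map_mem_orb g h1)] at h2
        exact absurd hz h2
      · rw [zero_mul]
    · refine Eq.symm ((orbSum_congr (ψ := fun _ => 0) fun x => ?_).trans Finset.sum_const_zero)
      split_ifs with h1 h2
      · rw [orb_eq (map_mem_orb g h1)] at h2
        exact absurd h2 hz
      · rfl
      · rfl
  rw [orbSum_congr this, ← orbSum_fiber f]
  refine orbSum_congr fun x => ?_
  rw [orbVal_comp]
  change _ = if z ∈ Z.orb (g (f x)) then _ else _
  split_ifs
  · ring
  · rfl

theorem push_cartesian {X Y X' Y' : FinGSet G} {f : X →[G] Y} {h : Y' →[G] Y} {f' : X' →[G] Y'}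
    {p : X' →[G] X} (c : Cartesian f h f' p) {φ : X → k} (hφ : Inv φ) (y' : Y') :
    μ.push f φ (h y') = μ.push f' (fun x' => φ (p x')) y' := by
  classical
  unfold push
  rw [orbSum_fiber p]
  refine orbSum_congr fun x => ?_
  have := congrArg (fun t => φ x * t) (μ.orbSum_cartesian c x y')
  simp only [mul_ite, mul_zero] at this
  rw [← this, ← mul_orbSum]
  refine orbSum_congr fun x' => ?_
  rw [mem_orb_symm (y := y')]
  split_ifs with h1 h2 h3 h3 h4 h4
  · exact congrArg (fun t => t * _) (hφ.of_mem h1.1).symm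
  all_goals simp_all

theorem push_projection {X Y : FinGSet G} (f : X →[G] Y) (φ : X → k) {ψ : Y → k} (hψ : Inv ψ)
    (y : Y) : μ.push f (fun x => φ x * ψ (f x)) y = μ.push f φ y * ψ y := by
  unfold push
  rw [← orbSum_mul]
  refine orbSum_congr fun x => ?_
  split_ifs with h
  · rw [hψ.of_mem h]; ring
  · rw [zero_mul]

theorem push_injective_apply {X Y : FinGSet G} (f : X →[G] Y) (hf : Function.Injective f)
    {φ : X → k} (hφ : Inv φ) (x : X) : μ.push f φ (f x) = φ x := by
  classical
  unfold push
  refine Eq.trans (orbSum_congr fun z => ?_) (orbSum_ite hφ x)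
  rw [orbVal_injective μ f hf, mul_one]
  refine if_congr ⟨?_, map_mem_orb f⟩ rfl rfl
  rintro ⟨g, hg⟩
  exact ⟨g, hf ((map_smul f g z).trans hg)⟩

theorem push_of_notMem {X Y : FinGSet G} (f : X →[G] Y) (φ : X → k) (y : Y) (hy : ∀ x, f x ≠ y) :
    μ.push f φ y = 0 := by
  refine (orbSum_congr (ψ := fun _ => 0) fun x => if_neg ?_).trans Finset.sum_const_zero
  rintro ⟨g, hg⟩
  exact hy (g • x) ((map_smul f g x).trans hg)

end GMeasure
end Measures
section PermCat
open MulAction FinGSet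
universe w
variable {G : Type} [Group G] [TopologicalSpace G] {k : Type w}

/-- The `k`-module `F(X)` of `G`-invariant functions on a `G`-set. -/
def InvFun (k : Type w) [CommRing k] (X : FinGSet G) : Submodule k (X → k) where
  carrier := {φ | Inv φ}
  add_mem' {φ ψ} h h' g x := by
    change φ (g • x) + ψ (g • x) = φ x + ψ x
    rw [h g x, h' g x]
  zero_mem' _ _ := rfl
  smul_mem' c φ h g x := by
    change c * φ (g • x) = c * φ x
    rw [h g x]

/-- The push-forward `f_* : F(X) → F(Y)` along a map of `G`-sets. -/
def GMeasure.pushforward [CommRing k] (μ : GMeasure G k) {X Y : FinGSet G} (f : X →[G] Y) :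
    InvFun k X →ₗ[k] InvFun k Y where
  toFun φ := ⟨μ.push f φ.1, μ.push_inv f φ.1⟩
  map_add' φ ψ := Subtype.ext (funext fun y => μ.push_add f φ.1 ψ.1 y)
  map_smul' c φ := Subtype.ext (funext fun y => μ.push_smul f c φ.1 y)

variable [CommRing k] (μ : GMeasure G k)

namespace GMeasure

theorem push_section {X Y : FinGSet G} (p : X →[G] Y) (i : Y →[G] X) (h : ∀ y, p (i y) = y)
    {F : X → k} (hF : Inv F) (h0 : ∀ x, x ≠ i (p x) → F x = 0) (y : Y) :
    μ.push p F y = F (i y) := by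
  have hi : Function.Injective i := Function.LeftInverse.injective h
  have h1 : ∀ x, F x = μ.push i (fun y => F (i y)) x := fun x => by
    by_cases hx : x = i (p x)
    · rw [hx, push_injective_apply μ i hi (hF.comp i)]
    · rw [h0 x hx, push_of_notMem]
      rintro z rfl
      exact hx (by rw [h])
  rw [push_congr μ p h1, push_comp]
  have h2 : ∀ a, p.comp i a = a := h
  have h3 := push_injective_apply μ (p.comp i) (Function.LeftInverse.injective (g := id) h2)
    (hF.comp i) y
  rwa [h2] at h3

end GMeasure

variable [RoelckePrecompact G]

namespace FinGSet

/-- The projection `p₁₃ : X × (Y × Z) → X × Z`. -/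
def p13 (X Y Z : FinGSet G) : X.prod (Y.prod Z) →[G] X.prod Z where
  toFun t := (t.1, t.2.2)
  map_smul' _ _ := rfl

/-- An isomorphism of `G`-sets. -/
structure GEquiv (X Y : FinGSet G) where
  e : X ≃ Y
  map_smul : ∀ (g : G) (x : X), e (g • x) = g • e x

namespace GEquiv

def refl (X : FinGSet G) : GEquiv X X := ⟨Equiv.refl X, fun _ _ => rfl⟩

def symm {X Y : FinGSet G} (a : GEquiv X Y) : GEquiv Y X :=
  ⟨a.e.symm, fun g y => by rw [Equiv.symm_apply_eq, a.map_smul, Equiv.apply_symm_apply]⟩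

def trans {X Y Z : FinGSet G} (a : GEquiv X Y) (b : GEquiv Y Z) : GEquiv X Z :=
  ⟨a.e.trans b.e, fun g x => by
    change b.e (a.e (g • x)) = g • b.e (a.e x)
    rw [a.map_smul, b.map_smul]⟩

def prod {X Y X' Y' : FinGSet G} (a : GEquiv X Y) (b : GEquiv X' Y') :
    GEquiv (X.prod X') (Y.prod Y') :=
  ⟨Equiv.prodCongr a.e b.e, fun g x => Prod.ext (a.map_smul g x.1) (b.map_smul g x.2)⟩

end GEquiv
end FinGSet

/-- The objects `Vec_X`, for `X` a finitary smooth `G`-set, of the category of permutation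
modules. -/
structure Perm (μ : GMeasure G k) : Type 1 where
  vec ::
  set : FinGSet G

namespace Perm
variable {μ}

/-- A `Y × X` matrix: an invariant function on `Y × X`. -/
abbrev Mat (k : Type w) [CommRing k] (Y X : FinGSet G) : Type w := InvFun k (Y.prod X)

/-- The function `(z, y, x) ↦ B(z, y) A(y, x)`. -/
def matProd {X Y Z : FinGSet G} (B : Mat k Z Y) (A : Mat k Y X) : InvFun k (Z.prod (Y.prod X)) :=
  ⟨fun t => B.1 (t.1, t.2.1) * A.1 (t.2.1, t.2.2), fun g t =>
    congrArg₂ (· * ·) (B.2 g (t.1, t.2.1)) (A.2 g (t.2.1, t.2.2))⟩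

/-- The product matrix `B A = (p₁₃)_* (p₂₃^* B · p₁₂^* A)`. -/
def matMul (μ : GMeasure G k) {X Y Z : FinGSet G} (B : Mat k Z Y) (A : Mat k Y X) : Mat k Z X :=
  μ.pushforward (p13 Z Y X) (matProd B A)

open scoped Classical in
/-- The matrix of an isomorphism of `G`-sets. -/
def graph {X Y : FinGSet G} (e : GEquiv X Y) : Mat k Y X :=
  ⟨fun t => if t.1 = e.e t.2 then 1 else 0, fun g t => by
    refine if_congr ?_ rfl rfl
    change g • t.1 = e.e (g • t.2) ↔ _
    rw [e.map_smul, smul_left_cancel_iff]⟩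

open scoped Classical in
/-- The identity matrix. -/
def matOne (X : FinGSet G) : Mat k X X :=
  ⟨fun t => if t.1 = t.2 then 1 else 0, (graph (GEquiv.refl X)).2⟩

theorem graph_refl (X : FinGSet G) : graph (GEquiv.refl X) = matOne (k := k) X := rfl

theorem mat_ext {X Y : FinGSet G} {A B : Mat k Y X} (h : ∀ y x, A.1 (y, x) = B.1 (y, x)) : A = B :=
  Subtype.ext (funext fun t => h t.1 t.2)

theorem matMul_graph {X Y Z : FinGSet G} (e : GEquiv X Y) (A : Mat k Z Y) (z : Z) (x : X) :
    (matMul μ A (graph e)).1 (z, x) = A.1 (z, e.e x) := by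
  classical
  let i : Z.prod X →[G] Z.prod (Y.prod X) :=
    ⟨fun t => (t.1, e.e t.2, t.2), fun g t =>
      Prod.ext rfl (Prod.ext (e.map_smul g t.2) rfl)⟩
  refine (μ.push_section (p13 Z Y X) i (fun _ => rfl) (matProd A (graph e)).2 ?_ (z, x)).trans ?_
  · rintro ⟨z, y, x⟩ h
    change _ * ite _ _ _ = _
    rw [if_neg, mul_zero]
    intro hy
    change y = e.e x at hy
    subst hy
    exact h rfl
  · exact (congrArg _ (if_pos rfl)).trans (mul_one _)

theorem graph_matMul {X Y Z : FinGSet G} (e : GEquiv Y Z) (A : Mat k Y X) (z : Z) (x : X) :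
    (matMul μ (graph e) A).1 (z, x) = A.1 (e.symm.e z, x) := by
  classical
  let i : Z.prod X →[G] Z.prod (Y.prod X) :=
    ⟨fun t => (t.1, e.symm.e t.1, t.2), fun g t =>
      Prod.ext rfl (Prod.ext (e.symm.map_smul g t.1) rfl)⟩
  refine (μ.push_section (p13 Z Y X) i (fun _ => rfl) (matProd (graph e) A).2 ?_ (z, x)).trans ?_
  · rintro ⟨z, y, x⟩ h
    change ite _ _ _ * _ = _
    rw [if_neg, zero_mul]
    intro hz
    change z = e.e y at hz
    subst hz
    apply h
    change (_, _, _) = (_, e.e.symm (e.e y), _)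
    rw [Equiv.symm_apply_apply]
    rfl
  · change ite _ _ _ * _ = _
    rw [if_pos, one_mul]
    · rfl
    · exact (Equiv.apply_symm_apply e.e z).symm

theorem matMul_assoc {X Y Z W : FinGSet G} (C : Mat k W Z) (B : Mat k Z Y) (A : Mat k Y X) :
    matMul μ (matMul μ C B) A = matMul μ C (matMul μ B A) := by
  refine mat_ext fun w x => ?_
  let R := W.prod (Z.prod (Y.prod X))
  let F : R → k := fun r => C.1 (r.1, r.2.1) * (B.1 (r.2.1, r.2.2.1) * A.1 (r.2.2.1, r.2.2.2))
  let q : R →[G] W.prod X := ⟨fun r => (r.1, r.2.2.2), fun _ _ => rfl⟩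
  trans μ.push q F (w, x)
  · let f' : R →[G] W.prod (Y.prod X) := ⟨fun r => (r.1, r.2.2.1, r.2.2.2), fun _ _ => rfl⟩
    let h : W.prod (Y.prod X) →[G] W.prod Y := ⟨fun r => (r.1, r.2.1), fun _ _ => rfl⟩
    let p : R →[G] W.prod (Z.prod Y) := ⟨fun r => (r.1, r.2.1, r.2.2.1), fun _ _ => rfl⟩
    have c : GMeasure.Cartesian (p13 W Z Y) h f' p := ⟨fun _ => rfl, by
      rintro ⟨w, z, y⟩ ⟨w', y', x⟩ e
      obtain ⟨rfl, rfl⟩ := Prod.mk.inj e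
      refine ⟨(w, z, y, x), ⟨rfl, rfl⟩, ?_⟩
      rintro ⟨w₁, z₁, y₁, x₁⟩ ⟨e1, e2⟩
      cases e1; cases e2; rfl⟩
    have h1 : ∀ t, (matProd (matMul μ C B) A).1 t = μ.push f' F t := fun t => by
      have e1 := μ.push_cartesian c (matProd C B).2 t
      let ψ : W.prod (Y.prod X) → k := fun t => A.1 (t.2.1, t.2.2)
      have hψ : Inv ψ := fun g t => A.2 g (t.2.1, t.2.2)
      have e2 := μ.push_projection f' (fun x' => (matProd C B).1 (p x')) hψ t
      refine (congrArg (fun s => s * ψ t) e1).trans (e2.symm.trans ?_)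
      exact μ.push_congr f' (fun r => mul_assoc _ _ _) t
    exact (μ.push_congr _ h1 _).trans (μ.push_comp f' (p13 _ _ _) F (w, x))
  · let f' : R →[G] W.prod (Z.prod X) := ⟨fun r => (r.1, r.2.1, r.2.2.2), fun _ _ => rfl⟩
    let h : W.prod (Z.prod X) →[G] Z.prod X := ⟨fun r => r.2, fun _ _ => rfl⟩
    let p : R →[G] Z.prod (Y.prod X) := ⟨fun r => r.2, fun _ _ => rfl⟩
    have c : GMeasure.Cartesian (p13 Z Y X) h f' p := ⟨fun _ => rfl, by
      rintro ⟨z, y, x⟩ ⟨w, z', x'⟩ e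
      obtain ⟨rfl, rfl⟩ := Prod.mk.inj e
      refine ⟨(w, z, y, x), ⟨rfl, rfl⟩, ?_⟩
      rintro ⟨w₁, z₁, y₁, x₁⟩ ⟨e1, e2⟩
      cases e1; cases e2; rfl⟩
    have h1 : ∀ t, (matProd C (matMul μ B A)).1 t = μ.push f' F t := fun t => by
      have e1 := μ.push_cartesian c (matProd B A).2 t
      let ψ : W.prod (Z.prod X) → k := fun t => C.1 (t.1, t.2.1)
      have hψ : Inv ψ := fun g t => C.2 g (t.1, t.2.1)
      have e2 := μ.push_projection f' (fun x' => (matProd B A).1 (p x')) hψ t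
      refine (congrArg (fun s => ψ t * s) e1).trans ((mul_comm _ _).trans (e2.symm.trans ?_))
      exact μ.push_congr f' (fun r => mul_comm _ _) t
    exact ((μ.push_congr _ h1 _).trans (μ.push_comp f' (p13 _ _ _) F (w, x))).symm

theorem matMul_one {X Y : FinGSet G} (A : Mat k Y X) : matMul μ A (matOne X) = A :=
  mat_ext fun y x => matMul_graph (GEquiv.refl X) A y x

theorem one_matMul {X Y : FinGSet G} (A : Mat k Y X) : matMul μ (matOne Y) A = A :=
  mat_ext fun y x => graph_matMul (GEquiv.refl Y) A y x

theorem matMul_add {X Y Z : FinGSet G} (B : Mat k Z Y) (A A' : Mat k Y X) :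
    matMul μ B (A + A') = matMul μ B A + matMul μ B A' := by
  refine (congrArg (μ.pushforward _) ?_).trans (map_add (μ.pushforward _) _ _)
  exact Subtype.ext (funext fun t => mul_add _ _ _)

theorem add_matMul {X Y Z : FinGSet G} (B B' : Mat k Z Y) (A : Mat k Y X) :
    matMul μ (B + B') A = matMul μ B A + matMul μ B' A := by
  refine (congrArg (μ.pushforward _) ?_).trans (map_add (μ.pushforward _) _ _)
  exact Subtype.ext (funext fun t => add_mul _ _ _)

theorem matMul_smul {X Y Z : FinGSet G} (c : k) (B : Mat k Z Y) (A : Mat k Y X) :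
    matMul μ B (c • A) = c • matMul μ B A := by
  refine (congrArg (μ.pushforward _) ?_).trans (map_smul (μ.pushforward _) _ _)
  exact Subtype.ext (funext fun t => mul_left_comm _ _ _)

theorem smul_matMul {X Y Z : FinGSet G} (c : k) (B : Mat k Z Y) (A : Mat k Y X) :
    matMul μ (c • B) A = c • matMul μ B A := by
  refine (congrArg (μ.pushforward _) ?_).trans (map_smul (μ.pushforward _) _ _)
  exact Subtype.ext (funext fun t => mul_assoc _ _ _)

/-- The Kronecker product `(y, y', x, x') ↦ A(y, x) A'(y', x')`. -/
def kron {X Y X' Y' : FinGSet G} (A : Mat k Y X) (A' : Mat k Y' X') :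
    Mat k (Y.prod Y') (X.prod X') :=
  ⟨fun t => A.1 (t.1.1, t.2.1) * A'.1 (t.1.2, t.2.2), fun g t =>
    congrArg₂ (· * ·) (A.2 g (t.1.1, t.2.1)) (A'.2 g (t.1.2, t.2.2))⟩

theorem kron_matMul {X Y Z X' Y' Z' : FinGSet G} (B : Mat k Z Y) (A : Mat k Y X) (B' : Mat k Z' Y')
    (A' : Mat k Y' X') :
    matMul μ (kron B B') (kron A A') = kron (matMul μ B A) (matMul μ B' A') := by
  refine mat_ext fun z x => ?_
  let V := (Z.prod Z').prod (X.prod X')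
  let R₁ := (Z.prod Z').prod (Y.prod (X.prod X'))
  let R₂ := (Z.prod Z').prod ((Y.prod Y').prod (X.prod X'))
  let f₁ : R₁ →[G] V := p13 _ _ _
  let f₂ : R₂ →[G] R₁ := ⟨fun t => (t.1, t.2.1.1, t.2.2), fun _ _ => rfl⟩
  let h₁ : V →[G] Z.prod X := ⟨fun t => (t.1.1, t.2.1), fun _ _ => rfl⟩
  let h₂ : V →[G] Z'.prod X' := ⟨fun t => (t.1.2, t.2.2), fun _ _ => rfl⟩
  let p₁ : R₁ →[G] Z.prod (Y.prod X) := ⟨fun t => (t.1.1, t.2.1, t.2.2.1), fun _ _ => rfl⟩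
  let p₂ : R₂ →[G] Z'.prod (Y'.prod X') := ⟨fun t => (t.1.2, t.2.1.2, t.2.2.2), fun _ _ => rfl⟩
  have c₁ : GMeasure.Cartesian (p13 Z Y X) h₁ f₁ p₁ := ⟨fun _ => rfl, by
    rintro ⟨z, y, x⟩ ⟨⟨z₁, z'⟩, ⟨x₁, x'⟩⟩ e
    obtain ⟨rfl, rfl⟩ := Prod.mk.inj e
    refine ⟨((z, z'), y, (x, x')), ⟨rfl, rfl⟩, ?_⟩
    rintro ⟨⟨z₁, z₁'⟩, y₁, ⟨x₁, x₁'⟩⟩ ⟨e1, e2⟩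
    cases e1; cases e2; rfl⟩
  have c₂ : GMeasure.Cartesian (p13 Z' Y' X') (h₂.comp f₁) f₂ p₂ := ⟨fun _ => rfl, by
    rintro ⟨z', y', x'⟩ ⟨⟨z, z₁'⟩, y, ⟨x, x₁'⟩⟩ e
    obtain ⟨rfl, rfl⟩ := Prod.mk.inj e
    refine ⟨((z, z'), (y, y'), (x, x')), ⟨rfl, rfl⟩, ?_⟩
    rintro ⟨⟨z₁, z₁'⟩, ⟨y₁, y₁'⟩, ⟨x₁, x₁'⟩⟩ ⟨e1, e2⟩
    cases e1; cases e2; rfl⟩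
  let φ := (matProd B A).1
  let φ' := (matProd B' A').1
  have hφ : Inv φ := (matProd B A).2
  have hφ' : Inv φ' := (matProd B' A').2
  let ψ : V → k := fun v => μ.push (p13 Z' Y' X') φ' (h₂ v)
  have hψ : Inv ψ := (μ.push_inv _ _).comp h₂
  refine Eq.symm ?_
  calc μ.push (p13 Z Y X) φ (h₁ (z, x)) * ψ (z, x)
      = μ.push f₁ (fun t => φ (p₁ t)) (z, x) * ψ (z, x) :=
        congrArg (fun s => s * ψ (z, x)) (μ.push_cartesian c₁ hφ (z, x))
    _ = μ.push f₁ (fun t => φ (p₁ t) * ψ (f₁ t)) (z, x) := (μ.push_projection f₁ _ hψ _).symm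
    _ = μ.push f₁ (μ.push f₂ fun t => φ' (p₂ t) * φ (p₁ (f₂ t))) (z, x) := by
        refine μ.push_congr f₁ (fun t => ?_) _
        have e1 := μ.push_cartesian c₂ hφ' t
        have e2 := μ.push_projection f₂ (fun t => φ' (p₂ t)) (hφ.comp p₁) t
        exact (mul_comm _ _).trans ((congrArg (fun s => s * φ (p₁ t)) e1).trans e2.symm)
    _ = μ.push (f₁.comp f₂) (fun t => φ' (p₂ t) * φ (p₁ (f₂ t))) (z, x) := μ.push_comp _ _ _ _
    _ = μ.push (f₁.comp f₂) (matProd (kron B B') (kron A A')).1 (z, x) :=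
        μ.push_congr _ (fun t => (mul_comm _ _).trans (mul_mul_mul_comm _ _ _ _)) _

/-- Morphisms `Vec_X ⟶ Vec_Y` are `Y × X` matrices, and composition is matrix multiplication. -/
instance : Category (Perm μ) where
  Hom X Y := Mat k Y.set X.set
  id X := matOne X.set
  comp f g := matMul μ g f
  id_comp f := matMul_one f
  comp_id f := one_matMul f
  assoc f g h := (matMul_assoc h g f).symm

instance : Preadditive (Perm μ) where
  homGroup X Y := inferInstanceAs (AddCommGroup (Mat k Y.set X.set))
  add_comp _ _ _ f f' g := matMul_add g f f'
  comp_add _ _ _ f g g' := add_matMul g g' f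

instance : Linear k (Perm μ) where
  homModule X Y := inferInstanceAs (Module k (Mat k Y.set X.set))
  smul_comp _ _ _ r f g := matMul_smul r g f
  comp_smul _ _ _ f r g := smul_matMul r g f

/-- The morphism given by an isomorphism of `G`-sets. -/
def perm {X Y : Perm μ} (e : GEquiv X.set Y.set) : X ⟶ Y := graph e

/-- The underlying matrix of a morphism. -/
abbrev mat {X Y : Perm μ} (f : X ⟶ Y) : Mat k Y.set X.set := f

theorem hom_ext {X Y : Perm μ} {f g : X ⟶ Y} (h : ∀ y x, (mat f).1 (y, x) = (mat g).1 (y, x)) :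
    f = g := mat_ext h

theorem comp_perm {X Y Z : Perm μ} (f : X ⟶ Y) (e : GEquiv Y.set Z.set) (z : Z.set) (x : X.set) :
    (mat (f ≫ perm e)).1 (z, x) = (mat f).1 (e.symm.e z, x) := graph_matMul e f z x

theorem perm_comp {X Y Z : Perm μ} (e : GEquiv X.set Y.set) (f : Y ⟶ Z) (z : Z.set) (x : X.set) :
    (mat (perm e ≫ f)).1 (z, x) = (mat f).1 (z, e.e x) := matMul_graph e f z x

theorem perm_perm {X Y Z : Perm μ} (e : GEquiv X.set Y.set) (f : GEquiv Y.set Z.set) :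
    (perm e : X ⟶ Y) ≫ (perm f : Y ⟶ Z) = perm (e.trans f) := 
  hom_ext fun z x => perm_comp e (perm f) z x

theorem perm_refl (X : Perm μ) : perm (GEquiv.refl X.set) = 𝟙 X := rfl

theorem perm_congr {X Y : Perm μ} {e e' : GEquiv X.set Y.set} (h : ∀ x, e.e x = e'.e x) :
    (perm e : X ⟶ Y) = perm e' := by
  classical
  exact hom_ext fun y x => if_congr (by rw [h]) rfl rfl

abbrev permIso {X Y : Perm μ} (e : GEquiv X.set Y.set) : X ≅ Y where
  hom := perm e
  inv := perm e.symm
  hom_inv_id := by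
    rw [perm_perm, ← perm_refl]
    exact perm_congr fun x => e.e.symm_apply_apply x
  inv_hom_id := by
    rw [perm_perm, ← perm_refl]
    exact perm_congr fun x => e.e.apply_symm_apply x

/-- The tensor product is given on objects by `Vec_X ⊗ Vec_Y = Vec_{X × Y}`, -/
abbrev tensor (X Y : Perm μ) : Perm μ := vec (X.set.prod Y.set)

/-- and on morphisms by the Kronecker product. -/
def tensorMap {X Y X' Y' : Perm μ} (f : X ⟶ Y) (g : X' ⟶ Y') : tensor X X' ⟶ tensor Y Y' :=
  kron (mat f) (mat g)

theorem ite_mul_ite_of_iff {p q r : Prop} [Decidable p] [Decidable q] [Decidable r]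
    (h : r ↔ p ∧ q) : (if p then (1 : k) else 0) * (if q then 1 else 0) = if r then 1 else 0 := by
  rw [if_congr h rfl rfl]
  split_ifs <;> simp_all

theorem perm_tensorMap {X Y X' Y' : Perm μ} (e : GEquiv X.set Y.set) (f : GEquiv X'.set Y'.set) :
    tensorMap (perm e : X ⟶ Y) (perm f : X' ⟶ Y') =
      perm (X := tensor X X') (Y := tensor Y Y') (e.prod f) := by
  classical
  refine hom_ext fun y x => ?_
  obtain ⟨y, y'⟩ := y
  obtain ⟨x, x'⟩ := x
  have h : ((y, y') = (e.e x, f.e x')) ↔ (y = e.e x ∧ y' = f.e x') := Prod.ext_iff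
  exact ite_mul_ite_of_iff h

theorem tensorMap_id (X Y : Perm μ) : tensorMap (𝟙 X) (𝟙 Y) = 𝟙 (tensor X Y) := by
  rw [← perm_refl, ← perm_refl, perm_tensorMap]; rfl

theorem tensorMap_comp {X₁ Y₁ Z₁ X₂ Y₂ Z₂ : Perm μ} (f₁ : X₁ ⟶ Y₁) (f₂ : X₂ ⟶ Y₂)
    (g₁ : Y₁ ⟶ Z₁) (g₂ : Y₂ ⟶ Z₂) :
    tensorMap f₁ f₂ ≫ tensorMap g₁ g₂ = tensorMap (f₁ ≫ g₁) (f₂ ≫ g₂) :=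
  kron_matMul (mat g₁) (mat f₁) (mat g₂) (mat f₂)

def assocE (X Y Z : FinGSet G) : GEquiv ((X.prod Y).prod Z) (X.prod (Y.prod Z)) :=
  ⟨Equiv.prodAssoc X Y Z, fun _ _ => rfl⟩

def leftE (X : FinGSet G) : GEquiv ((pt G).prod X) X := ⟨Equiv.punitProd X, fun _ _ => rfl⟩

def rightE (X : FinGSet G) : GEquiv (X.prod (pt G)) X := ⟨Equiv.prodPUnit X, fun _ _ => rfl⟩

def swapE (X Y : FinGSet G) : GEquiv (X.prod Y) (Y.prod X) := ⟨Equiv.prodComm X Y, fun _ _ => rfl⟩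

theorem id_pt : (mat (𝟙 (vec (pt G) : Perm μ))).1 ((), ()) = 1 := by
  classical exact if_pos rfl

instance : MonoidalCategoryStruct (Perm μ) where
  tensorObj := tensor
  tensorHom := tensorMap
  whiskerLeft X _ _ f := tensorMap (𝟙 X) f
  whiskerRight f X := tensorMap f (𝟙 X)
  tensorUnit := vec (pt G)
  associator X Y Z := permIso (X := tensor (tensor X Y) Z) (Y := tensor X (tensor Y Z))
    (assocE X.set Y.set Z.set)
  leftUnitor X := permIso (X := tensor (vec (pt G)) X) (leftE X.set)
  rightUnitor X := permIso (X := tensor X (vec (pt G))) (rightE X.set)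

instance : MonoidalCategory (Perm μ) :=
  MonoidalCategory.ofTensorHom
    (id_tensorHom_id := tensorMap_id)
    (id_tensorHom := fun _ _ _ _ => rfl)
    (tensorHom_id := fun _ _ => rfl)
    (tensorHom_comp_tensorHom := tensorMap_comp)
    (associator_naturality := fun f₁ f₂ f₃ => by
      change tensorMap (tensorMap f₁ f₂) f₃ ≫ perm _ = perm _ ≫ tensorMap f₁ (tensorMap f₂ f₃)
      refine hom_ext fun z x => ?_
      rw [comp_perm, perm_comp]
      exact mul_assoc _ _ _)
    (leftUnitor_naturality := fun f => by
      change tensorMap (𝟙 (vec (pt G))) f ≫ perm _ = perm _ ≫ f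
      refine hom_ext fun z x => ?_
      rw [comp_perm, perm_comp]
      change (mat (𝟙 (vec (pt G) : Perm μ))).1 ((), ()) * (mat f).1 (z, x.2) = (mat f).1 (z, x.2)
      rw [id_pt, one_mul])
    (rightUnitor_naturality := fun f => by
      change tensorMap f (𝟙 (vec (pt G))) ≫ perm _ = perm _ ≫ f
      refine hom_ext fun z x => ?_
      rw [comp_perm, perm_comp]
      change (mat f).1 (z, x.1) * (mat (𝟙 (vec (pt G) : Perm μ))).1 ((), ()) = (mat f).1 (z, x.1)
      rw [id_pt, mul_one])
    (pentagon := fun W X Y Z => by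
      change tensorMap (perm _) (perm (GEquiv.refl _)) ≫ perm _ ≫
        tensorMap (perm (GEquiv.refl _)) (perm _) = perm _ ≫ perm _
      rw [perm_tensorMap, perm_tensorMap, perm_perm, perm_perm, perm_perm]
      exact perm_congr fun _ => rfl)
    (triangle := fun X Y => by
      change perm _ ≫ tensorMap (perm (GEquiv.refl _)) (perm _) =
        tensorMap (perm _) (perm (GEquiv.refl _))
      rw [perm_tensorMap, perm_tensorMap, perm_perm]
      exact perm_congr fun _ => rfl)

instance : SymmetricCategory (Perm μ) where
  braiding X Y := permIso (X := tensor X Y) (Y := tensor Y X) (swapE X.set Y.set)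
  braiding_naturality_right X _ _ f := by
    change tensorMap (𝟙 X) f ≫ perm _ = perm _ ≫ tensorMap f (𝟙 X)
    refine hom_ext fun z x => ?_
    rw [comp_perm, perm_comp]
    exact mul_comm _ _
  braiding_naturality_left f Z := by
    change tensorMap f (𝟙 Z) ≫ perm _ = perm _ ≫ tensorMap (𝟙 Z) f
    refine hom_ext fun z x => ?_
    rw [comp_perm, perm_comp]
    exact mul_comm _ _
  hexagon_forward X Y Z := by
    change perm _ ≫ perm _ ≫ perm _ = tensorMap (perm _) (perm (GEquiv.refl _)) ≫ perm _ ≫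
      tensorMap (perm (GEquiv.refl _)) (perm _)
    rw [perm_tensorMap, perm_tensorMap, perm_perm, perm_perm, perm_perm, perm_perm]
    exact perm_congr fun _ => rfl
  hexagon_reverse X Y Z := by
    change perm (GEquiv.symm _) ≫ perm _ ≫ perm (GEquiv.symm _) =
      tensorMap (perm (GEquiv.refl _)) (perm _) ≫ perm (GEquiv.symm _) ≫
        tensorMap (perm _) (perm (GEquiv.refl _))
    rw [perm_tensorMap, perm_tensorMap, perm_perm, perm_perm, perm_perm, perm_perm]
    exact perm_congr fun _ => rfl
  symmetry X Y := by
    change perm _ ≫ perm _ = perm (GEquiv.refl _)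
    rw [perm_perm]
    exact perm_congr fun _ => rfl

instance : MonoidalPreadditive (Perm μ) where
  whiskerLeft_zero {X _ _} := hom_ext fun y x => mul_zero ((mat (𝟙 X)).1 (y.1, x.1))
  zero_whiskerRight {X _ _} := hom_ext fun y x => zero_mul ((mat (𝟙 X)).1 (y.2, x.2))
  whiskerLeft_add _ _ := hom_ext fun _ _ => mul_add _ _ _
  add_whiskerRight _ _ := hom_ext fun _ _ => add_mul _ _ _

instance : MonoidalLinear k (Perm μ) where
  whiskerLeft_smul _ _ _ _ _ := hom_ext fun _ _ => mul_left_comm _ _ _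
  smul_whiskerRight _ _ _ _ _ := hom_ext fun _ _ => mul_assoc _ _ _

end Perm
end PermCat
section Cantor
open Topology Pointwise

/-- A Cantor space: a topological space homeomorphic to the Cantor set. -/
class IsCantorSpace (𝔛 : Type) [TopologicalSpace 𝔛] : Prop where
  exists_homeomorph : Nonempty (𝔛 ≃ₜ cantorSet)

/-- The group of self-homeomorphisms of a space, topologized below by its action on clopen sets. -/
def HomeoGroup (𝔛 : Type) [TopologicalSpace 𝔛] : Type := 𝔛 ≃ₜ 𝔛

variable {𝔛 : Type} [TopologicalSpace 𝔛]

namespace HomeoGroup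

instance : Group (HomeoGroup 𝔛) := inferInstanceAs (Group (𝔛 ≃ₜ 𝔛))

instance : MulAction (HomeoGroup 𝔛) 𝔛 where
  smul g := DFunLike.coe (F := 𝔛 ≃ₜ 𝔛) g
  one_smul _ := rfl
  mul_smul _ _ _ := rfl

theorem continuous_smul' (g : HomeoGroup 𝔛) : Continuous fun x : 𝔛 => g • x :=
  Homeomorph.continuous (X := 𝔛) (Y := 𝔛) g

theorem isClopen_smul (g : HomeoGroup 𝔛) {A : Set 𝔛} (hA : IsClopen A) : IsClopen (g • A) := by
  have h : g • A = (fun x : 𝔛 => g⁻¹ • x) ⁻¹' A := (Set.preimage_smul_inv g A).symm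
  rw [h]
  exact hA.preimage (continuous_smul' g⁻¹)

/-- The intersection `G{A₁} ∩ ⋯ ∩ G{Aₙ}` of setwise stabilizers of a finite family of sets. -/
def stab (s : Finset (Set 𝔛)) : Set (HomeoGroup 𝔛) := {g | ∀ A ∈ s, g • A = A}

/-- The subgroups `G{A₁} ∩ ⋯ ∩ G{Aₙ}`, for clopen `A₁, …, Aₙ`, as a basis of neighbourhoods of the
identity. -/
abbrev basis : GroupFilterBasis (HomeoGroup 𝔛) where
  sets := {U | ∃ s : Finset (Set 𝔛), (∀ A ∈ s, IsClopen A) ∧ U = stab s}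
  nonempty := ⟨_, ∅, by simp, rfl⟩
  inter_sets := by
    classical
    rintro _ _ ⟨s, hs, rfl⟩ ⟨t, ht, rfl⟩
    refine ⟨_, ⟨s ∪ t, ?_, rfl⟩, fun g hg => ⟨fun A hA => hg A ?_, fun A hA => hg A ?_⟩⟩
    · intro A hA
      rcases Finset.mem_union.1 hA with h | h
      · exact hs A h
      · exact ht A h
    · exact Finset.mem_union_left _ hA
    · exact Finset.mem_union_right _ hA
  one' := by
    rintro _ ⟨s, _, rfl⟩ A _
    exact one_smul _ A
  mul' := by
    rintro _ ⟨s, hs, rfl⟩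
    refine ⟨_, ⟨s, hs, rfl⟩, ?_⟩
    rintro _ ⟨a, ha, b, hb, rfl⟩ A hA
    change (a * b) • A = A
    rw [mul_smul, hb A hA, ha A hA]
  inv' := by
    rintro _ ⟨s, hs, rfl⟩
    refine ⟨_, ⟨s, hs, rfl⟩, fun g hg A hA => ?_⟩
    exact inv_smul_eq_iff.2 (hg A hA).symm
  conj' := by
    classical
    rintro g _ ⟨s, hs, rfl⟩
    refine ⟨_, ⟨s.image fun A => g⁻¹ • A, ?_, rfl⟩, fun h hh A hA => ?_⟩
    · intro A hA
      obtain ⟨B, hB, rfl⟩ := Finset.mem_image.1 hA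
      exact isClopen_smul _ (hs B hB)
    · have := hh _ (Finset.mem_image_of_mem _ hA)
      change (g * h * g⁻¹) • A = A
      rw [mul_smul, mul_smul, this, smul_inv_smul]

instance : TopologicalSpace (HomeoGroup 𝔛) := basis.topology

instance : IsTopologicalGroup (HomeoGroup 𝔛) := basis.isTopologicalGroup

theorem exists_stab_subset (U : Subgroup (HomeoGroup 𝔛)) (hU : IsOpen (U : Set (HomeoGroup 𝔛))) :
    ∃ s : Finset (Set 𝔛), (∀ A ∈ s, IsClopen A) ∧ stab s ⊆ (U : Set (HomeoGroup 𝔛)) := by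
  obtain ⟨_, ⟨s, hs, rfl⟩, h⟩ := (basis (𝔛 := 𝔛)).nhds_one_hasBasis.mem_iff.1
    (hU.mem_nhds U.one_mem)
  exact ⟨s, hs, h⟩

theorem isOpen_of_stab_subset (U : Subgroup (HomeoGroup 𝔛)) (s : Finset (Set 𝔛))
    (hs : ∀ A ∈ s, IsClopen A) (h : stab s ⊆ (U : Set (HomeoGroup 𝔛))) :
    IsOpen (U : Set (HomeoGroup 𝔛)) :=
  U.isOpen_of_mem_nhds ((basis (𝔛 := 𝔛)).nhds_one_hasBasis.mem_iff.2 ⟨_, ⟨s, hs, rfl⟩, h⟩)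

end HomeoGroup

/-! Homogeneity of the Cantor space. -/

theorem exists_homeomorph_fin_prod (n : ℕ) :
    Nonempty (Fin (n + 1) × (ℕ → Bool) ≃ₜ (ℕ → Bool)) := by
  have hBool : Nonempty (Bool × (ℕ → Bool) ≃ₜ (ℕ → Bool)) :=
    ⟨((Homeomorph.funUnique Unit Bool).symm.prodCongr (Homeomorph.refl _)).trans
      (Homeomorph.sumArrowHomeomorphProdArrow.symm.trans
        (Homeomorph.piCongrLeft (Y := fun _ => Bool)
          ((Equiv.sumComm Unit ℕ).trans Equiv.natSumPUnitEquivNat)))⟩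
  obtain ⟨b⟩ := hBool
  induction n with
  | zero => exact ⟨Homeomorph.uniqueProd (Fin 1) _⟩
  | succ n ih =>
    obtain ⟨e⟩ := ih
    let e1 : Fin (n + 1 + 1) ≃ₜ Fin (n + 1) ⊕ Fin 1 := finSumFinEquiv.symm.toHomeomorphOfDiscrete
    let e2 : Bool ≃ₜ Fin 1 ⊕ Fin 1 := (Equiv.boolEquivPUnitSumPUnit.{0, 0}.trans
      (Equiv.sumCongr (Equiv.ofUnique _ _) (Equiv.ofUnique _ _))).toHomeomorphOfDiscrete
    let u : Fin 1 × (ℕ → Bool) ≃ₜ (ℕ → Bool) := Homeomorph.uniqueProd _ _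
    exact ⟨(e1.prodCongr (Homeomorph.refl _)).trans <| Homeomorph.sumProdDistrib.trans <|
      ((e.trans u.symm).sumCongr (Homeomorph.refl _)).trans <| Homeomorph.sumProdDistrib.symm.trans <|
      (e2.symm.prodCongr (Homeomorph.refl _)).trans b⟩

theorem exists_homeomorph_finite_prod (T : Type) [TopologicalSpace T] [DiscreteTopology T] [Finite T]
    [Nonempty T] : Nonempty (T × (ℕ → Bool) ≃ₜ (ℕ → Bool)) := by
  obtain ⟨n, ⟨e⟩⟩ := Finite.exists_equiv_fin T
  obtain _ | n := n
  · exact isEmptyElim (e (Classical.arbitrary T))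
  · obtain ⟨f⟩ := exists_homeomorph_fin_prod n
    exact ⟨(e.toHomeomorphOfDiscrete.prodCongr (Homeomorph.refl _)).trans f⟩

theorem exists_depends_lt {K : Set (ℕ → Bool)} (hK : IsClopen K) :
    ∃ N, ∀ x y : ℕ → Bool, (∀ i < N, x i = y i) → (x ∈ K ↔ y ∈ K) := by
  have h : ∀ x : ℕ → Bool, ∃ n, (∀ y ∈ PiNat.cylinder x n, (x ∈ K ↔ y ∈ K)) := by
    intro x
    have hb := PiNat.isTopologicalBasis_cylinders (fun _ : ℕ => Bool)
    by_cases hx : x ∈ K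
    · obtain ⟨_, ⟨z, n, rfl⟩, hxv, hv⟩ := hb.exists_subset_of_mem_open hx hK.isOpen
      refine ⟨n, fun y hy => ⟨fun _ => hv ?_, fun _ => hx⟩⟩
      rwa [← PiNat.mem_cylinder_iff_eq.1 hxv]
    · obtain ⟨_, ⟨z, n, rfl⟩, hxv, hv⟩ := hb.exists_subset_of_mem_open
        (show x ∈ Kᶜ from hx) hK.compl.isOpen
      refine ⟨n, fun y hy => ⟨fun h => absurd h hx, fun h => absurd h (hv ?_)⟩⟩
      rwa [← PiNat.mem_cylinder_iff_eq.1 hxv]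
  choose n hn using h
  obtain ⟨t, _, ht⟩ := isCompact_univ.elim_nhds_subcover (fun x => PiNat.cylinder x (n x))
    (fun x _ => (PiNat.isOpen_cylinder _ x (n x)).mem_nhds (PiNat.self_mem_cylinder x _))
  refine ⟨t.sup n, fun x y hxy => ?_⟩
  obtain ⟨z, hz, hxz⟩ := Set.mem_iUnion₂.1 (ht (Set.mem_univ x))
  have hyz : y ∈ PiNat.cylinder z (n z) := by
    rw [PiNat.mem_cylinder_iff] at hxz ⊢
    intro i hi
    rw [← hxy i (hi.trans_le (Finset.le_sup hz)), hxz i hi]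
  rw [← hn z x hxz, ← hn z y hyz]

theorem exists_homeomorph_clopen {K : Set (ℕ → Bool)} (hK : IsClopen K) (hne : K.Nonempty) :
    Nonempty (K ≃ₜ (ℕ → Bool)) := by
  obtain ⟨N, hN⟩ := exists_depends_lt hK
  let e : (ℕ → Bool) ≃ₜ ({i // i < N} → Bool) × ({i // ¬ i < N} → Bool) :=
    Homeomorph.piEquivPiSubtypeProd (fun i => i < N) (fun _ => Bool)
  have hinf : Infinite {i // ¬ i < N} := by
    have : {i | ¬ i < N}.Infinite := (Set.finite_lt_nat N).infinite_compl
    exact this.to_subtype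
  obtain ⟨r⟩ := nonempty_equiv_of_countable (α := {i // ¬ i < N}) (β := ℕ)
  let T : Set ({i // i < N} → Bool) := {t | ∃ x ∈ K, (e x).1 = t}
  have hT : ∀ x, x ∈ K ↔ (e x).1 ∈ T := by
    intro x
    refine ⟨fun h => ⟨x, h, rfl⟩, ?_⟩
    rintro ⟨y, hy, hxy⟩
    refine (hN y x fun i hi => ?_).1 hy
    exact congrFun hxy ⟨i, hi⟩
  have : Nonempty T := by
    obtain ⟨x, hx⟩ := hne
    exact ⟨⟨_, (hT x).1 hx⟩⟩
  obtain ⟨f⟩ := exists_homeomorph_finite_prod T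
  let e' : K ≃ₜ {p : ({i // i < N} → Bool) × ({i // ¬ i < N} → Bool) // p.1 ∈ T} :=
    e.subtype hT
  let e'' : {p : ({i // i < N} → Bool) × ({i // ¬ i < N} → Bool) // p.1 ∈ T} ≃ₜ
      T × ({i // ¬ i < N} → Bool) :=
    { toFun := fun p => (⟨p.1.1, p.2⟩, p.1.2)
      invFun := fun p => ⟨(p.1.1, p.2), p.1.2⟩
      left_inv := fun _ => rfl
      right_inv := fun _ => rfl
      continuous_toFun := by fun_prop
      continuous_invFun := by fun_prop }
  exact ⟨e'.trans <| e''.trans <| ((Homeomorph.refl _).prodCongr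
    (Homeomorph.piCongrLeft (Y := fun _ => Bool) r)).trans f⟩

theorem exists_homeomorph_clopen' [IsCantorSpace 𝔛] {K : Set 𝔛} (hK : IsClopen K)
    (hne : K.Nonempty) : Nonempty (K ≃ₜ (ℕ → Bool)) := by
  obtain ⟨e⟩ := IsCantorSpace.exists_homeomorph (𝔛 := 𝔛)
  let e := e.trans cantorSetHomeomorphNatToBool
  obtain ⟨f⟩ := exists_homeomorph_clopen (K := e.symm ⁻¹' K) (hK.preimage e.symm.continuous)
    (hne.preimage e.symm.surjective)
  exact ⟨(e.subtype fun x => by simp).trans f⟩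

/-- Two locally constant functions on a Cantor space with the same image differ by a
homeomorphism. -/
theorem exists_homeo_of_range_eq [IsCantorSpace 𝔛] {F : Type} (φ ψ : LocallyConstant 𝔛 F)
    (h : Set.range φ = Set.range ψ) : ∃ g : HomeoGroup 𝔛, ∀ x : 𝔛, ψ (g • x) = φ x := by
  have hσ : ∀ a, Nonempty ({x // φ x = a} ≃ₜ {x // ψ x = a}) := by
    intro a
    by_cases ha : a ∈ Set.range φ
    · have hb : a ∈ Set.range ψ := h ▸ ha
      obtain ⟨e⟩ := exists_homeomorph_clopen' (φ.isLocallyConstant.isClopen_fiber a) ha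
      obtain ⟨f⟩ := exists_homeomorph_clopen' (ψ.isLocallyConstant.isClopen_fiber a) hb
      exact ⟨e.trans f.symm⟩
    · have h1 : IsEmpty {x // φ x = a} := ⟨fun x => ha ⟨x.1, x.2⟩⟩
      have h2 : IsEmpty {x // ψ x = a} := ⟨fun x => ha (h ▸ ⟨x.1, x.2⟩)⟩
      exact ⟨Homeomorph.empty⟩
  have σ := fun a => (hσ a).some
  have hc : ∀ χ : LocallyConstant 𝔛 F, Nonempty {e : (Σ a, {x // χ x = a}) ≃ₜ 𝔛 //
      ∀ p, e p = p.2.1} := fun χ =>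
    ⟨⟨(Equiv.sigmaFiberEquiv χ).toHomeomorphOfContinuousOpen
      (continuous_sigma fun a => continuous_subtype_val)
      (isOpenMap_sigma.2 fun a => (χ.isLocallyConstant.isOpen_fiber a).isOpenMap_subtype_val),
      fun _ => rfl⟩⟩
  obtain ⟨⟨a, ha⟩⟩ := hc φ
  obtain ⟨⟨b, hb⟩⟩ := hc ψ
  let m : (Σ a, {x // φ x = a}) ≃ₜ (Σ a, {x // ψ x = a}) :=
    { toEquiv := Equiv.sigmaCongrRight fun a => (σ a).toEquiv
      continuous_toFun := continuous_sigma fun i => continuous_sigmaMk.comp (σ i).continuous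
      continuous_invFun := continuous_sigma fun i =>
        continuous_sigmaMk.comp (σ i).symm.continuous }
  refine ⟨a.symm.trans (m.trans b), fun x => ?_⟩
  obtain ⟨p, rfl⟩ := a.surjective x
  change ψ (b (m (a.symm (a p)))) = φ (a p)
  rw [a.symm_apply_apply, ha, hb, p.2.2]
  exact (m p).2.2

end Cantor
section CantorSets
open MulAction Pointwise FinGSet
universe w
variable (𝔛 : Type) [TopologicalSpace 𝔛]

/-- Membership in a clopen set, as a locally constant function. -/
def memLC {𝔛 : Type} [TopologicalSpace 𝔛] (A : Set 𝔛) (hA : IsClopen A) :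
    LocallyConstant 𝔛 Prop where
  toFun x := x ∈ A
  isLocallyConstant := (IsLocallyConstant.iff_exists_open _).2 fun x => by
    by_cases hx : x ∈ A
    · exact ⟨A, hA.isOpen, hx, fun y hy => propext ⟨fun _ => hx, fun _ => hy⟩⟩
    · exact ⟨Aᶜ, hA.compl.isOpen, hx, fun y hy =>
        propext ⟨fun h => absurd h hy, fun h => absurd h hx⟩⟩

instance [IsCantorSpace 𝔛] : RoelckePrecompact (HomeoGroup 𝔛) where
  finite_doubleCoset U V hU hV := by
    obtain ⟨s, hs, hsU⟩ := HomeoGroup.exists_stab_subset U hU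
    obtain ⟨t, ht, htV⟩ := HomeoGroup.exists_stab_subset V hV
    let φ : HomeoGroup 𝔛 → LocallyConstant 𝔛 (s ⊕ t → Prop) := fun g =>
      LocallyConstant.unflip (Sum.elim (fun A => memLC A.1 (hs A.1 A.2))
        (fun B => memLC (g • B.1) (HomeoGroup.isClopen_smul g (ht B.1 B.2))))
    refine Finite.of_injective (β := Set (s ⊕ t → Prop)) (fun q => Set.range (φ q.out)) ?_
    intro q q' hq
    obtain ⟨h, hh⟩ := exists_homeo_of_range_eq (φ q.out) (φ q'.out) hq
    rw [← Quotient.out_eq q, ← Quotient.out_eq q']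
    refine Quotient.sound (DoubleCoset.rel_iff.2 ?_)
    have h1 : ∀ A ∈ s, h • A = A := by
      intro A hA
      ext x
      have := congrFun (hh (h⁻¹ • x)) (Sum.inl ⟨A, hA⟩)
      rw [smul_inv_smul] at this
      rw [Set.mem_smul_set_iff_inv_smul_mem]
      exact (iff_of_eq this).symm
    have h2 : ∀ B ∈ t, h • q.out • B = q'.out • B := by
      intro B hB
      ext x
      have := congrFun (hh (h⁻¹ • x)) (Sum.inr ⟨B, hB⟩)
      rw [smul_inv_smul] at this
      rw [Set.mem_smul_set_iff_inv_smul_mem]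
      exact (iff_of_eq this).symm
    refine ⟨h, hsU h1, q.out⁻¹ * h⁻¹ * q'.out, htV fun B hB => ?_, ?_⟩
    · rw [mul_smul, mul_smul, ← h2 B hB, inv_smul_smul, inv_smul_smul]
    · group

variable [IsCantorSpace 𝔛]

/-- The action of homeomorphisms on functions: `g • φ = φ ∘ g⁻¹`. -/
abbrev actionY (A : Type) : MulAction (HomeoGroup 𝔛) (LocallyConstant 𝔛 A) where
  smul g φ := ⟨fun x => φ (g⁻¹ • x),
    φ.isLocallyConstant.comp_continuous (HomeoGroup.continuous_smul' g⁻¹)⟩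
  one_smul φ := LocallyConstant.ext fun x => rfl
  mul_smul g h φ := LocallyConstant.ext fun x => by
    change φ ((g * h)⁻¹ • x) = φ (h⁻¹ • g⁻¹ • x)
    rw [mul_inv_rev, mul_smul]

/-- The `G`-set `Y(A)` of continuous maps from the Cantor space `𝔛` to the discrete space `A`. -/
def setY (A : Type) [Finite A] : FinGSet (HomeoGroup 𝔛) where
  carrier := LocallyConstant 𝔛 A
  action := actionY 𝔛 A
  smooth φ := by
    classical
    let _ := actionY 𝔛 A
    have := Fintype.ofFinite A
    refine HomeoGroup.isOpen_of_stab_subset _ (Finset.univ.image fun a => {x | φ x = a}) ?_ ?_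
    · intro K hK
      obtain ⟨a, _, rfl⟩ := Finset.mem_image.1 hK
      exact φ.isLocallyConstant.isClopen_fiber a
    · intro g hg
      refine LocallyConstant.ext fun x => ?_
      have h1 := hg {y | φ y = φ x} (Finset.mem_image_of_mem _ (Finset.mem_univ _))
      have h2 : x ∈ g • {y | φ y = φ x} := by rw [h1]; rfl
      exact Set.mem_smul_set_iff_inv_smul_mem.1 h2
  finitary := by
    let _ := actionY 𝔛 A
    refine Finite.of_injective (β := Set A) (fun q => Set.range (q.out : LocallyConstant 𝔛 A)) ?_
    intro q q' hq
    obtain ⟨g, hg⟩ := exists_homeo_of_range_eq _ _ hq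
    rw [← Quotient.out_eq q, ← Quotient.out_eq q']
    refine Quotient.sound ⟨g⁻¹, LocallyConstant.ext fun x => ?_⟩
    change q'.out (g⁻¹⁻¹ • x) = q.out x
    rw [inv_inv, hg]

variable {𝔛}

/-- The map `Y(f) : Y(A) → Y(B)` given by composition with `f : A → B`. -/
def mapY {A B : Type} [Finite A] [Finite B] (f : A → B) : setY 𝔛 A →[HomeoGroup 𝔛] setY 𝔛 B where
  toFun φ := LocallyConstant.map f φ
  map_smul' _ _ := rfl

variable (𝔛)

/-- The `G`-stable subset `Y(D)` of `Y(A)`, for `D` a subset of `A`. -/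
def subY {A : Type} [Finite A] (D : Set A) : SubMulAction (HomeoGroup 𝔛) (setY 𝔛 A) where
  carrier := {φ : LocallyConstant 𝔛 A | ∀ x, φ x ∈ D}
  smul_mem' g _ h x := h (g⁻¹ • x)

/-- The `G`-stable subset `X(A)` of `Y(A)` consisting of the surjective maps. -/
def subX (A : Type) [Finite A] : SubMulAction (HomeoGroup 𝔛) (setY 𝔛 A) where
  carrier := {φ : LocallyConstant 𝔛 A | Function.Surjective φ}
  smul_mem' g φ h a := by
    obtain ⟨x, hx⟩ := h a
    exact ⟨g • x, (congrArg (LocallyConstant.toFun φ) (inv_smul_smul g x)).trans hx⟩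

/-- The `G`-set `X(n)` of surjective continuous maps from `𝔛` to the discrete space with `n`
points. -/
def setX (n : ℕ) : FinGSet (HomeoGroup 𝔛) := (setY 𝔛 (Fin n)).sub (subX 𝔛 (Fin n))

variable {𝔛}

/-- The characterization of `ν`: it is regular, and `ν(X(n)) = (-1)^(n-1)` for `n ≥ 1`. -/
def IsNu (ν : GMeasure (HomeoGroup 𝔛) ℚ) : Prop :=
  ν.Regular ∧ ∀ n : ℕ, 1 ≤ n → ν.value (setX 𝔛 n) = (-1) ^ (n - 1)

open scoped Classical in
/-- The indicator function of a `G`-stable subset. -/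
def indicator (k : Type w) [CommRing k] {G : Type} [Group G] [TopologicalSpace G] {X : FinGSet G}
    (S : SubMulAction G X) : InvFun k X :=
  ⟨fun x => if x ∈ S then 1 else 0, fun g x => if_congr
    ⟨fun h => by simpa using S.smul_mem g⁻¹ h, S.smul_mem g⟩ rfl rfl⟩

end CantorSets

end CantorPerm
end

/-! Partitions. A point of a smooth `G`-set is fixed by all homeomorphisms that preserve each part
of some finite clopen partition of the Cantor space. Among the partitions that support a point in
this sense there is a coarsest one, and the stabilizer of the point permutes its parts
(`exists_exact`, `exact_factor`). Since surjections onto a finite set are all conjugate under `G`, a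
transitive `G`-set `X` receives a map `q : X(n) → X` whose fibres are the classes under a set `Γ` of
permutations of the `n` parts (`ExactCover.q_eq_iff`); in effect `X = X(n)/Γ`.

Existence of `ν`. The Euler characteristic of a `G`-set counts the points whose coarsest partition
is a fixed standard one with `n + 1` parts, each with weight `(-1)^n / (n+1)!`. On `X(n)/Γ` it
equals `(-1)^(n-1) / |Γ|`, which is never zero, so a map `X → Y` can be given the quotient of the
two Euler characteristics. Normalization, additivity and multiplicativity are formal. For base
change everything is pulled back to covers by `X(a)`, `X(b)` and `X(c)`. There the claim becomes an
alternating sum over the subsets of a fibre product of finite sets that project onto both factors,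
and Möbius inversion evaluates it (`sum_fibreProduct_sign`).

Uniqueness of `ν`. The base change of `q` along itself is a union of copies of `X(n)`, so every
measure gives `q` the number of these copies. As `ν(X) ν(q) = ν(X(n))`, the values on transitive
sets are forced, and by regularity so are those on all maps.

Push-forwards. The orbits on `Y(A)` are the non-empty subsets `S` of `A`, of measure `-(-1)^|S|`.
The coefficient of `Y(f)_* 1` at the orbit `T` is therefore the sum of `(-1)^(|S|+|T|)` over the `S`
with `f(S) = T`, which is `1` when `T` lies in the image of `f` and `0` otherwise
(`sum_image_eq_sign`). This is part (b).

The equivalence. A Boolean matrix `R` is sent to the indicator function of the pairs `(ψ, φ)` that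
are related by `R` at every point of the Cantor space. Part (b) makes this compatible with
composition: the push-forward of the indicator of the composable triples is the indicator of the
composable pairs (`PushY.relMat_mul`). The resulting functor is extended to linear combinations,
direct sums and images of idempotents. The value at `(ψ, φ)` of a combination of matrices is the sum
of the coefficients of those whose support contains the joint image of `(ψ, φ)`, a non-empty set.
This system is triangular for inclusion, so the functor is full and kills only the multiples of the
zero matrices, whose support is empty; cutting with `1 - [0]` removes precisely these. Finally,
regularity makes `Vec_X` a summand of a sum of modules `Vec_{X(n)}`, and these are summands of
`Vec_{Y(n)}`, whence essential surjectivity (`exists_retract`). -/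

noncomputable section
namespace CantorPerm
set_option linter.unusedSectionVars false
-- Supporting partitions of points of smooth `G`-sets
section Support
open MulAction Pointwise FinGSet
variable {𝔛 : Type} [TopologicalSpace 𝔛]

/-- The pair of two locally constant functions. -/
def pairLC {E F : Type} (φ : LocallyConstant 𝔛 E) (ψ : LocallyConstant 𝔛 F) :
    LocallyConstant 𝔛 (E × F) where
  toFun x := (φ x, ψ x)
  isLocallyConstant := φ.isLocallyConstant.prodMk ψ.isLocallyConstant

/-- The composite of a locally constant function with a homeomorphism. -/
def compLC {E : Type} (φ : LocallyConstant 𝔛 E) (g : HomeoGroup 𝔛) : LocallyConstant 𝔛 E where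
  toFun x := φ (g • x)
  isLocallyConstant := φ.isLocallyConstant.comp_continuous (HomeoGroup.continuous_smul' g)

@[simp] theorem compLC_apply {E : Type} (φ : LocallyConstant 𝔛 E) (g : HomeoGroup 𝔛) (x : 𝔛) :
    compLC φ g x = φ (g • x) := rfl

variable [IsCantorSpace 𝔛]

theorem nonempty_cantor (𝔛 : Type) [TopologicalSpace 𝔛] [IsCantorSpace 𝔛] : Nonempty 𝔛 := by
  obtain ⟨e⟩ := IsCantorSpace.exists_homeomorph (𝔛 := 𝔛)
  exact ⟨(e.trans cantorSetHomeomorphNatToBool).symm fun _ => true⟩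

/-- The Cantor space is homeomorphic to its product with `A`, and the projection to `A` is as
required. -/
theorem exists_surjective_locallyConstant (𝔛 : Type) [TopologicalSpace 𝔛] [IsCantorSpace 𝔛]
    (A : Type) [Finite A] [Nonempty A] :
    ∃ φ : LocallyConstant 𝔛 A, Function.Surjective φ := by
  obtain ⟨e⟩ := IsCantorSpace.exists_homeomorph (𝔛 := 𝔛)
  let _ : TopologicalSpace A := ⊥
  have : DiscreteTopology A := ⟨rfl⟩
  obtain ⟨f⟩ := exists_homeomorph_finite_prod A
  let h : 𝔛 ≃ₜ A × (ℕ → Bool) := (e.trans cantorSetHomeomorphNatToBool).trans f.symm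
  refine ⟨⟨fun x => (h x).1, (IsLocallyConstant.iff_continuous _).2 (by fun_prop)⟩, fun a => ?_⟩
  exact ⟨h.symm (a, fun _ => true), congrArg Prod.fst (h.apply_symm_apply _)⟩

/-- A locally constant function on a Cantor space extends to one with any prescribed joint image. -/
theorem exists_extension {E F : Type} [Finite E] [Finite F] (φ : LocallyConstant 𝔛 F)
    (T : F → E → Prop) (h1 : ∀ x, ∃ e, T (φ x) e) (h2 : ∀ f e, T f e → ∃ x, φ x = f) :
    ∃ χ : LocallyConstant 𝔛 E, (∀ x, T (φ x) (χ x)) ∧ ∀ f e, T f e → ∃ x, φ x = f ∧ χ x = e := by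
  obtain ⟨x₀⟩ := nonempty_cantor 𝔛
  have : Nonempty {p : F × E // T p.1 p.2} := by
    obtain ⟨e, he⟩ := h1 x₀
    exact ⟨⟨(_, e), he⟩⟩
  -- The first coordinate of a surjection onto the graph of `T` has the same image as `φ`, so a
  -- homeomorphism carries one to the other; the second coordinate is transported along.
  obtain ⟨ρ, hρ⟩ := exists_surjective_locallyConstant 𝔛 {p : F × E // T p.1 p.2}
  obtain ⟨g, hg⟩ := exists_homeo_of_range_eq φ (ρ.map fun p => p.1.1) (by
    ext f
    constructor
    · rintro ⟨x, rfl⟩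
      obtain ⟨e, he⟩ := h1 x
      obtain ⟨y, hy⟩ := hρ ⟨(_, e), he⟩
      exact ⟨y, congrArg (fun p => p.1.1) hy⟩
    · rintro ⟨y, rfl⟩
      exact h2 _ _ (ρ y).2)
  have hg : ∀ x, (ρ (g • x)).1.1 = φ x := hg
  refine ⟨compLC (ρ.map fun p => p.1.2) g, fun x => ?_, fun f e he => ?_⟩
  · have := (ρ (g • x)).2
    rwa [hg] at this
  · obtain ⟨y, hy⟩ := hρ ⟨(f, e), he⟩
    refine ⟨g⁻¹ • y, ?_, ?_⟩
    · rw [← hg, smul_inv_smul, hy]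
    · change (ρ (g • g⁻¹ • y)).1.2 = e
      rw [smul_inv_smul, hy]

/-- The homeomorphisms that preserve every fibre of `φ` fix `x`. -/
def Supports {X : FinGSet (HomeoGroup 𝔛)} {F : Type} (φ : LocallyConstant 𝔛 F) (x : X) : Prop :=
  ∀ g : HomeoGroup 𝔛, (∀ t : 𝔛, φ (g • t) = φ t) → g • x = x

/-- The partition into the fibres of `φ` is the coarsest one that supports `x`: it does, and the
stabilizer of `x` permutes the fibres. -/
def Exact {X : FinGSet (HomeoGroup 𝔛)} {F : Type} (φ : LocallyConstant 𝔛 F) (x : X) : Prop :=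
  Supports φ x ∧ ∀ g : HomeoGroup 𝔛, g • x = x → ∀ s t : 𝔛, φ s = φ t → φ (g • s) = φ (g • t)

variable {X : FinGSet (HomeoGroup 𝔛)} {F : Type}

theorem Exact.iff {φ : LocallyConstant 𝔛 F} {x : X} (h : Exact φ x) {g : HomeoGroup 𝔛}
    (hg : g • x = x) (s t : 𝔛) : φ (g • s) = φ (g • t) ↔ φ s = φ t := by
  refine ⟨fun e => ?_, h.2 g hg s t⟩
  have := h.2 g⁻¹ (inv_smul_eq_iff.2 hg.symm) _ _ e
  rwa [inv_smul_smul, inv_smul_smul] at this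

theorem Supports.of_ker {E : Type} {φ : LocallyConstant 𝔛 F} {χ : LocallyConstant 𝔛 E} {x : X}
    (h : Supports φ x) (hk : ∀ s t, χ s = χ t → φ s = φ t) : Supports χ x :=
  fun g hg => h g fun t => hk _ _ (hg t)

theorem Exact.of_ker {E : Type} {φ : LocallyConstant 𝔛 F} {χ : LocallyConstant 𝔛 E} {x : X}
    (h : Exact φ x) (hk : ∀ s t, χ s = χ t ↔ φ s = φ t) : Exact χ x :=
  ⟨h.1.of_ker fun s t => (hk s t).1, fun g hg s t e => (hk _ _).2 (h.2 g hg s t ((hk _ _).1 e))⟩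

/-- If a fibre of `χ` met several fibres of `φ`, a homeomorphism preserving `χ` could scramble these
inside it. It would fix `x` without permuting the fibres of `φ`, against exactness. -/
theorem exact_factor {E : Type} [Finite E] [Finite F] {φ : LocallyConstant 𝔛 F}
    {χ : LocallyConstant 𝔛 E} {x : X} (h : Exact φ x) (hχ : Supports χ x) (s t : 𝔛)
    (hst : χ s = χ t) : φ s = φ t := by
  -- On each non-empty cell of `(χ, φ)`, the function `φ'` takes all the values that `φ` takes on
  -- the surrounding fibre of `χ`.
  obtain ⟨φ', h1, h2⟩ := exists_extension (pairLC χ φ)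
    (fun p f => (∃ u, χ u = p.1 ∧ φ u = p.2) ∧ ∃ u, χ u = p.1 ∧ φ u = f)
    (fun u => ⟨φ u, ⟨u, rfl, rfl⟩, ⟨u, rfl, rfl⟩⟩)
    (fun p f h => h.1.imp fun u hu => Prod.ext hu.1 hu.2)
  -- The pairs `(χ, φ)` and `(χ, φ')` have the same image, so `φ` and `φ'` differ by a homeomorphism
  -- preserving `χ`, which therefore fixes `x`.
  obtain ⟨g, hg⟩ := exists_homeo_of_range_eq (pairLC χ φ) (pairLC χ φ') (by
    ext ⟨e, f⟩
    constructor
    · rintro ⟨u, hu⟩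
      obtain ⟨rfl, rfl⟩ := Prod.mk.inj hu
      obtain ⟨v, hv1, hv2⟩ := h2 (χ u, φ u) (φ u) ⟨⟨u, rfl, rfl⟩, ⟨u, rfl, rfl⟩⟩
      exact ⟨v, Prod.ext (Prod.mk.inj hv1).1 hv2⟩
    · rintro ⟨u, hu⟩
      obtain ⟨rfl, rfl⟩ := Prod.mk.inj hu
      obtain ⟨v, hv1, hv2⟩ := (h1 u).2
      exact ⟨v, Prod.ext hv1 hv2⟩)
  have hgχ : ∀ u, χ (g • u) = χ u := fun u => (Prod.mk.inj (hg u)).1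
  have hgφ : ∀ u, φ' (g • u) = φ u := fun u => (Prod.mk.inj (hg u)).2
  have hgx : g⁻¹ • x = x := inv_smul_eq_iff.2 (hχ g hgχ).symm
  -- Both `a` and `b` lie in the part of `s` under `φ`, but `g⁻¹` carries them into the parts of `s`
  -- and of `t`.
  obtain ⟨a, ha1, ha2⟩ := h2 (χ s, φ s) (φ s) ⟨⟨s, rfl, rfl⟩, ⟨s, rfl, rfl⟩⟩
  obtain ⟨b, hb1, hb2⟩ := h2 (χ s, φ s) (φ t) ⟨⟨s, rfl, rfl⟩, ⟨t, hst.symm, rfl⟩⟩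
  have hab : φ a = φ b := ((Prod.mk.inj ha1).2).trans (Prod.mk.inj hb1).2.symm
  have := h.2 g⁻¹ hgx a b hab
  rw [← hgφ, ← hgφ, smul_inv_smul, smul_inv_smul, ha2, hb2] at this
  exact this

theorem exists_fin_ker [Finite F] (φ : LocallyConstant 𝔛 F) : ∃ (n : ℕ)
    (ψ : LocallyConstant 𝔛 (Fin n)), Function.Surjective ψ ∧ ∀ s t, ψ s = ψ t ↔ φ s = φ t := by
  obtain ⟨n, ⟨e⟩⟩ := Finite.exists_equiv_fin (Set.range φ)
  refine ⟨n, ⟨fun x => e ⟨φ x, x, rfl⟩, ?_⟩, fun i => ?_, fun s t => ?_⟩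
  · exact (IsLocallyConstant.iff_exists_open _).2 fun x => by
      obtain ⟨U, hU, hx, h⟩ := (IsLocallyConstant.iff_exists_open _).1 φ.isLocallyConstant x
      exact ⟨U, hU, hx, fun y hy => congrArg e (Subtype.ext (h y hy))⟩
  · obtain ⟨x, hx⟩ := (e.symm i).2
    exact ⟨x, e.symm.injective (Subtype.ext (by
      exact (congrArg Subtype.val (e.symm_apply_apply ⟨φ x, x, rfl⟩)).trans hx))⟩
  · exact e.apply_eq_iff_eq.trans Subtype.ext_iff

/-- The open stabilizer contains the common stabilizer of finitely many clopen sets, and the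
partition that these generate supports the point. -/
theorem exists_supports (x : X) : ∃ (n : ℕ) (φ : LocallyConstant 𝔛 (Fin n)),
    Function.Surjective φ ∧ Supports φ x := by
  obtain ⟨s, hs, h⟩ := HomeoGroup.exists_stab_subset _ (X.smooth x)
  let χ : LocallyConstant 𝔛 (s → Prop) := LocallyConstant.unflip fun A => memLC A.1 (hs A.1 A.2)
  obtain ⟨n, φ, hφ, hk⟩ := exists_fin_ker χ
  refine ⟨n, φ, hφ, Supports.of_ker (φ := χ) (fun g hg => ?_) fun s t => (hk s t).1⟩
  refine h fun A hA => ?_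
  ext y
  have := congrFun (hg (g⁻¹ • y)) ⟨A, hA⟩
  rw [smul_inv_smul] at this
  rw [Set.mem_smul_set_iff_inv_smul_mem]
  exact (iff_of_eq this).symm

/-- A supporting partition with the least number of parts is exact. If an element `h` of the
stabilizer sent two points of one part into different parts `a` and `a'`, the partition with `a` and
`a'` merged would still support `x`. -/
theorem exists_exact (x : X) : ∃ (n : ℕ) (φ : LocallyConstant 𝔛 (Fin n)),
    Function.Surjective φ ∧ Exact φ x := by
  classical
  have hex := exists_supports x
  obtain ⟨φ, hφ, hs⟩ := Nat.find_spec hex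
  have hmin := fun m => @Nat.find_min _ _ hex m
  generalize Nat.find hex = n at φ hφ hs hmin
  refine ⟨n, φ, hφ, hs, fun h hx p q hpq => ?_⟩
  by_contra hne
  -- two fibres that can be merged
  set a := φ (h • p) with ha
  set a' := φ (h • q) with ha'
  -- Two homeomorphisms whose pullbacks of `φ` differ only by confusing `a` with `a'` have inverses
  -- with the same effect on `x`, provided that the two pullbacks agree somewhere on every part.
  have key : ∀ g₁ g₂ : HomeoGroup 𝔛, (∀ i, ∃ u, φ (g₁ • u) = i ∧ φ (g₂ • u) = i) →
      (∀ u, φ (g₁ • u) = φ (g₂ • u) ∨ (φ (g₁ • u) = a ∨ φ (g₁ • u) = a') ∧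
        (φ (g₂ • u) = a ∨ φ (g₂ • u) = a')) → g₁⁻¹ • x = g₂⁻¹ • x := by
    intro g₁ g₂ hd hS
    -- `χ` is such that `(φ ∘ g₁, χ)` and `(φ ∘ g₂, χ)` both have the image of `(φ ∘ h, φ)`. Where
    -- the two pullbacks disagree, the common value of `φ` at `p` and `q` is admissible, because `h`
    -- sends `p` into `a` and `q` into `a'`.
    obtain ⟨χ, h1, h2⟩ := exists_extension (pairLC (compLC φ g₁) (compLC φ g₂))
      (fun p b => (∃ u, φ (g₁ • u) = p.1 ∧ φ (g₂ • u) = p.2) ∧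
        (∃ u, φ (h • u) = p.1 ∧ φ u = b) ∧ ∃ u, φ (h • u) = p.2 ∧ φ u = b)
      (by
        intro u
        have hm : ∀ c, c = a ∨ c = a' → ∃ v, φ (h • v) = c ∧ φ v = φ p := by
          rintro c (rfl | rfl)
          · exact ⟨p, rfl, rfl⟩
          · exact ⟨q, rfl, hpq.symm⟩
        rcases hS u with e | ⟨e1, e2⟩
        · obtain ⟨v, hv⟩ := hφ (φ (g₁ • u))
          have hv' : φ (h • h⁻¹ • v) = φ (g₁ • u) := by rw [smul_inv_smul, hv]
          exact ⟨φ (h⁻¹ • v), ⟨u, rfl, rfl⟩, ⟨_, hv', rfl⟩, ⟨_, hv'.trans e, rfl⟩⟩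
        · exact ⟨φ p, ⟨u, rfl, rfl⟩, hm _ e1, hm _ e2⟩)
      (fun p b hb => hb.1.imp fun u hu => Prod.ext hu.1 hu.2)
    -- If `k` carries `(φ ∘ h, φ)` to `(φ ∘ g, χ)`, then `g k h⁻¹` preserves `φ` and so fixes `x`;
    -- since `h` fixes `x`, this says `k x = g⁻¹ x`.
    have hk : ∀ g : HomeoGroup 𝔛, (∀ u, ∃ v, φ (h • v) = φ (g • u) ∧ φ v = χ u) →
        (∀ v, ∃ u, φ (g • u) = φ (h • v) ∧ χ u = φ v) →
        ∃ k : HomeoGroup 𝔛, (∀ u, χ (k • u) = φ u) ∧ k • x = g⁻¹ • x := by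
      intro g h3 h4
      obtain ⟨k, hk⟩ := exists_homeo_of_range_eq (pairLC (compLC φ h) φ) (pairLC (compLC φ g) χ) (by
        ext ⟨e, f⟩
        constructor
        · rintro ⟨v, hv⟩
          obtain ⟨rfl, rfl⟩ := Prod.mk.inj hv
          obtain ⟨u, hu⟩ := h4 v
          exact ⟨u, Prod.ext hu.1 hu.2⟩
        · rintro ⟨u, hu⟩
          obtain ⟨rfl, rfl⟩ := Prod.mk.inj hu
          obtain ⟨v, hv⟩ := h3 u
          exact ⟨v, Prod.ext hv.1 hv.2⟩)
      refine ⟨k, fun u => (Prod.mk.inj (hk u)).2, ?_⟩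
      have := hs (g * k * h⁻¹) fun t => by
        have := (Prod.mk.inj (hk (h⁻¹ • t))).1
        simp only [compLC_apply, smul_inv_smul] at this
        rw [mul_smul, mul_smul, this]
      rw [mul_smul, mul_smul, inv_smul_eq_iff.2 hx.symm] at this
      exact eq_inv_smul_iff.2 this
    obtain ⟨k₁, hk1, hk1'⟩ := hk g₁ (fun u => (h1 u).2.1) (fun v => by
      obtain ⟨w, hw⟩ := hd (φ (h • v))
      obtain ⟨u, hu1, hu2⟩ := h2 (φ (h • v), φ (h • v)) (φ v) ⟨⟨w, hw⟩, ⟨v, rfl, rfl⟩, ⟨v, rfl, rfl⟩⟩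
      exact ⟨u, (Prod.mk.inj hu1).1, hu2⟩)
    obtain ⟨k₂, hk2, hk2'⟩ := hk g₂ (fun u => (h1 u).2.2) (fun v => by
      obtain ⟨w, hw⟩ := hd (φ (h • v))
      obtain ⟨u, hu1, hu2⟩ := h2 (φ (h • v), φ (h • v)) (φ v) ⟨⟨w, hw⟩, ⟨v, rfl, rfl⟩, ⟨v, rfl, rfl⟩⟩
      exact ⟨u, (Prod.mk.inj hu1).2, hu2⟩)
    rw [← hk1', ← hk2']
    -- `k₁` and `k₂` both pull `χ` back to `φ`, so `k₁⁻¹ k₂` preserves `φ`.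
    have := hs (k₁⁻¹ * k₂) fun t => by rw [← hk1, ← hk2, mul_smul, smul_inv_smul]
    rw [mul_smul, inv_smul_eq_iff] at this
    exact this.symm
  -- `m` merges `a'` into `a`; the partition `m ∘ φ` has one part fewer than `φ`.
  let m : Fin n → {i : Fin n // i ≠ a'} := fun i => if hi : i = a' then ⟨a, hne⟩ else ⟨i, hi⟩
  have hm : ∀ i j, m i = m j → i = j ∨ (i = a ∨ i = a') ∧ (j = a ∨ j = a') := by
    intro i j hij
    by_cases hi : i = a' <;> by_cases hj : j = a' <;> simp [m, hi, hj] at hij ⊢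
    · exact Or.inr hij.symm
    · exact hij
    · exact Or.inl hij
  have hma : m a = m a' := by simp [m, hne]
  obtain ⟨k, ⟨e⟩⟩ := Finite.exists_equiv_fin {i : Fin n // i ≠ a'}
  have hcard : k < n := by
    have h1 := Nat.card_congr e
    have h2 : Nat.card {i : Fin n // i ≠ a'} < Nat.card (Fin n) := by
      rw [Nat.card_eq_fintype_card, Nat.card_eq_fintype_card]
      exact Fintype.card_subtype_lt (x := a') (by simp)
    rw [h1] at h2
    simpa using h2
  refine hmin k hcard ⟨φ.map (fun i => e (m i)), fun c => ?_, fun g hg => ?_⟩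
  · obtain ⟨t, ht⟩ := hφ (e.symm c).1
    refine ⟨t, ?_⟩
    change e (m (φ t)) = c
    rw [ht]
    simp only [m, dif_neg (e.symm c).2]
    exact e.apply_symm_apply c
  · have hg : ∀ t, m (φ (g • t)) = m (φ t) := fun t => e.injective (hg t)
    -- The proviso of `key` may fail for the pair `1`, `g`, as when `g` exchanges `a` and `a'`. Both
    -- are therefore compared with a third homeomorphism `k`, for which `φ ∘ k` takes on each cell
    -- of `(φ, φ ∘ g)` all the values allowed by the merged partition.
    obtain ⟨ψ, h1, h2⟩ := exists_extension (pairLC φ (compLC φ g))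
      (fun p l => (∃ u, φ u = p.1 ∧ φ (g • u) = p.2) ∧ m p.1 = m l)
      (fun u => ⟨φ u, ⟨u, rfl, rfl⟩, rfl⟩)
      (fun p b hb => hb.1.imp fun u hu => Prod.ext hu.1 hu.2)
    have hsur : Function.Surjective ψ := fun i => by
      obtain ⟨t, rfl⟩ := hφ i
      obtain ⟨u, hu1, hu2⟩ := h2 (φ t, φ (g • t)) (φ t) ⟨⟨t, rfl, rfl⟩, rfl⟩
      exact ⟨u, hu2⟩
    obtain ⟨k, hk⟩ := exists_homeo_of_range_eq ψ φ (hsur.range_eq.trans hφ.range_eq.symm)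
    have e1 := key 1 k (fun i => by
        obtain ⟨t, rfl⟩ := hφ i
        obtain ⟨u, hu1, hu2⟩ := h2 (φ t, φ (g • t)) (φ t) ⟨⟨t, rfl, rfl⟩, rfl⟩
        refine ⟨u, ?_, ?_⟩
        · rw [one_smul]; exact (Prod.mk.inj hu1).1
        · rw [hk, hu2])
      (fun u => hm _ _ (by rw [hk, one_smul]; exact (h1 u).2))
    have e2 := key g k (fun i => by
        obtain ⟨t, ht⟩ := hφ i
        have ht' : φ (g • g⁻¹ • t) = i := by rw [smul_inv_smul, ht]
        obtain ⟨u, hu1, hu2⟩ := h2 (φ (g⁻¹ • t), φ (g • g⁻¹ • t)) i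
          ⟨⟨_, rfl, rfl⟩, by rw [← hg, ht']⟩
        refine ⟨u, ?_, ?_⟩
        · exact (Prod.mk.inj hu1).2.trans ht'
        · rw [hk, hu2])
      (fun u => hm _ _ (by rw [hk, hg]; exact (h1 u).2))
    rw [← e1, inv_one, one_smul, inv_smul_eq_iff] at e2
    exact e2.symm

end Support
end CantorPerm
end

noncomputable section
namespace CantorPerm
set_option linter.unusedSectionVars false
-- Points with a standard partition, and the Euler characteristic
section Euler
open MulAction Pointwise FinGSet
variable {𝔛 : Type} [TopologicalSpace 𝔛] [IsCantorSpace 𝔛]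
variable {X Y Z : FinGSet (HomeoGroup 𝔛)} {A B : Type}

theorem exists_factor {φ : LocallyConstant 𝔛 A} {ψ : LocallyConstant 𝔛 B}
    (hφ : Function.Surjective φ) (hk : ∀ s t, φ s = φ t → ψ s = ψ t) :
    ∃ j : A → B, ∀ t, j (φ t) = ψ t := by
  refine ⟨fun a => ψ (hφ a).choose, fun t => hk _ _ (hφ (φ t)).choose_spec⟩

theorem exists_equiv_of_ker {φ : LocallyConstant 𝔛 A} {ψ : LocallyConstant 𝔛 B}
    (hφ : Function.Surjective φ) (hψ : Function.Surjective ψ)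
    (hk : ∀ s t, φ s = φ t ↔ ψ s = ψ t) : ∃ e : A ≃ B, ∀ t, e (φ t) = ψ t := by
  obtain ⟨j, hj⟩ := exists_factor hφ fun s t => (hk s t).1
  refine ⟨Equiv.ofBijective j ⟨fun a b hab => ?_, fun b => ?_⟩, hj⟩
  · obtain ⟨s, rfl⟩ := hφ a
    obtain ⟨t, rfl⟩ := hφ b
    rw [hj, hj] at hab
    exact (hk s t).2 hab
  · obtain ⟨t, rfl⟩ := hψ b
    exact ⟨φ t, hj t⟩

/-- Each of two exact partitions refines the other, so the coarsest supporting partition is unique.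
-/
theorem Exact.ker_iff [Finite A] [Finite B] {φ : LocallyConstant 𝔛 A} {ψ : LocallyConstant 𝔛 B}
    {x : X} (h : Exact φ x) (h' : Exact ψ x) (s t : 𝔛) : φ s = φ t ↔ ψ s = ψ t :=
  ⟨exact_factor h' h.1 s t, exact_factor h h'.1 s t⟩

theorem Exact.comp {φ : LocallyConstant 𝔛 A} {g : HomeoGroup 𝔛} {x : X} (h : Exact φ (g • x)) :
    Exact (compLC φ g) x := by
  refine ⟨fun k hk => ?_, fun k hk s t hst => ?_⟩
  · have := h.1 (g * k * g⁻¹) fun t => by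
      have := hk (g⁻¹ • t)
      simp only [compLC_apply, smul_inv_smul] at this
      rw [mul_smul, mul_smul, this]
    rw [mul_smul, mul_smul, inv_smul_smul] at this
    exact smul_left_cancel g this
  · have := h.2 (g * k * g⁻¹) (by rw [mul_smul, mul_smul, inv_smul_smul, hk]) _ _ hst
    simp only [mul_smul, inv_smul_smul] at this
    exact this

theorem exact_comp_iff {φ : LocallyConstant 𝔛 A} {g : HomeoGroup 𝔛} {x : X} :
    Exact (compLC φ g) x ↔ Exact φ (g • x) := by
  refine ⟨fun h => ?_, Exact.comp⟩
  have h' : Exact (compLC φ g) (g⁻¹ • g • x) := by rwa [inv_smul_smul]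
  have := h'.comp
  have e : compLC (compLC φ g) g⁻¹ = φ := LocallyConstant.ext fun t => by
    simp only [compLC_apply, smul_inv_smul]
  rwa [e] at this

theorem exact_map_iff {f : X →[HomeoGroup 𝔛] Y} (hf : Function.Injective f)
    {φ : LocallyConstant 𝔛 A} {x : X} : Exact φ (f x) ↔ Exact φ x := by
  have h : ∀ g : HomeoGroup 𝔛, g • f x = f x ↔ g • x = x := fun g => by
    rw [← map_smul, hf.eq_iff]
  simp only [Exact, Supports, h]

variable (𝔛) in
/-- A chosen surjection of the Cantor space onto a set with `n + 1` elements. -/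
def stdLC (n : ℕ) : LocallyConstant 𝔛 (Fin (n + 1)) :=
  (exists_surjective_locallyConstant 𝔛 (Fin (n + 1))).choose

theorem stdLC_surjective (n : ℕ) : Function.Surjective (stdLC 𝔛 n) :=
  (exists_surjective_locallyConstant 𝔛 (Fin (n + 1))).choose_spec

/-- Surjections onto the same finite set differ by a homeomorphism, so the coarsest partition of a
point can be moved to a standard one. -/
theorem exists_smul_exact_stdLC (x : X) : ∃ (n : ℕ) (g : HomeoGroup 𝔛), Exact (stdLC 𝔛 n) (g • x) := by
  obtain ⟨m, φ, hφ, h⟩ := exists_exact x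
  obtain ⟨t⟩ := nonempty_cantor 𝔛
  obtain _ | n := m
  · exact (φ t).elim0
  obtain ⟨g, hg⟩ := exists_homeo_of_range_eq φ (stdLC 𝔛 n)
    (hφ.range_eq.trans (stdLC_surjective n).range_eq.symm)
  refine ⟨n, g, exact_comp_iff.1 ?_⟩
  rwa [show compLC (stdLC 𝔛 n) g = φ from LocallyConstant.ext hg]

/-- The number of parts of the coarsest partition is constant on orbits. The shift by one comes from
the indexing of the standard surjections, which avoids the empty target. -/
theorem Exact.stdLC_index {n : ℕ} {x : X} {g : HomeoGroup 𝔛} [Fintype A] {φ : LocallyConstant 𝔛 A}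
    (hφ : Function.Surjective φ) (h : Exact φ x)
    (h' : Exact (stdLC 𝔛 n) (g • x)) : Fintype.card A = n + 1 := by
  obtain ⟨e, _⟩ := exists_equiv_of_ker (ψ := compLC (stdLC 𝔛 n) g) hφ (fun i => by
    obtain ⟨t, rfl⟩ := stdLC_surjective (𝔛 := 𝔛) n i
    exact ⟨g⁻¹ • t, by rw [compLC_apply, smul_inv_smul]⟩) (h.ker_iff h'.comp)
  simpa using Fintype.card_congr e

/-- The points of a `G`-set whose coarsest supporting partition is a standard one. -/
def StdPoint (X : FinGSet (HomeoGroup 𝔛)) : Type := Σ n : ℕ, {x : X // Exact (stdLC 𝔛 n) x}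

theorem StdPoint.ext_fst {e e' : StdPoint X} (h1 : e.1 = e'.1) (h2 : e.2.1 = e'.2.1) : e = e' := by
  obtain ⟨n, x, hx⟩ := e
  obtain ⟨n', x', hx'⟩ := e'
  cases h1
  cases h2
  rfl

/-- The index carries no further information: it is the number of parts, less one. -/
theorem StdPoint.ext {e e' : StdPoint X} (h2 : e.2.1 = e'.2.1) : e = e' := by
  refine StdPoint.ext_fst ?_ h2
  have h' : Exact (stdLC 𝔛 e'.1) ((1 : HomeoGroup 𝔛) • e.2.1) := by
    rw [one_smul, h2]; exact e'.2.2
  have := e.2.2.stdLC_index (stdLC_surjective (𝔛 := 𝔛) e.1) h'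
  simpa using this

/-- A standard point is determined by its orbit and by the labelling, with standard labels, of the
parts of the coarsest partition of a fixed representative. There are finitely many orbits and
labellings. -/
instance (X : FinGSet (HomeoGroup 𝔛)) : Finite (StdPoint X) := by
  classical
  have hq : ∀ q : orbitRel.Quotient (HomeoGroup 𝔛) X, ∃ (m : ℕ) (φ : LocallyConstant 𝔛 (Fin m)),
    Function.Surjective φ ∧ Exact φ q.out := fun q => exists_exact q.out
  choose m φ hφ hx using hq
  choose t ht using hφ
  let Q : StdPoint X → orbitRel.Quotient (HomeoGroup 𝔛) X := fun e => Quotient.mk'' e.2.1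
  have hg : ∀ e : StdPoint X, ∃ g : HomeoGroup 𝔛, g • (Q e).out = e.2.1 := fun e =>
    Quotient.exact (Quotient.out_eq (Q e)).symm
  choose g hg using hg
  have hex : ∀ e, Exact (stdLC 𝔛 e.1) (g e • (Q e).out) := fun e => by
    rw [hg]; exact e.2.2
  have hm : ∀ e, m (Q e) = e.1 + 1 := fun e => by
    simpa using (hx (Q e)).stdLC_index (fun i => ⟨t _ i, ht _ i⟩) (hex e)
  -- The labels are read off at the chosen points `t q i`, one in each part.
  let F : StdPoint X → Σ q, Fin (m q) → Fin (m q) := fun e =>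
    ⟨Q e, fun i => Fin.cast (hm e).symm (stdLC 𝔛 e.1 (g e • t _ i))⟩
  refine Finite.of_injective F fun e e' h => ?_
  have h1 : Q e = Q e' := congrArg Sigma.fst h
  have h2 : ∀ i : ℕ, ∀ (hi : i < m (Q e)) (hi' : i < m (Q e')),
      (stdLC 𝔛 e.1 (g e • t _ ⟨i, hi⟩)).val = (stdLC 𝔛 e'.1 (g e' • t _ ⟨i, hi'⟩)).val := by
    have : ∀ p p' : Σ q, Fin (m q) → Fin (m q), p = p' → ∀ i hi hi',
        (p.2 ⟨i, hi⟩).val = (p'.2 ⟨i, hi'⟩).val := by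
      rintro p _ rfl i hi hi'; rfl
    exact fun i hi hi' => this _ _ h i hi hi'
  have h3 : e.1 = e'.1 := by
    have h4 := hm e
    rw [h1, hm e'] at h4
    omega
  refine StdPoint.ext_fst h3 ?_
  have hE := hex e
  have hE' := hex e'
  -- Both labellings are constant on the parts of the representative, so agreement at the chosen
  -- points is agreement everywhere.
  have key : ∀ s : 𝔛, (stdLC 𝔛 e.1 (g e • s)).val = (stdLC 𝔛 e'.1 (g e' • s)).val := by
    intro s
    have h5 := ((hx (Q e)).ker_iff hE.comp (t _ (φ _ s)) s).1 (ht _ _)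
    have h6 := ((hx (Q e')).ker_iff hE'.comp (t _ (φ _ s)) s).1 (ht _ _)
    simp only [compLC_apply] at h5 h6
    rw [← h5, ← h6]
    have h7 : (φ (Q e) s).val = (φ (Q e') s).val := by rw [h1]
    have h8 := h2 (φ (Q e) s).val (φ (Q e) s).2 (h7 ▸ (φ (Q e') s).2)
    refine h8.trans ?_
    congr 4
    exact Fin.ext h7
  rw [← hg e, ← hg e', h1]
  rw [← h3] at hE'
  have h9 := hE'.1 (g e * (g e')⁻¹) fun s => by
    have := key ((g e')⁻¹ • s)
    rw [smul_inv_smul] at this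
    rw [mul_smul]
    refine Fin.ext (this.trans ?_)
    rw [h3]
  rw [mul_smul, inv_smul_smul] at h9
  rw [← h9]

instance (X : FinGSet (HomeoGroup 𝔛)) : Fintype (StdPoint X) := Fintype.ofFinite _

/-- The weight of a point whose coarsest supporting partition has `n + 1` parts. -/
def stdWeight (n : ℕ) : ℚ := (-1) ^ n / (n + 1).factorial

theorem stdWeight_ne_zero (n : ℕ) : stdWeight n ≠ 0 :=
  div_ne_zero (pow_ne_zero _ (by norm_num)) (Nat.cast_ne_zero.2 (Nat.factorial_ne_zero _))

/-- The Euler characteristic of a finitary `G`-set. -/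
def euler (X : FinGSet (HomeoGroup 𝔛)) : ℚ := ∑ e : StdPoint X, stdWeight e.1

/-- All standard points of a transitive set have the same number of parts, hence the same weight,
and nothing cancels. -/
theorem euler_ne_zero (hX : X.Transitive) : euler X ≠ 0 := by
  obtain ⟨⟨x⟩, hX⟩ := hX
  obtain ⟨n, g, h⟩ := exists_smul_exact_stdLC x
  have h1 : ∀ e : StdPoint X, e.1 = n := by
    intro e
    obtain ⟨k, hk⟩ := hX.exists_smul_eq (g • x) e.2.1
    have h2 := h.stdLC_index (stdLC_surjective n) (n := e.1) (g := k) (by rw [hk]; exact e.2.2)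
    simpa using h2.symm
  have h2 : euler X = Fintype.card (StdPoint X) * stdWeight n := by
    rw [euler, Finset.sum_congr rfl fun e _ => congrArg stdWeight (h1 e)]
    simp
  rw [h2]
  have : Nonempty (StdPoint X) := ⟨⟨n, g • x, h⟩⟩
  exact mul_ne_zero (Nat.cast_ne_zero.2 Fintype.card_ne_zero) (stdWeight_ne_zero n)

/-- As coarsest partitions are preserved, the standard points of `X` are exactly the points over
standard points of `Y`, with the same weights. -/
theorem euler_cover (f : X →[HomeoGroup 𝔛] Y) (d : ℕ)
    (hf : ∀ n x, Exact (stdLC 𝔛 n) x ↔ Exact (stdLC 𝔛 n) (f x))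
    (hd : ∀ y, Nat.card {x // f x = y} = d) : euler X = d * euler Y := by
  classical
  let F : StdPoint X → StdPoint Y := fun e => ⟨e.1, f e.2.1, (hf _ _).1 e.2.2⟩
  rw [euler, ← Finset.sum_fiberwise (s := Finset.univ) (g := F), euler, Finset.mul_sum]
  refine Finset.sum_congr rfl fun e _ => ?_
  rw [Finset.sum_congr rfl (g := fun _ => stdWeight e.1)
    (fun e' he' => by rw [← (Finset.mem_filter.1 he').2])]
  rw [Finset.sum_const, nsmul_eq_mul]
  congr 2
  rw [← hd e.2.1, ← Fintype.card_subtype, ← Nat.card_eq_fintype_card]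
  refine Nat.card_congr ⟨fun e' => ⟨e'.1.2.1, congrArg (fun e => e.2.1) e'.2⟩,
    fun x => ⟨⟨e.1, x.1, (hf _ _).2 (by rw [x.2]; exact e.2.2)⟩, StdPoint.ext x.2⟩,
    fun e' => Subtype.ext (StdPoint.ext rfl), fun _ => rfl⟩

theorem euler_congr (f : X →[HomeoGroup 𝔛] Y) (hf : Function.Bijective f) : euler X = euler Y := by
  rw [euler_cover f 1 (fun n x => (exact_map_iff hf.1).symm), Nat.cast_one, one_mul]
  intro y
  obtain ⟨x, rfl⟩ := hf.2 y
  exact Nat.card_eq_one_iff_exists.2 ⟨⟨x, rfl⟩, fun z => Subtype.ext (hf.1 z.2)⟩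

/-- Injective maps preserve stabilizers, hence coarsest partitions, so standard points may be
counted piece by piece. -/
theorem euler_decomposition {ι : Type} [Fintype ι] {V : ι → FinGSet (HomeoGroup 𝔛)}
    (j : ∀ i, V i →[HomeoGroup 𝔛] X) (hj : ∀ i, Function.Injective (j i))
    (hd : ∀ i i' v v', j i v = j i' v' → i = i') (hc : ∀ x, ∃ i v, j i v = x) :
    euler X = ∑ i, euler (V i) := by
  let F : (Σ i, StdPoint (V i)) → StdPoint X := fun p =>
    ⟨p.2.1, j p.1 p.2.2.1, (exact_map_iff (hj _)).2 p.2.2.2⟩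
  have hF : Function.Bijective F := by
    constructor
    · rintro ⟨i, e⟩ ⟨i', e'⟩ h
      have h1 : j i e.2.1 = j i' e'.2.1 := congrArg (fun e => e.2.1) h
      have h2 := hd _ _ _ _ h1
      subst h2
      rw [show e = e' from StdPoint.ext (hj _ h1)]
    · intro e
      obtain ⟨i, v, hv⟩ := hc e.2.1
      exact ⟨⟨i, e.1, v, (exact_map_iff (hj _)).1 (by rw [hv]; exact e.2.2)⟩, StdPoint.ext hv⟩
  unfold euler
  rw [← Fintype.sum_sigma']
  exact (Fintype.sum_bijective F hF _ _ fun _ => rfl).symm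

end Euler
end CantorPerm
end

noncomputable section
namespace CantorPerm
set_option linter.unusedSectionVars false
-- Alternating sums over the subsets of a finite set
section Signs
variable {R : Type*} [CommRing R]

/-- Möbius inversion in the form of a uniqueness statement: the sum over the subsets of `T`
determines the value at `T` once the values at smaller sets are known. -/
theorem eq_of_sum_powerset_eq {M : Type*} [AddCommGroup M] {A : Type} [DecidableEq A]
    {f g : Finset A → M} (h : ∀ T : Finset A, ∑ S ∈ T.powerset, f S = ∑ S ∈ T.powerset, g S) (T : Finset A) :
    f T = g T := by
  induction T using Finset.strongInduction with
  | H T ih =>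
    have h1 := h T
    rw [← Finset.add_sum_erase _ f (Finset.mem_powerset_self T),
      ← Finset.add_sum_erase _ g (Finset.mem_powerset_self T)] at h1
    rw [Finset.sum_congr rfl fun S (hS : S ∈ T.powerset.erase T) =>
      ih S (Finset.mem_ssubsets.1 hS)] at h1
    exact add_right_cancel h1

theorem sum_powerset_sign {A : Type} [DecidableEq A] (T : Finset A) :
    ∑ S ∈ T.powerset, (-1 : R) ^ S.card = if T = ∅ then 1 else 0 := by
  have := congrArg (Int.cast : ℤ → R) (Finset.sum_powerset_neg_one_pow_card (x := T))
  push_cast at this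
  exact this

/-- Trades a prescribed image for a containment of images; after this the alternating sums below run
over full powersets. -/
theorem sum_powerset_comm {M : Type*} [AddCommMonoid M] {A B : Type} [Fintype A] [DecidableEq A]
    [DecidableEq B] (F : Finset A → M) (I : Finset A → Finset B) (T : Finset B) :
    (∑ T' ∈ T.powerset, ∑ S, if I S = T' then F S else 0) = ∑ S, if I S ⊆ T then F S else 0 := by
  rw [Finset.sum_comm]
  refine Finset.sum_congr rfl fun S _ => ?_
  rw [Finset.sum_ite_eq]
  simp only [Finset.mem_powerset]

/-- Summed over the subsets of `T`, the left side runs over all subsets of `A₁ ∩ f⁻¹(T)` and the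
right side over all subsets of `T ∩ f(A₁)`. Each alternating sum is `1` or `0` according to whether
the set is empty, and the two sets are empty together. -/
theorem sum_image_eq_sign {A B : Type} [Fintype A] [DecidableEq A] [DecidableEq B] (f : A → B)
    (A₁ : Finset A) (T : Finset B) :
    (∑ S : Finset A, if S.image f = T then (if S ⊆ A₁ then (-1 : R) ^ S.card else 0) else 0) =
      if T ⊆ A₁.image f then (-1) ^ T.card else 0 := by
  refine eq_of_sum_powerset_eq (f := fun T => ∑ S : Finset A, if S.image f = T then
    (if S ⊆ A₁ then (-1 : R) ^ S.card else 0) else 0)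
    (g := fun T => if T ⊆ A₁.image f then (-1) ^ T.card else 0) (fun T => ?_) T
  rw [sum_powerset_comm]
  have e1 : ∀ S : Finset A, (if S.image f ⊆ T then (if S ⊆ A₁ then (-1 : R) ^ S.card else 0) else 0)
      = if S ∈ (A₁.filter fun a => f a ∈ T).powerset then (-1) ^ S.card else 0 := by
    intro S
    rw [← ite_and]
    refine if_congr ?_ rfl rfl
    simp only [Finset.mem_powerset, Finset.subset_iff, Finset.mem_image, Finset.mem_filter]
    constructor
    · rintro ⟨h1, h2⟩ a ha
      exact ⟨h2 ha, h1 ⟨a, ha, rfl⟩⟩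
    · intro h
      refine ⟨?_, fun a ha => (h ha).1⟩
      rintro _ ⟨a, ha, rfl⟩
      exact (h ha).2
  have e2 : ∀ T' ∈ T.powerset, (if T' ⊆ A₁.image f then (-1 : R) ^ T'.card else 0) =
      if T' ∈ (T ∩ A₁.image f).powerset then (-1) ^ T'.card else 0 := by
    intro T' hT'
    refine if_congr ?_ rfl rfl
    rw [Finset.mem_powerset, Finset.subset_inter_iff]
    exact ⟨fun h => ⟨Finset.mem_powerset.1 hT', h⟩, fun h => h.2⟩
  rw [Finset.sum_congr rfl fun S _ => e1 S, Finset.sum_congr rfl e2, Finset.sum_ite_mem,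
    Finset.sum_ite_mem, Finset.univ_inter, Finset.inter_eq_right.2
      (Finset.powerset_mono.2 Finset.inter_subset_left), sum_powerset_sign, sum_powerset_sign]
  refine if_congr ?_ rfl rfl
  simp only [Finset.eq_empty_iff_forall_notMem, Finset.mem_filter, Finset.mem_inter,
    Finset.mem_image]
  constructor
  · rintro h _ ⟨h1, a, ha, rfl⟩
    exact h a ⟨ha, h1⟩
  · rintro h a ⟨ha, h1⟩
    exact h _ ⟨h1, a, ha, rfl⟩

/-- This is the numerical form of base change. Both sides are summed over the subsets of `A₁` and of
`B₁`. The left side becomes the alternating sum over all subsets of the fibre product of `A₁` and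
`B₁`. The right side, sorted by the common image `T` in `C`, becomes the alternating sum over the
subsets of `s(A₁) ∩ t(B₁)`, which is empty exactly when the fibre product is. -/
theorem sum_fibreProduct_sign {A B C : Type} [Fintype A] [Fintype B] [Fintype C] [DecidableEq A]
    [DecidableEq B] [DecidableEq C] (s : A → C) (t : B → C) (A₁ : Finset A) (B₁ : Finset B) :
    (∑ D : Finset (A × B), if D.image Prod.fst = A₁ then (if D.image Prod.snd = B₁ then
      (if ∀ p ∈ D, s p.1 = t p.2 then (-1 : R) ^ D.card else 0) else 0) else 0) =
      if A₁.image s = B₁.image t then (-1) ^ A₁.card * (-1) ^ B₁.card * (-1) ^ (A₁.image s).card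
        else 0 := by
  refine eq_of_sum_powerset_eq (f := fun A₁ => ∑ D : Finset (A × B), if D.image Prod.fst = A₁ then
    (if D.image Prod.snd = B₁ then (if ∀ p ∈ D, s p.1 = t p.2 then (-1 : R) ^ D.card else 0) else 0)
      else 0) (g := fun A₁ => if A₁.image s = B₁.image t then
        (-1) ^ A₁.card * (-1) ^ B₁.card * (-1) ^ (A₁.image s).card else 0) (fun A₁ => ?_) A₁
  rw [sum_powerset_comm]
  have e0 : ∀ B₁ : Finset B, (∑ D : Finset (A × B), if D.image Prod.fst ⊆ A₁ then
      (if D.image Prod.snd = B₁ then (if ∀ p ∈ D, s p.1 = t p.2 then (-1 : R) ^ D.card else 0)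
        else 0) else 0) = ∑ D : Finset (A × B), if D.image Prod.snd = B₁ then
          (if D.image Prod.fst ⊆ A₁ then (if ∀ p ∈ D, s p.1 = t p.2 then (-1 : R) ^ D.card else 0)
            else 0) else 0 := by
    intro B₁
    refine Finset.sum_congr rfl fun D _ => ?_
    split_ifs <;> rfl
  rw [e0]
  refine eq_of_sum_powerset_eq (f := fun B₁ => ∑ D : Finset (A × B), if D.image Prod.snd = B₁ then
    (if D.image Prod.fst ⊆ A₁ then (if ∀ p ∈ D, s p.1 = t p.2 then (-1 : R) ^ D.card else 0) else 0)
      else 0) (g := fun B₁ => ∑ A' ∈ A₁.powerset, if A'.image s = B₁.image t then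
        (-1) ^ A'.card * (-1) ^ B₁.card * (-1) ^ (A'.image s).card else 0) (fun B₁ => ?_) B₁
  rw [sum_powerset_comm]
  have e1 : ∀ D : Finset (A × B), (if D.image Prod.snd ⊆ B₁ then (if D.image Prod.fst ⊆ A₁ then
      (if ∀ p ∈ D, s p.1 = t p.2 then (-1 : R) ^ D.card else 0) else 0) else 0) =
      if D ∈ ((A₁ ×ˢ B₁).filter fun p => s p.1 = t p.2).powerset then (-1) ^ D.card else 0 := by
    intro D
    rw [← ite_and, ← ite_and]
    refine if_congr ?_ rfl rfl
    simp only [Finset.mem_powerset, Finset.subset_iff, Finset.mem_image, Finset.mem_filter,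
      Finset.mem_product]
    constructor
    · rintro ⟨⟨h1, h2⟩, h3⟩ p hp
      exact ⟨⟨h2 ⟨p, hp, rfl⟩, h1 ⟨p, hp, rfl⟩⟩, h3 p hp⟩
    · intro h
      refine ⟨⟨?_, ?_⟩, fun p hp => (h hp).2⟩
      · rintro _ ⟨p, hp, rfl⟩
        exact (h hp).1.2
      · rintro _ ⟨p, hp, rfl⟩
        exact (h hp).1.1
  rw [Finset.sum_congr rfl fun D _ => e1 D, Finset.sum_ite_mem, Finset.univ_inter,
    sum_powerset_sign]
  -- The common image becomes a summation variable, so that the sums over `A'` and `B'` separate.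
  have e2 : ∀ (A' : Finset A) (B' : Finset B), (if A'.image s = B'.image t then
      (-1 : R) ^ A'.card * (-1) ^ B'.card * (-1) ^ (A'.image s).card else 0) =
      ∑ T : Finset C, (if A'.image s = T then (-1) ^ A'.card else 0) *
        (if B'.image t = T then (-1) ^ B'.card else 0) * (-1) ^ T.card := by
    intro A' B'
    rw [Finset.sum_eq_single (A'.image s)]
    · rw [if_pos rfl]
      by_cases h : A'.image s = B'.image t
      · rw [if_pos h, if_pos h.symm]
      · rw [if_neg h, if_neg (Ne.symm h)]; ring
    · intro T _ hT
      rw [if_neg hT.symm]; ring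
    · simp
  have e3 : ∀ {A' : Type} [Fintype A'] [DecidableEq A'] (r : A' → C) (A₁ : Finset A') (T : Finset C),
      (∑ A' ∈ A₁.powerset, if A'.image r = T then (-1 : R) ^ A'.card else 0) =
        if T ⊆ A₁.image r then (-1) ^ T.card else 0 := by
    intro A' _ _ r A₁ T
    rw [← sum_image_eq_sign, ← Finset.univ_inter A₁.powerset, ← Finset.sum_ite_mem]
    refine Finset.sum_congr rfl fun S _ => ?_
    simp only [Finset.mem_powerset]
    split_ifs <;> rfl
  simp only [e2]
  have e4 : (∑ B' ∈ B₁.powerset, ∑ A' ∈ A₁.powerset, ∑ T : Finset C,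
      (if A'.image s = T then (-1 : R) ^ A'.card else 0) *
        (if B'.image t = T then (-1) ^ B'.card else 0) * (-1) ^ T.card) =
      ∑ T : Finset C, (∑ A' ∈ A₁.powerset, if A'.image s = T then (-1 : R) ^ A'.card else 0) *
        (∑ B' ∈ B₁.powerset, if B'.image t = T then (-1 : R) ^ B'.card else 0) * (-1) ^ T.card := by
    rw [Finset.sum_congr rfl fun B' _ => Finset.sum_comm, Finset.sum_comm]
    refine Finset.sum_congr rfl fun T _ => ?_
    rw [Finset.sum_mul_sum, Finset.sum_mul, Finset.sum_comm]
    refine Finset.sum_congr rfl fun A' _ => ?_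
    rw [Finset.sum_mul]
  rw [e4]
  simp only [e3]
  -- Of the three equal signs, one from each factor and one explicit, a single one survives.
  have e5 : ∀ T : Finset C, ((if T ⊆ A₁.image s then (-1 : R) ^ T.card else 0) *
      (if T ⊆ B₁.image t then (-1) ^ T.card else 0) * (-1) ^ T.card) =
      if T ∈ (A₁.image s ∩ B₁.image t).powerset then (-1) ^ T.card else 0 := by
    intro T
    rw [if_congr (Finset.mem_powerset.trans Finset.subset_inter_iff) rfl rfl, ite_and]
    split_ifs
    · rw [← mul_pow]; norm_num
    all_goals ring
  rw [Finset.sum_congr rfl fun T _ => e5 T, Finset.sum_ite_mem, Finset.univ_inter,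
    sum_powerset_sign]
  refine if_congr ?_ rfl rfl
  simp only [Finset.eq_empty_iff_forall_notMem, Finset.mem_filter, Finset.mem_inter,
    Finset.mem_image, Finset.mem_product]
  constructor
  · rintro h _ ⟨⟨a, ha, rfl⟩, b, hb, e⟩
    exact h (a, b) ⟨⟨ha, hb⟩, e.symm⟩
  · rintro h ⟨a, b⟩ ⟨⟨ha, hb⟩, e⟩
    exact h _ ⟨⟨a, ha, rfl⟩, b, hb, e.symm⟩

end Signs
end CantorPerm
end

noncomputable section
namespace CantorPerm
set_option linter.unusedSectionVars false
-- Orbits on `Y(D)`, and covers of transitive sets by `X(n)`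
section EulerMeasure
open MulAction Pointwise FinGSet
variable {𝔛 : Type} [TopologicalSpace 𝔛] [IsCantorSpace 𝔛]
variable {X Y Z : FinGSet (HomeoGroup 𝔛)} {A B D : Type}

/-- A point of `Y(D)`, as a locally constant function. -/
def lc [Finite D] (ρ : setY 𝔛 D) : LocallyConstant 𝔛 D := ρ

/-- A locally constant function, as a point of `Y(D)`. -/
def yv [Finite D] (ρ : LocallyConstant 𝔛 D) : setY 𝔛 D := ρ

theorem lc_smul [Finite D] (g : HomeoGroup 𝔛) (ρ : setY 𝔛 D) (t : 𝔛) :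
    lc (g • ρ) t = lc ρ (g⁻¹ • t) := rfl

theorem lc_ext [Finite D] {ρ ρ' : setY 𝔛 D} (h : ∀ t, lc ρ t = lc ρ' t) : ρ = ρ' :=
  LocallyConstant.ext h

open scoped Classical in
/-- The image of a locally constant function to a finite set. -/
def img [Fintype D] (ρ : LocallyConstant 𝔛 D) : Finset D := Finset.univ.filter fun d => ∃ t, ρ t = d

theorem mem_img [Fintype D] {ρ : LocallyConstant 𝔛 D} {d : D} : d ∈ img ρ ↔ ∃ t, ρ t = d := by
  classical
  simp [img]

theorem img_nonempty [Fintype D] (ρ : LocallyConstant 𝔛 D) : (img ρ).Nonempty := by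
  obtain ⟨t⟩ := nonempty_cantor 𝔛
  exact ⟨ρ t, mem_img.2 ⟨t, rfl⟩⟩

theorem img_smul [Fintype D] (g : HomeoGroup 𝔛) (ρ : setY 𝔛 D) : img (lc (g • ρ)) = img (lc ρ) := by
  ext d
  rw [mem_img, mem_img]
  constructor
  · rintro ⟨t, ht⟩
    exact ⟨g⁻¹ • t, ht⟩
  · rintro ⟨t, ht⟩
    exact ⟨g • t, by rw [lc_smul, inv_smul_smul, ht]⟩

/-- With `img_smul`, `img_nonempty` and `exists_img_eq`, this identifies the orbits on `Y(D)` with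
the non-empty subsets of `D`. -/
theorem exists_smul_of_img_eq [Fintype D] {ρ ρ' : setY 𝔛 D} (h : img (lc ρ) = img (lc ρ')) :
    ∃ g : HomeoGroup 𝔛, g • ρ = ρ' := by
  obtain ⟨g, hg⟩ := exists_homeo_of_range_eq (lc ρ') (lc ρ) (by
    ext d
    have := congrArg (fun s => d ∈ s) h
    simp only [mem_img] at this
    exact (iff_of_eq this).symm)
  exact ⟨g⁻¹, lc_ext fun x => by rw [lc_smul, inv_inv, hg]⟩

theorem exists_img_eq [Fintype D] {R : Finset D} (hR : R.Nonempty) :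
    ∃ ρ : LocallyConstant 𝔛 D, img ρ = R := by
  have : Nonempty R := hR.to_subtype
  obtain ⟨ρ, hρ⟩ := exists_surjective_locallyConstant 𝔛 R
  refine ⟨ρ.map Subtype.val, ?_⟩
  ext d
  rw [mem_img]
  constructor
  · rintro ⟨t, rfl⟩
    exact (ρ t).2
  · intro hd
    obtain ⟨t, ht⟩ := hρ ⟨d, hd⟩
    exact ⟨t, congrArg Subtype.val ht⟩

theorem smul_setY_eq_iff [Finite D] (g : HomeoGroup 𝔛) (ρ : setY 𝔛 D) :
    g • ρ = ρ ↔ ∀ t, lc ρ (g • t) = lc ρ t := by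
  constructor
  · intro h t
    conv_lhs => rw [← h]
    rw [lc_smul, inv_smul_smul]
  · intro h
    refine lc_ext fun t => ?_
    rw [lc_smul, ← h, smul_inv_smul]

/-- The stabilizer of `ρ` consists of the homeomorphisms that preserve each fibre of `ρ`, so it even
fixes every part. -/
theorem exact_setY_self [Finite D] (ρ : setY 𝔛 D) : Exact (lc ρ) ρ := by
  refine ⟨fun g hg => (smul_setY_eq_iff g ρ).2 hg, fun g hg s t h => ?_⟩
  have := (smul_setY_eq_iff g ρ).1 hg
  rw [this, this, h]

/-- The inclusion of a `G`-stable subset. -/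
def subIncl {G : Type} [Group G] [TopologicalSpace G] {X : FinGSet G} (S : SubMulAction G X) :
    X.sub S →[G] X where
  toFun x := x.1
  map_smul' _ _ := rfl

theorem subIncl_injective {G : Type} [Group G] [TopologicalSpace G] {X : FinGSet G}
    (S : SubMulAction G X) : Function.Injective (subIncl S) := Subtype.val_injective

/-- The `G`-stable subset of `Y(D)` of the maps whose image has a given property. -/
def subImg [Fintype D] (P : Finset D → Prop) : SubMulAction (HomeoGroup 𝔛) (setY 𝔛 D) where
  carrier := {ρ | P (img (lc ρ))}
  smul_mem' g ρ h := by
    change P (img (lc (g • ρ)))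
    rw [img_smul]
    exact h

theorem exact_subImg_iff [Fintype D] {P : Finset D → Prop} [Finite A] {φ : LocallyConstant 𝔛 A}
    (ρ : (setY 𝔛 D).sub (subImg P)) : Exact φ ρ ↔
      ∀ s t, φ s = φ t ↔ lc ρ.1 s = lc ρ.1 t := by
  rw [← exact_map_iff (subIncl_injective _)]
  exact ⟨fun h => h.ker_iff (exact_setY_self _), fun h => (exact_setY_self _).of_ker h⟩

-- The standard points in question are the composites of the standard surjection with the bijections
-- from its target to `R`.
open scoped Classical in
theorem card_stdPoint_img [Fintype D] {P : Finset D → Prop} {R : Finset D} (hP : P R) {m : ℕ}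
    (hm : R.card = m + 1) :
    Nat.card {e : StdPoint ((setY 𝔛 D).sub (subImg P)) // img (lc e.2.1.1) = R} =
      (m + 1).factorial := by
  have e0 : Fin (m + 1) ≃ R := (Fintype.equivFinOfCardEq (by simpa using hm)).symm
  have himg : ∀ σ : Fin (m + 1) ≃ R, img ((stdLC 𝔛 m).map fun i => (σ i).1) = R := by
    intro σ
    ext d
    rw [mem_img]
    constructor
    · rintro ⟨t, rfl⟩
      exact (σ _).2
    · intro hd
      obtain ⟨t, ht⟩ := stdLC_surjective (𝔛 := 𝔛) m (σ.symm ⟨d, hd⟩)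
      refine ⟨t, ?_⟩
      change (σ (stdLC 𝔛 m t)).1 = d
      rw [ht, σ.apply_symm_apply]
  let F : (Fin (m + 1) ≃ R) →
      {e : StdPoint ((setY 𝔛 D).sub (subImg P)) // img (lc e.2.1.1) = R} := fun σ =>
    ⟨⟨m, ⟨yv ((stdLC 𝔛 m).map fun i => (σ i).1), by
      exact (congrArg P (himg σ)).mpr hP⟩, (exact_subImg_iff _).2 fun s t =>
        ((Subtype.val_injective.comp σ.injective).eq_iff (a := stdLC 𝔛 m s)).symm⟩, himg σ⟩
  have hF : Function.Bijective F := by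
    constructor
    · intro σ τ h
      refine Equiv.ext fun i => ?_
      obtain ⟨t, rfl⟩ := stdLC_surjective (𝔛 := 𝔛) m i
      have h1 : lc (F σ).1.2.1.1 = lc (F τ).1.2.1.1 := by rw [h]
      exact Subtype.ext (LocallyConstant.congr_fun h1 t)
    · rintro ⟨⟨n, ρ, hρ⟩, hR⟩
      have hk := (exact_subImg_iff ρ).1 hρ
      have hR : img (lc ρ.1) = R := hR
      obtain ⟨j, hj⟩ := exists_factor (stdLC_surjective (𝔛 := 𝔛) n) fun s t => (hk s t).1
      have hjR : ∀ i, j i ∈ R := fun i => by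
        obtain ⟨t, rfl⟩ := stdLC_surjective (𝔛 := 𝔛) n i
        rw [hj, ← hR]
        exact mem_img.2 ⟨t, rfl⟩
      let σ : Fin (n + 1) ≃ R := Equiv.ofBijective (fun i => ⟨j i, hjR i⟩) ⟨fun a b hab => by
          obtain ⟨s, rfl⟩ := stdLC_surjective (𝔛 := 𝔛) n a
          obtain ⟨t, rfl⟩ := stdLC_surjective (𝔛 := 𝔛) n b
          have := congrArg Subtype.val hab
          change j _ = j _ at this
          rw [hj, hj] at this
          exact (hk s t).2 this, by
        rintro ⟨d, hd⟩
        rw [← hR, mem_img] at hd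
        obtain ⟨t, rfl⟩ := hd
        exact ⟨stdLC 𝔛 n t, Subtype.ext (hj t)⟩⟩
      have hn : n = m := by
        have := Fintype.card_congr σ
        simp [hm] at this
        exact this
      subst hn
      exact ⟨σ, Subtype.ext (StdPoint.ext (Subtype.ext (lc_ext fun t => hj t)))⟩
  rw [← Nat.card_congr (Equiv.ofBijective F hF), Nat.card_eq_fintype_card, Fintype.card_equiv e0,
    Fintype.card_fin]

-- An image `R` with `m + 1` elements accounts for `(m+1)!` points of weight `(-1)^m / (m+1)!`, that
-- is, for `-(-1)^|R|`. The empty set is never an image, although the sum on the right would count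
-- it; hence the assumption on `P`.
open scoped Classical in
theorem euler_subImg [Fintype D] (P : Finset D → Prop) (h0 : ¬ P ∅) :
    euler ((setY 𝔛 D).sub (subImg P)) = - ∑ R : Finset D, if P R then (-1) ^ R.card else 0 := by
  rw [euler, ← Finset.sum_fiberwise (s := Finset.univ)
    (g := fun e : StdPoint ((setY 𝔛 D).sub (subImg P)) => img (lc e.2.1.1)),
    ← Finset.sum_neg_distrib]
  refine Finset.sum_congr rfl fun R _ => ?_
  have hmem : ∀ e : StdPoint ((setY 𝔛 D).sub (subImg P)), P (img (lc e.2.1.1)) :=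
    fun e => e.2.1.2
  split_ifs with hP
  · obtain ⟨m, hm⟩ : ∃ m, R.card = m + 1 := by
      refine Nat.exists_eq_succ_of_ne_zero fun h => h0 ?_
      rwa [← Finset.card_eq_zero.1 h]
    have hw : ∀ e ∈ Finset.univ.filter (fun e : StdPoint ((setY 𝔛 D).sub (subImg P)) =>
        img (lc e.2.1.1) = R), stdWeight e.1 = stdWeight m := by
      intro e he
      have he := (Finset.mem_filter.1 he).2
      obtain ⟨n, ρ, hρ⟩ := e
      have h1 : R.card = n + 1 := by
        obtain ⟨ρ, hρP⟩ := ρ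
        obtain ⟨j, hj⟩ := exists_factor (stdLC_surjective (𝔛 := 𝔛) n)
          fun s t => ((exact_subImg_iff _).1 hρ s t).1
        have hji : Function.Injective j := fun a b hab => by
          obtain ⟨s, rfl⟩ := stdLC_surjective (𝔛 := 𝔛) n a
          obtain ⟨t, rfl⟩ := stdLC_surjective (𝔛 := 𝔛) n b
          rw [hj, hj] at hab
          exact ((exact_subImg_iff _).1 hρ s t).2 hab
        have : R = Finset.univ.image j := by
          rw [← he]
          ext d
          rw [mem_img, Finset.mem_image]
          constructor
          · rintro ⟨t, rfl⟩
            exact ⟨_, Finset.mem_univ _, hj t⟩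
          · rintro ⟨i, _, rfl⟩
            obtain ⟨t, rfl⟩ := stdLC_surjective (𝔛 := 𝔛) n i
            exact ⟨t, (hj t).symm⟩
        rw [this, Finset.card_image_of_injective _ hji, Finset.card_univ, Fintype.card_fin]
      exact congrArg stdWeight (show n = m by omega)
    rw [Finset.sum_congr rfl hw, Finset.sum_const, nsmul_eq_mul, ← Fintype.card_subtype,
      ← Nat.card_eq_fintype_card, card_stdPoint_img hP hm, stdWeight, hm, pow_succ]
    have := Nat.factorial_ne_zero (m + 1)
    field_simp
  · rw [neg_zero]
    refine Finset.sum_eq_zero fun e he => absurd (hmem e) ?_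
    rwa [(Finset.mem_filter.1 he).2]

theorem mem_subX_iff [Fintype A] (φ : setY 𝔛 A) : φ ∈ subX 𝔛 A ↔ img (lc φ) = Finset.univ := by
  rw [Finset.eq_univ_iff_forall]
  simp only [mem_img]
  rfl

theorem subX_eq_subImg [Fintype A] :
    subX 𝔛 A = subImg (𝔛 := 𝔛) fun R : Finset A => R = Finset.univ :=
  SetLike.ext mem_subX_iff

theorem euler_subX [Fintype A] [Nonempty A] :
    euler ((setY 𝔛 A).sub (subX 𝔛 A)) = - (-1) ^ Fintype.card A := by
  classical
  rw [subX_eq_subImg, euler_subImg _ Finset.univ_nonempty.ne_empty.symm]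
  refine congrArg Neg.neg ((Finset.sum_eq_single Finset.univ (fun R _ h => if_neg h)
    fun h => absurd (Finset.mem_univ _) h).trans ?_)
  rw [if_pos rfl, Finset.card_univ]

theorem subX_transitive (𝔛 : Type) [TopologicalSpace 𝔛] [IsCantorSpace 𝔛] (A : Type) [Finite A]
    [Nonempty A] : ((setY 𝔛 A).sub (subX 𝔛 A)).Transitive := by
  have := Fintype.ofFinite A
  obtain ⟨φ, hφ⟩ := exists_surjective_locallyConstant 𝔛 A
  refine ⟨⟨⟨yv φ, hφ⟩⟩, ⟨?_⟩⟩
  rintro ⟨a, ha⟩ ⟨b, hb⟩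
  obtain ⟨g, hg⟩ := exists_smul_of_img_eq (((mem_subX_iff a).1 ha).trans ((mem_subX_iff b).1 hb).symm)
  exact ⟨g, Subtype.ext hg⟩

theorem exists_map_of_stabilizer {G : Type} [Group G] [TopologicalSpace G] {X Y : FinGSet G}
    (hX : X.Transitive) (x : X) (y : Y) (h : ∀ g : G, g • x = x → g • y = y) :
    ∃ f : X →[G] Y, f x = y := by
  obtain ⟨_, hX⟩ := hX
  choose k hk using fun z => hX.exists_smul_eq x z
  have key : ∀ g g' : G, g • x = g' • x → g • y = g' • y := by
    intro g g' e
    have := h (g'⁻¹ * g) (by rw [mul_smul, e, inv_smul_smul])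
    rw [mul_smul, inv_smul_eq_iff] at this
    exact this
  refine ⟨⟨fun z => k z • y, fun g z => ?_⟩, ?_⟩
  · change k (g • z) • y = g • k z • y
    rw [← mul_smul]
    exact key _ _ (by rw [hk, mul_smul, hk])
  · change k x • y = y
    rw [key (k x) 1 (by rw [hk, one_smul]), one_smul]

theorem card_fibre_eq {G : Type} [Group G] [TopologicalSpace G] {X Y : FinGSet G}
    (hY : Y.Transitive) (f : X →[G] Y) (y y' : Y) :
    Nat.card {x // f x = y} = Nat.card {x // f x = y'} := by
  obtain ⟨g, rfl⟩ := hY.2.exists_smul_eq y y'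
  refine Nat.card_congr ⟨fun x => ⟨g • x.1, by rw [map_smul, x.2]⟩,
    fun x => ⟨g⁻¹ • x.1, by rw [map_smul, x.2, inv_smul_smul]⟩,
    fun x => Subtype.ext (inv_smul_smul _ _), fun x => Subtype.ext (smul_inv_smul _ _)⟩

theorem exact_iff_of_exact [Finite A] [Finite B] {φ : LocallyConstant 𝔛 A} {x : X} {y : Y}
    (hx : Exact φ x) (hy : Exact φ y) (θ : LocallyConstant 𝔛 B) : Exact θ x ↔ Exact θ y :=
  ⟨fun h => hy.of_ker (h.ker_iff hx), fun h => hx.of_ker (h.ker_iff hy)⟩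

/-- A cover of a transitive `G`-set by `X(A)` along which coarsest supporting partitions are
preserved, marked by a point of `X(A)`. -/
structure ExactCover (X : FinGSet (HomeoGroup 𝔛)) (x : X) where
  n : ℕ
  φ : LocallyConstant 𝔛 (Fin n)
  surj : Function.Surjective φ
  exact : Exact φ x
  q : (setY 𝔛 (Fin n)).sub (subX 𝔛 (Fin n)) →[HomeoGroup 𝔛] X
  q_apply : q ⟨yv φ, surj⟩ = x

/-- A homeomorphism that fixes `φ` as a point of `X(n)` fixes `x`, because `φ` supports `x`. So the
assignment of `x` to `φ` extends to an equivariant map. -/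
theorem exists_exactCover (x : X) : Nonempty (ExactCover X x) := by
  obtain ⟨n, φ, hφ, h⟩ := exists_exact x
  obtain ⟨t⟩ := nonempty_cantor 𝔛
  have : Nonempty (Fin n) := ⟨φ t⟩
  obtain ⟨q, hq⟩ := exists_map_of_stabilizer (subX_transitive 𝔛 (Fin n)) ⟨yv φ, hφ⟩ x fun g hg =>
    h.1 g ((smul_setY_eq_iff g (yv φ)).1 (congrArg Subtype.val hg))
  exact ⟨⟨n, φ, hφ, h, q, hq⟩⟩

namespace ExactCover
variable {x : X} (c : ExactCover X x)

/-- The covering `G`-set `X(A)`. -/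
abbrev E : FinGSet (HomeoGroup 𝔛) := (setY 𝔛 (Fin c.n)).sub (subX 𝔛 (Fin c.n))

/-- The marked point. -/
abbrev pt : c.E := ⟨yv c.φ, c.surj⟩

theorem nonempty : Nonempty (Fin c.n) := by
  obtain ⟨t⟩ := nonempty_cantor 𝔛
  exact ⟨c.φ t⟩

theorem transitive : c.E.Transitive := by
  have := c.nonempty
  exact subX_transitive 𝔛 (Fin c.n)

theorem exact_pt : Exact c.φ c.pt :=
  (exact_map_iff (subIncl_injective _)).1 (exact_setY_self (yv c.φ))

/-- At the marked point `φ` is exact both for the point of `X(n)` and for its image; transitivity of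
`X(n)` spreads this to all points. -/
theorem exact_iff [Finite B] (θ : LocallyConstant 𝔛 B) (ψ : c.E) :
    Exact θ ψ ↔ Exact θ (c.q ψ) := by
  obtain ⟨g, rfl⟩ := c.transitive.2.exists_smul_eq c.pt ψ
  rw [map_smul, c.q_apply, ← exact_comp_iff, ← exact_comp_iff]
  exact exact_iff_of_exact c.exact_pt c.exact _

/-- The degree of the cover. -/
def deg : ℕ := Nat.card {ψ // c.q ψ = x}

/-- `euler_cover` applies to `q`, whose fibres all have the same size and which preserves coarsest
partitions. -/
theorem deg_mul_euler (hX : X.Transitive) : (c.deg : ℚ) * euler X = - (-1) ^ c.n := by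
  have := c.nonempty
  have h := euler_cover c.q c.deg (fun n x => c.exact_iff _ x) (fun y => card_fibre_eq hX _ _ _)
  rw [← h]
  simpa using euler_subX (𝔛 := 𝔛) (A := Fin c.n)

theorem deg_ne_zero (hX : X.Transitive) : (c.deg : ℚ) ≠ 0 := by
  intro h
  have := c.deg_mul_euler hX
  rw [h, zero_mul] at this
  exact neg_ne_zero.2 (pow_ne_zero _ (by norm_num)) this.symm

/-- The permutations of the parts that act trivially on the base of the cover. -/
def Γ : Type := {σ : Equiv.Perm (Fin c.n) // c.q ⟨yv (c.φ.map σ), σ.surjective.comp c.surj⟩ = x}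

instance : Finite c.Γ := Subtype.finite

/-- After translation `ω` is the marked point. An element `k` that carries it to a point with the
same image fixes `x`, so by exactness it permutes the parts of `φ`; this permutation is `σ`. The
cover is thus the quotient of `X(n)` by `Γ`. -/
theorem q_eq_iff (ψ ω : c.E) : c.q ψ = c.q ω ↔
    ∃ σ : c.Γ, ∀ t, lc ψ.1 t =
      σ.1 (lc ω.1 t) := by
  obtain ⟨g, rfl⟩ := c.transitive.2.exists_smul_eq c.pt ω
  have hg : ∀ t, lc (g • c.pt).1 t = c.φ (g⁻¹ • t) := fun t => rfl
  simp only [hg]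
  rw [map_smul, c.q_apply, ← inv_smul_eq_iff, ← map_smul]
  constructor
  · intro h
    obtain ⟨k, hk⟩ := c.transitive.2.exists_smul_eq c.pt (g⁻¹ • ψ)
    have hkx : k • x = x := by
      have := congrArg c.q hk
      rw [map_smul, c.q_apply] at this
      exact this.trans h
    have hkx' : k⁻¹ • x = x := inv_smul_eq_iff.2 hkx.symm
    -- `φ` and `φ ∘ k⁻¹` have the same fibres, so they differ by a relabelling of the parts.
    obtain ⟨σ, hσ⟩ := exists_equiv_of_ker (ψ := compLC c.φ k⁻¹) c.surj (fun i => by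
      obtain ⟨t, rfl⟩ := c.surj i
      exact ⟨k • t, by rw [compLC_apply, inv_smul_smul]⟩) fun s t => (c.exact.iff hkx' s t).symm
    have e : k • c.pt = (⟨yv (c.φ.map σ), σ.surjective.comp c.surj⟩ : c.E) :=
      Subtype.ext (lc_ext fun t => (hσ t).symm)
    refine ⟨⟨σ, ?_⟩, fun t => ?_⟩
    · rw [← e, hk, h]
    · have h1 : lc (k • c.pt).1 (g⁻¹ • t) =
        lc (g⁻¹ • ψ).1 (g⁻¹ • t) := by rw [hk]
      have h2 : lc (g⁻¹ • ψ).1 (g⁻¹ • t) =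
          lc ψ.1 (g⁻¹⁻¹ • g⁻¹ • t) := rfl
      rw [inv_smul_smul] at h2
      rw [← h2, ← h1]
      exact (hσ _).symm
  · rintro ⟨⟨σ, hσ⟩, h⟩
    refine Eq.trans (congrArg c.q ?_) hσ
    refine Subtype.ext (lc_ext fun t => ?_)
    have h2 : lc (g⁻¹ • ψ).1 t =
        lc ψ.1 (g⁻¹⁻¹ • t) := rfl
    refine h2.trans ((h _).trans ?_)
    rw [inv_inv, inv_smul_smul]
    rfl

/-- Composition with `φ` is a bijection from `Γ` to the fibre over `x`: injective because `φ` is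
surjective, surjective by `q_eq_iff`. -/
theorem deg_eq : c.deg = Nat.card c.Γ := by
  refine Nat.card_congr (Equiv.ofBijective (fun σ : c.Γ =>
    (⟨⟨yv (c.φ.map σ.1), σ.1.surjective.comp c.surj⟩, σ.2⟩ : {ψ // c.q ψ = x})) ⟨?_, ?_⟩).symm
  · rintro ⟨σ, hσ⟩ ⟨τ, hτ⟩ h
    refine Subtype.ext (Equiv.ext fun i => ?_)
    obtain ⟨t, rfl⟩ := c.surj i
    have h1 : c.φ.map σ = c.φ.map τ := congrArg (fun p : {ψ // c.q ψ = x} => lc p.1.1) h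
    exact LocallyConstant.congr_fun h1 t
  · rintro ⟨ψ, hψ⟩
    obtain ⟨σ, hσ⟩ := (c.q_eq_iff ψ c.pt).1 (hψ.trans c.q_apply.symm)
    exact ⟨σ, Subtype.ext (Subtype.ext (lc_ext fun t => (hσ t).symm))⟩

end ExactCover
end EulerMeasure
end CantorPerm
end

noncomputable section
namespace CantorPerm
set_option linter.unusedSectionVars false
-- Base change for the Euler characteristic, and existence of the measure
section BaseChange
open MulAction Pointwise FinGSet
variable {𝔛 : Type} [TopologicalSpace 𝔛] [IsCantorSpace 𝔛]
variable {X Y X' Y' : FinGSet (HomeoGroup 𝔛)} {A B C : Type}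

theorem Supports.map {φ : LocallyConstant 𝔛 A} {x : X} (h : Supports φ x)
    (f : X →[HomeoGroup 𝔛] Y) : Supports φ (f x) := fun g hg => by rw [← map_smul, h g hg]

/-- For use on fibre products: the coarsest partition of a point there is the common refinement of
those of its two projections. -/
theorem Supports.iff_of_pair {φ : LocallyConstant 𝔛 A} {χ : LocallyConstant 𝔛 B} {x : X} {y : Y}
    {z : Y'} (hz : ∀ g : HomeoGroup 𝔛, g • z = z ↔ g • x = x ∧ g • y = y) (hx : Exact φ x)
    (hy : Exact χ y) : Exact (pairLC φ χ) z := by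
  refine ⟨fun g hg => (hz g).2 ⟨hx.1 g fun t => (Prod.mk.inj (hg t)).1,
    hy.1 g fun t => (Prod.mk.inj (hg t)).2⟩, fun g hg s t hst => ?_⟩
  obtain ⟨h1, h2⟩ := Prod.mk.inj hst
  exact Prod.ext (hx.2 g ((hz g).1 hg).1 s t h1) (hy.2 g ((hz g).1 hg).2 s t h2)

theorem fst_surjective_iff [Fintype A] [Fintype B] [DecidableEq A] (ρ : LocallyConstant 𝔛 (A × B)) :
    Function.Surjective (fun t => (ρ t).1) ↔ (img ρ).image Prod.fst = Finset.univ := by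
  simp only [Finset.eq_univ_iff_forall, Finset.mem_image, mem_img]
  exact forall_congr' fun a => ⟨fun ⟨t, ht⟩ => ⟨ρ t, ⟨t, rfl⟩, ht⟩,
    fun ⟨_, ⟨t, ht⟩, h⟩ => ⟨t, (congrArg Prod.fst ht).trans h⟩⟩

theorem snd_surjective_iff [Fintype A] [Fintype B] [DecidableEq B] (ρ : LocallyConstant 𝔛 (A × B)) :
    Function.Surjective (fun t => (ρ t).2) ↔ (img ρ).image Prod.snd = Finset.univ := by
  simp only [Finset.eq_univ_iff_forall, Finset.mem_image, mem_img]
  exact forall_congr' fun a => ⟨fun ⟨t, ht⟩ => ⟨ρ t, ⟨t, rfl⟩, ht⟩,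
    fun ⟨_, ⟨t, ht⟩, h⟩ => ⟨t, (congrArg Prod.snd ht).trans h⟩⟩

/-- For a single `σ` the signs add up by `sum_fibreProduct_sign`. An admissible `R` determines `σ`,
since `R` projects onto `B` and `t` is surjective, so every `R` is counted for one `σ` only. -/
theorem euler_twisted_fibreProduct [Fintype A] [Fintype B] [Fintype C] [Nonempty A] {K : Type}
    [Finite K] (s : A → C) (t : B → C) (hs : Function.Surjective s) (ht : Function.Surjective t)
    (κ : K → Equiv.Perm C) (hκ : Function.Injective κ) [DecidableEq A] [DecidableEq B] :
    euler ((setY 𝔛 (A × B)).sub (subImg fun R => R.image Prod.fst = Finset.univ ∧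
      R.image Prod.snd = Finset.univ ∧ ∃ σ, ∀ p ∈ R, s p.1 = κ σ (t p.2))) =
      - (Nat.card K * ((-1) ^ Fintype.card A * (-1) ^ Fintype.card B * (-1) ^ Fintype.card C)) := by
  classical
  have := Fintype.ofFinite K
  rw [euler_subImg]
  · congr 1
    rw [Nat.card_eq_fintype_card, ← Finset.card_univ, ← nsmul_eq_mul, ← Finset.sum_const]
    have e : ∀ σ : K, ((-1 : ℚ) ^ Fintype.card A * (-1) ^ Fintype.card B * (-1) ^ Fintype.card C) =
        ∑ R : Finset (A × B), if R.image Prod.fst = Finset.univ then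
          (if R.image Prod.snd = Finset.univ then
            (if ∀ p ∈ R, s p.1 = κ σ (t p.2) then (-1 : ℚ) ^ R.card else 0) else 0) else 0 := by
      intro σ
      rw [sum_fibreProduct_sign s (fun b => κ σ (t b)), if_pos, Finset.card_univ, Finset.card_univ,
        Finset.image_univ_of_surjective hs, Finset.card_univ]
      exact (Finset.image_univ_of_surjective hs).trans
        (Finset.image_univ_of_surjective ((κ σ).surjective.comp ht)).symm
    rw [Finset.sum_congr rfl fun σ _ => e σ, Finset.sum_comm]
    refine Finset.sum_congr rfl fun R _ => ?_
    by_cases h1 : R.image Prod.fst = Finset.univ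
    · by_cases h2 : R.image Prod.snd = Finset.univ
      · simp only [h1, h2, true_and, if_true]
        split_ifs with h3
        · obtain ⟨σ, hσ⟩ := h3
          rw [Finset.sum_eq_single σ, if_pos hσ]
          · intro τ _ hτ
            rw [if_neg]
            intro h
            apply hτ
            refine hκ (Equiv.ext fun c => ?_)
            obtain ⟨b, rfl⟩ := ht c
            have hb : b ∈ R.image Prod.snd := h2 ▸ Finset.mem_univ b
            obtain ⟨p, hp, rfl⟩ := Finset.mem_image.1 hb
            rw [← h p hp, ← hσ p hp]
          · simp
        · refine (Finset.sum_eq_zero fun σ _ => if_neg fun h => h3 ⟨σ, h⟩).symm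
      · simp [h2]
    · simp [h1]
  · rintro ⟨h, _⟩
    rw [Finset.image_empty] at h
    exact Finset.univ_nonempty.ne_empty h.symm

/-- `X`, `Y'` and `Y` are covered by sets `X(a)`, `X(b)` and `X(c)`, and the maps to `Y` come from
maps `s`, `t` between the sets of parts. The pullback `Z` of `X'` to the covers consists of the
pairs whose images in `X(c)` agree up to `Γ`, so `euler_twisted_fibreProduct` gives its Euler
characteristic. On the other hand `Z` covers `X'`, with degree the product of the degrees of the
covers of `X` and `Y'`. -/
theorem euler_baseChange_transitive (hX : X.Transitive) (hY : Y.Transitive) (hY' : Y'.Transitive)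
    (f : X →[HomeoGroup 𝔛] Y) (h : Y' →[HomeoGroup 𝔛] Y) (f' : X' →[HomeoGroup 𝔛] Y')
    (p : X' →[HomeoGroup 𝔛] X) (hc : ∀ x', f (p x') = h (f' x'))
    (hu : ∀ x y', f x = h y' → ∃! x', p x' = x ∧ f' x' = y') :
    euler X' * euler Y = euler X * euler Y' := by
  classical
  obtain ⟨x₀⟩ := hX.1
  obtain ⟨y₀, hy₀⟩ : ∃ y₀, f x₀ = h y₀ := by
    obtain ⟨y⟩ := hY'.1
    obtain ⟨g, hg⟩ := hY.2.exists_smul_eq (h y) (f x₀)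
    exact ⟨g • y, by rw [map_smul, hg]⟩
  obtain ⟨a⟩ := exists_exactCover x₀
  obtain ⟨b⟩ := exists_exactCover y₀
  obtain ⟨c⟩ := exists_exactCover (f x₀)
  have := a.nonempty
  -- The partition of `x₀` also supports `f x₀`, hence refines the coarsest partition of `f x₀`; `s`
  -- is the resulting map on parts, and `t` arises in the same way from `y₀`.
  obtain ⟨s, hs⟩ := exists_factor a.surj (exact_factor c.exact (a.exact.1.map f))
  obtain ⟨t, ht⟩ := exists_factor b.surj (exact_factor c.exact (by
    rw [hy₀]; exact b.exact.1.map h))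
  have hss : Function.Surjective s := fun i => by
    obtain ⟨u, rfl⟩ := c.surj i
    exact ⟨_, hs u⟩
  have hts : Function.Surjective t := fun i => by
    obtain ⟨u, rfl⟩ := c.surj i
    exact ⟨_, ht u⟩
  have hfa : ∀ ψ : a.E, ∃ hψ, f (a.q ψ) = c.q ⟨yv ((lc ψ.1).map s), hψ⟩ := by
    intro ψ
    obtain ⟨g, rfl⟩ := a.transitive.2.exists_smul_eq a.pt ψ
    refine ⟨hss.comp (g • a.pt).2, ?_⟩
    rw [map_smul, a.q_apply, map_smul]
    refine (congrArg (fun y => g • y) c.q_apply.symm).trans ((map_smul c.q g c.pt).symm.trans ?_)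
    exact congrArg c.q (Subtype.ext (lc_ext fun u => (hs (g⁻¹ • u)).symm))
  have hhb : ∀ ψ : b.E, ∃ hψ, h (b.q ψ) = c.q ⟨yv ((lc ψ.1).map t), hψ⟩ := by
    intro ψ
    obtain ⟨g, rfl⟩ := b.transitive.2.exists_smul_eq b.pt ψ
    refine ⟨hts.comp (g • b.pt).2, ?_⟩
    rw [map_smul, b.q_apply, map_smul, ← hy₀]
    refine (congrArg (fun y => g • y) c.q_apply.symm).trans ((map_smul c.q g c.pt).symm.trans ?_)
    exact congrArg c.q (Subtype.ext (lc_ext fun u => (ht (g⁻¹ • u)).symm))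
  let P : Finset (Fin a.n × Fin b.n) → Prop := fun R => R.image Prod.fst = Finset.univ ∧
      R.image Prod.snd = Finset.univ ∧ ∃ σ : c.Γ, ∀ p ∈ R, s p.1 = σ.1 (t p.2)
  let Z : FinGSet (HomeoGroup 𝔛) := (setY 𝔛 (Fin a.n × Fin b.n)).sub (subImg P)
  have hZ : euler Z = - (Nat.card c.Γ * ((-1) ^ a.n * (-1) ^ b.n * (-1) ^ c.n)) := by
    have := euler_twisted_fibreProduct (𝔛 := 𝔛) s t hss hts (fun σ : c.Γ => σ.1)
      Subtype.val_injective
    simpa only [Fintype.card_fin] using this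
  let za : Z →[HomeoGroup 𝔛] a.E := ⟨fun z => ⟨yv ((lc z.1).map Prod.fst),
    (fst_surjective_iff (lc z.1)).2 z.2.1⟩, fun g z => rfl⟩
  let zb : Z →[HomeoGroup 𝔛] b.E := ⟨fun z => ⟨yv ((lc z.1).map Prod.snd),
    (snd_surjective_iff (lc z.1)).2 z.2.2.1⟩, fun g z => rfl⟩
  have hP : ∀ (ψ : a.E) (ω : b.E), f (a.q ψ) = h (b.q ω) ↔ P (img (pairLC (lc ψ.1) (lc ω.1))) := by
    intro ψ ω
    obtain ⟨h1, h2⟩ := hfa ψ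
    obtain ⟨h3, h4⟩ := hhb ω
    refine (iff_of_eq (congrArg₂ Eq h2 h4)).trans ((c.q_eq_iff ⟨_, h1⟩ ⟨_, h3⟩).trans ?_)
    have e1 := (fst_surjective_iff (pairLC (lc ψ.1) (lc ω.1))).1 ψ.2
    have e2 := (snd_surjective_iff (pairLC (lc ψ.1) (lc ω.1))).1 ω.2
    constructor
    · rintro ⟨σ, hσ⟩
      refine ⟨e1, e2, σ, fun p hp => ?_⟩
      obtain ⟨u, rfl⟩ := mem_img.1 hp
      exact hσ u
    · rintro ⟨_, _, σ, hσ⟩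
      exact ⟨σ, fun u => hσ _ (mem_img.2 ⟨u, rfl⟩)⟩
  have hz : ∀ z : Z, f (a.q (za z)) = h (b.q (zb z)) := fun z => (hP _ _).2 z.2
  -- The universal property of `X'` gives the map `Z → X'`; its uniqueness clause gives the
  -- equivariance.
  choose w hw1 hw2 using fun z : Z => hu _ _ (hz z)
  let F : Z →[HomeoGroup 𝔛] X' := ⟨w, fun g z => ((hw2 (g • z)) (g • w z) ⟨by
    rw [map_smul, (hw1 z).1, map_smul, map_smul], by
    rw [map_smul, (hw1 z).2, map_smul, map_smul]⟩).symm⟩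
  have hF1 : ∀ z, p (F z) = a.q (za z) := fun z => (hw1 z).1
  have hF2 : ∀ z, f' (F z) = b.q (zb z) := fun z => (hw1 z).2
  have hstab : ∀ (x' : X') (g : HomeoGroup 𝔛), g • x' = x' ↔ g • p x' = p x' ∧ g • f' x' = f' x' := by
    intro x' g
    constructor
    · intro e
      rw [← map_smul, ← map_smul, e]
      exact ⟨rfl, rfl⟩
    · rintro ⟨e1, e2⟩
      exact (hu _ _ (hc x')).unique ⟨by rw [map_smul, e1], by rw [map_smul, e2]⟩ ⟨rfl, rfl⟩
  -- A point of `Z` over `x'` is a pair of points in the fibres of the two covers over the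
  -- projections of `x'`. Upstairs and downstairs the coarsest partition is the common refinement of
  -- the same two partitions.
  have hcov : euler Z = ((a.deg * b.deg : ℕ) : ℚ) * euler X' := by
    refine euler_cover F _ (fun n z => ?_) fun x' => ?_
    · have e1 : Exact (lc (za z).1) (za z) :=
        (exact_map_iff (subIncl_injective _)).1 (exact_setY_self (za z).1)
      have e2 : Exact (lc (zb z).1) (zb z) :=
        (exact_map_iff (subIncl_injective _)).1 (exact_setY_self (zb z).1)
      have e3 : Exact (lc z.1) z :=
        (exact_map_iff (subIncl_injective _)).1 (exact_setY_self z.1)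
      refine exact_iff_of_exact e3 ?_ _
      refine Supports.iff_of_pair (hstab (F z)) (φ := lc (za z).1) (χ := lc (zb z).1) ?_ ?_
      · rw [hF1]; exact (a.exact_iff _ _).1 e1
      · rw [hF2]; exact (b.exact_iff _ _).1 e2
    · unfold ExactCover.deg
      rw [card_fibre_eq hX a.q x₀ (p x'), card_fibre_eq hY' b.q y₀ (f' x'), ← Nat.card_prod]
      refine Nat.card_congr ⟨fun z => (⟨za z.1, by rw [← hF1, z.2]⟩, ⟨zb z.1, by rw [← hF2, z.2]⟩),
        fun r => ⟨⟨yv (pairLC (lc r.1.1.1) (lc r.2.1.1)),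
          (hP _ _).1 (by rw [r.1.2, r.2.2, hc])⟩, ?_⟩, fun z => rfl, fun r => rfl⟩
      refine (hu _ _ (hc x')).unique ⟨(hF1 _).trans ?_, (hF2 _).trans ?_⟩ ⟨rfl, rfl⟩
      · exact r.1.2
      · exact r.2.2
  have ha := a.deg_mul_euler hX
  have hb := b.deg_mul_euler hY'
  have hcc := c.deg_mul_euler hY
  rw [hZ, ← c.deg_eq] at hcov
  push_cast at hcov
  have ha0 := a.deg_ne_zero hX
  have hb0 := b.deg_ne_zero hY'
  refine mul_left_cancel₀ (mul_ne_zero ha0 hb0) ?_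
  have hsq : ((-1 : ℚ) ^ c.n) * (-1) ^ c.n = 1 := by rw [← mul_pow]; norm_num
  calc (a.deg * b.deg : ℚ) * (euler X' * euler Y)
      = (a.deg * b.deg * euler X') * euler Y := by ring
    _ = - ((-1) ^ a.n * (-1) ^ b.n * (-1) ^ c.n) * (c.deg * euler Y) := by rw [← hcov]; ring
    _ = ((-1) ^ a.n * (-1) ^ b.n) * ((-1) ^ c.n * (-1) ^ c.n) := by rw [hcc]; ring
    _ = (a.deg * euler X) * (b.deg * euler Y') := by rw [hsq, ha, hb]; ring
    _ = _ := by ring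

/-- The preimage of a `G`-stable subset. -/
def preSub (p : X' →[HomeoGroup 𝔛] X) (S : SubMulAction (HomeoGroup 𝔛) X) :
    SubMulAction (HomeoGroup 𝔛) X' where
  carrier := {x | p x ∈ S}
  smul_mem' g x hx := by
    change p (g • x) ∈ S
    rw [map_smul]
    exact S.smul_mem g hx

theorem euler_eq_sum_orbits (p : X' →[HomeoGroup 𝔛] X) :
    euler X' = ∑ q : orbitRel.Quotient (HomeoGroup 𝔛) X, euler (X'.sub (preSub p (X.orb q.out))) := by
  refine euler_decomposition (fun q => subIncl _) (fun q => subIncl_injective _) ?_ ?_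
  · rintro q q' v v' e
    have e : v.1 = v'.1 := e
    have h1 : q = Quotient.mk'' (p v.1) := (mem_orb_out _ _).1 v.2
    have h2 : q' = Quotient.mk'' (p v'.1) := (mem_orb_out _ _).1 v'.2
    rw [h1, h2, e]
  · intro x
    exact ⟨Quotient.mk'' (p x), ⟨x, (mem_orb_out _ _).2 rfl⟩, rfl⟩

/-- Both sides are additive over the orbits of `X`. Only `X`, `Y` and `Y'` have to be transitive in
the previous case, so no decomposition of the pieces of `X'` is needed. -/
theorem euler_baseChange (hY : Y.Transitive) (hY' : Y'.Transitive)
    (f : X →[HomeoGroup 𝔛] Y) (h : Y' →[HomeoGroup 𝔛] Y) (f' : X' →[HomeoGroup 𝔛] Y')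
    (p : X' →[HomeoGroup 𝔛] X) (hc : ∀ x', f (p x') = h (f' x'))
    (hu : ∀ x y', f x = h y' → ∃! x', p x' = x ∧ f' x' = y') :
    euler X' * euler Y = euler X * euler Y' := by
  -- `X'` is cut along the preimages of the orbits of `X`; applied to the identity of `X`, the same
  -- lemma cuts `X` itself.
  rw [euler_eq_sum_orbits p, euler_eq_sum_orbits (MulActionHom.id (HomeoGroup 𝔛) (X := X)),
    Finset.sum_mul, Finset.sum_mul]
  refine Finset.sum_congr rfl fun q _ => ?_
  have e : euler (X.sub (preSub (MulActionHom.id (HomeoGroup 𝔛)) (X.orb q.out))) =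
    euler (X.sub (X.orb q.out)) := rfl
  rw [e]
  refine euler_baseChange_transitive (orb_transitive X q.out) hY hY' (f.comp (subIncl _)) h
    (f'.comp (subIncl _)) (restrict p _ _ fun _ hx => hx) (fun x' => hc x'.1) ?_
  rintro ⟨x, hx⟩ y' hxy
  obtain ⟨x', ⟨h1, h2⟩, h3⟩ := hu x y' hxy
  refine ⟨⟨x', by change p x' ∈ X.orb q.out; rw [h1]; exact hx⟩, ⟨Subtype.ext h1, h2⟩, ?_⟩
  rintro ⟨z, hz⟩ ⟨e1, e2⟩
  exact Subtype.ext (h3 z ⟨congrArg Subtype.val e1, e2⟩)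

variable (𝔛) in
/-- The measure given by the Euler characteristic. -/
def eulerMeasure : GMeasure (HomeoGroup 𝔛) ℚ where
  val {X Y} _ _ := euler X / euler Y
  iso {X Y} hY f hf := by rw [euler_congr f hf, div_self (euler_ne_zero hY)]
  add {X X₁ X₂ Y} hY f i₁ i₂ h₁ h₂ h := by
    rw [← add_div]
    congr 1
    let V : Bool → FinGSet (HomeoGroup 𝔛) := fun b => bif b then X₁ else X₂
    let j : ∀ b, V b →[HomeoGroup 𝔛] X := fun b => match b with
      | true => i₁
      | false => i₂
    have hdis := Set.disjoint_iff_forall_ne.1 h.disjoint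
    rw [euler_decomposition (V := V) j, Fintype.sum_bool]
    · rfl
    · rintro (_ | _)
      · exact h₂
      · exact h₁
    · rintro (_ | _) (_ | _) v v' e
      · rfl
      · exact absurd e.symm (hdis ⟨v', rfl⟩ ⟨v, rfl⟩)
      · exact absurd e (hdis ⟨v, rfl⟩ ⟨v', rfl⟩)
      · rfl
    · intro x
      have hx : x ∈ Set.range i₁ ∪ Set.range i₂ := by
        have := h.sup_eq_top
        change _ ∪ _ = _ at this
        rw [this]
        trivial
      rcases hx with ⟨v, hv⟩ | ⟨v, hv⟩
      · exact ⟨true, v, hv⟩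
      · exact ⟨false, v, hv⟩
  comp {X Y Z} hY hZ f g := by
    have := euler_ne_zero hY
    have := euler_ne_zero hZ
    field_simp
  baseChange {X Y X' Y'} hY hY' f h f' p hc hu := by
    have := euler_ne_zero hY
    have := euler_ne_zero hY'
    rw [div_eq_div_iff this ‹euler Y ≠ 0›]
    exact euler_baseChange hY hY' f h f' p hc hu

/-- The one-point set is isomorphic to `X(1)`. -/
theorem euler_pt : euler (pt (HomeoGroup 𝔛)) = 1 := by
  have h := euler_subX (𝔛 := 𝔛) (A := Fin 1)
  rw [← euler_congr (GMeasure.toPt ((setY 𝔛 (Fin 1)).sub (subX 𝔛 (Fin 1)))), h]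
  · norm_num
  · refine ⟨fun a b _ => Subtype.ext (lc_ext fun t => Subsingleton.elim _ _), fun y => ?_⟩
    obtain ⟨x⟩ := (subX_transitive 𝔛 (Fin 1)).1
    exact ⟨x, rfl⟩

theorem isNu_eulerMeasure : IsNu (eulerMeasure 𝔛) := by
  refine ⟨fun X Y hX hY f => (div_ne_zero (euler_ne_zero hX) (euler_ne_zero hY)).isUnit,
    fun n hn => ?_⟩
  obtain ⟨n, rfl⟩ := Nat.exists_eq_add_of_le' hn
  change euler (setX 𝔛 (n + 1)) / euler (pt (HomeoGroup 𝔛)) = _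
  rw [euler_pt, div_one, setX, euler_subX, Fintype.card_fin, pow_succ, Nat.add_sub_cancel]
  ring

end BaseChange
end CantorPerm
end

noncomputable section
namespace CantorPerm
set_option linter.unusedSectionVars false
-- Values of a measure on maps and on orbits
section MeasureValues
open MulAction FinGSet
universe w
variable {G : Type} [Group G] [TopologicalSpace G] {k : Type w} [CommRing k] (μ : GMeasure G k)
variable {X Y Z : FinGSet G}

namespace GMeasure

/-- Base change along the isomorphism from the total subset of `Y` to `Y` reduces this to the
decomposition already known for restrictions to stable subsets. -/
theorem val_eq_orbSum (hY : Y.Transitive) (f : X →[G] Y) : μ.val hY f = X.orbSum (μ.orbVal f) := by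
  classical
  have hT : (Y.sub ⊤).Transitive := ⟨hY.1.map fun y => ⟨y, trivial⟩, ⟨fun a b => by
    obtain ⟨g, hg⟩ := hY.2.exists_smul_eq a.1 b.1
    exact ⟨g, Subtype.ext hg⟩⟩⟩
  have e := μ.on_eq_orbSum f ⊤ ⊤ hT (fun _ _ => trivial)
  rw [← μ.baseChange hY hT f (subIncl ⊤) (restrict f ⊤ ⊤ fun _ _ => trivial) (subIncl ⊤)
    (fun _ => rfl) (fun x y' h => ⟨⟨x, trivial⟩, ⟨rfl, Subtype.ext h⟩,
      fun z hz => Subtype.ext hz.1⟩)]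
  exact e.trans (orbSum_congr fun x => if_pos trivial)

/-- When `x` and `f x` have the same stabilizer, `f` maps the orbit of `x` isomorphically onto that
of `f x`. -/
theorem orbVal_eq_one (f : X →[G] Y) (x : X) (h : ∀ g : G, g • f x = f x → g • x = x) :
    μ.orbVal f x = 1 := by
  refine μ.iso _ _ ⟨?_, ?_⟩
  · rintro ⟨_, a, rfl⟩ ⟨_, b, rfl⟩ e
    have e : f (a • x) = f (b • x) := congrArg Subtype.val e
    rw [map_smul, map_smul] at e
    have := h (b⁻¹ * a) (by rw [mul_smul, e, inv_smul_smul])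
    rw [mul_smul, inv_smul_eq_iff] at this
    exact Subtype.ext this
  · rintro ⟨_, g, rfl⟩
    exact ⟨⟨g • x, g, rfl⟩, Subtype.ext (map_smul f g x)⟩

theorem val_mul_value (hY : Y.Transitive) (f : X →[G] Y) :
    μ.value Y * μ.val hY f = μ.value X := (μ.comp hY pt_transitive f (toPt Y)).symm

theorem value_congr (hY : Y.Transitive) (f : X →[G] Y) (hf : Function.Bijective f) :
    μ.value X = μ.value Y := by rw [← μ.val_mul_value hY f, μ.iso hY f hf, mul_one]

theorem value_orb_mul_orbVal (f : X →[G] Y) (x : X) :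
    μ.value (Y.sub (Y.orb (f x))) * μ.orbVal f x = μ.value (X.sub (X.orb x)) :=
  μ.val_mul_value _ _

theorem ext_val {ν : GMeasure G k} (h : ∀ {X Y : FinGSet G} (hY : Y.Transitive) (f : X →[G] Y),
    μ.val hY f = ν.val hY f) : μ = ν := by
  obtain ⟨a, _, _, _, _⟩ := μ
  obtain ⟨b, _, _, _, _⟩ := ν
  have : @a = @b := by
    funext X Y hY f
    exact h hY f
  subst this
  rfl

end GMeasure
end MeasureValues

/-! ### Uniqueness of the measure -/

section Uniqueness
open MulAction FinGSet GMeasure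
universe w
variable {𝔛 : Type} [TopologicalSpace 𝔛] [IsCantorSpace 𝔛] {k : Type w} [CommRing k]
variable {X Y : FinGSet (HomeoGroup 𝔛)}

/-- The pairs of points with the same image. -/
def fibreSquare (f : X →[HomeoGroup 𝔛] Y) : SubMulAction (HomeoGroup 𝔛) (X.prod X) where
  carrier := {p | f p.1 = f p.2}
  smul_mem' g p h := by
    change f (g • p.1) = f (g • p.2)
    rw [map_smul, map_smul]
    exact congrArg (fun y => g • y) h

/-- Base change of `q` along itself. In a point `(ψ, ω)` of the fibre square, `ψ` is a relabelling
of `ω` and has the same stabilizer, so every orbit of the square is a copy of `X(n)`. The value of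
`q` is the number of these orbits, whatever the measure. -/
theorem ExactCover.val_q (μ : GMeasure (HomeoGroup 𝔛) k) (hX : X.Transitive) {x : X}
    (c : ExactCover X x) : μ.val hX c.q = Fintype.card (orbitRel.Quotient (HomeoGroup 𝔛)
      ((c.E.prod c.E).sub (fibreSquare c.q))) := by
  let Z := (c.E.prod c.E).sub (fibreSquare c.q)
  let f' : Z →[HomeoGroup 𝔛] c.E := ⟨fun z => z.1.2, fun _ _ => rfl⟩
  let p : Z →[HomeoGroup 𝔛] c.E := ⟨fun z => z.1.1, fun _ _ => rfl⟩
  rw [← μ.baseChange hX c.transitive c.q c.q f' p (fun z => z.2) (fun a b h =>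
    ⟨⟨(a, b), h⟩, ⟨rfl, rfl⟩, fun z hz => Subtype.ext (Prod.ext hz.1 hz.2)⟩), val_eq_orbSum]
  refine (orbSum_congr (ψ := fun _ => 1) fun z => μ.orbVal_eq_one _ _ fun g hg => ?_).trans
    (by simp [orbSum, Z])
  obtain ⟨⟨ψ, ω⟩, hz⟩ := z
  obtain ⟨σ, hσ⟩ := (c.q_eq_iff ψ ω).1 hz
  have hω : g • ω.1 = ω.1 := congrArg Subtype.val hg
  refine Subtype.ext (Prod.ext (Subtype.ext (lc_ext fun t => ?_)) hg)
  have h2 := congrArg (fun ρ => lc ρ t) hω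
  exact (hσ (g⁻¹ • t)).trans ((congrArg σ.1 h2).trans (hσ t).symm)

namespace IsNu
variable {ν ν' : GMeasure (HomeoGroup 𝔛) ℚ} (h : IsNu ν) (h' : IsNu ν')
include h

theorem value_ne_zero (hX : X.Transitive) : ν.value X ≠ 0 := (h.1 _ _ hX pt_transitive _).ne_zero

theorem value_cover {x : X} (c : ExactCover X x) : ν.value c.E = (-1) ^ (c.n - 1) :=
  h.2 c.n (Fin.pos_iff_nonempty.2 c.nonempty)

include h'

/-- The product of `ν(X)` and `ν(q)` is `ν(X(n))`. The second factor is a number of orbits that does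
not depend on the measure, and the product is prescribed. -/
theorem value_eq (hX : X.Transitive) : ν.value X = ν'.value X := by
  obtain ⟨x⟩ := hX.1
  obtain ⟨c⟩ := exists_exactCover x
  have h1 := ν.val_mul_value hX c.q
  have h2 := ν'.val_mul_value hX c.q
  rw [c.val_q, h.value_cover] at h1
  rw [c.val_q, h'.value_cover, ← h1] at h2
  -- The number of orbits is not zero, since its product with a value is `±1`.
  refine (mul_right_cancel₀ (fun h0 => ?_) h2).symm
  rw [h0, mul_zero] at h1
  exact pow_ne_zero _ (by norm_num) h1.symm

/-- By regularity one may divide by the value of the target orbit. -/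
theorem orbVal_eq (f : X →[HomeoGroup 𝔛] Y) (x : X) : ν.orbVal f x = ν'.orbVal f x := by
  have h1 := ν.value_orb_mul_orbVal f x
  have h2 := ν'.value_orb_mul_orbVal f x
  rw [h.value_eq h' (orb_transitive _ _), h.value_eq h' (orb_transitive _ _), ← h2] at h1
  exact mul_left_cancel₀ (h'.value_ne_zero (orb_transitive _ _)) h1

theorem eq : ν = ν' := ν.ext_val fun hY f => by
  rw [val_eq_orbSum, val_eq_orbSum]
  exact orbSum_congr (h.orbVal_eq h' f)

end IsNu

theorem existsUnique_isNu : ∃! ν : GMeasure (HomeoGroup 𝔛) ℚ, IsNu ν :=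
  ⟨eulerMeasure 𝔛, isNu_eulerMeasure, fun _ h => h.eq isNu_eulerMeasure⟩

end Uniqueness

/-! ### Push-forward along `Y(f)` -/

section PushY
open MulAction FinGSet GMeasure
universe w
variable {𝔛 : Type} [TopologicalSpace 𝔛] [IsCantorSpace 𝔛] {A B : Type} [Fintype A] [Fintype B]

theorem mem_orb_setY {ρ ρ' : setY 𝔛 A} : ρ' ∈ (setY 𝔛 A).orb ρ ↔ img (lc ρ') = img (lc ρ) := by
  constructor
  · rintro ⟨g, rfl⟩
    exact img_smul g ρ
  · exact fun h => exists_smul_of_img_eq h.symm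

/-- The orbit of `ρ` is isomorphic to `X(n)`, where `n` is the size of the image of `ρ`. -/
theorem IsNu.value_orb {ν : GMeasure (HomeoGroup 𝔛) ℚ} (h : IsNu ν) (ρ : setY 𝔛 A) :
    ν.value ((setY 𝔛 A).sub ((setY 𝔛 A).orb ρ)) = - (-1) ^ (img (lc ρ)).card := by
  obtain ⟨n, hn⟩ : ∃ n, (img (lc ρ)).card = n + 1 :=
    Nat.exists_eq_succ_of_ne_zero (Finset.card_pos.2 (img_nonempty _)).ne'
  let e : Fin (n + 1) ≃ img (lc ρ) := (Fintype.equivFinOfCardEq (by simpa using hn)).symm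
  let i : Fin (n + 1) → A := fun j => (e j).1
  have hi : Function.Injective i := Subtype.val_injective.comp e.injective
  have himg : ∀ ψ : setX 𝔛 (n + 1), img (lc (mapY i ψ.1)) = img (lc ρ) := fun ψ => by
    ext d
    rw [mem_img]
    constructor
    · rintro ⟨t, rfl⟩
      exact (e (lc ψ.1 t)).2
    · intro hd
      obtain ⟨t, ht⟩ := ψ.2 (e.symm ⟨d, hd⟩)
      refine ⟨t, ?_⟩
      change (e (ψ.1.toFun t)).1 = d
      have ht : ψ.1.toFun t = e.symm ⟨d, hd⟩ := ht
      rw [ht, e.apply_symm_apply]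
  let F : setX 𝔛 (n + 1) →[HomeoGroup 𝔛] (setY 𝔛 A).sub ((setY 𝔛 A).orb ρ) :=
    ⟨fun ψ => ⟨mapY i ψ.1, mem_orb_setY.2 (himg ψ)⟩, fun _ _ => rfl⟩
  rw [← ν.value_congr (orb_transitive _ _) F, h.2 (n + 1) (by omega), hn, Nat.add_sub_cancel,
    pow_succ]
  · ring
  · constructor
    · intro ψ ω hψ
      have hψ : mapY i ψ.1 = mapY i ω.1 := congrArg Subtype.val hψ
      exact Subtype.ext (lc_ext fun t => hi (congrArg (fun r => lc r t) hψ))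
    · rintro ⟨_, g, rfl⟩
      obtain ⟨ψ⟩ := (subX_transitive 𝔛 (Fin (n + 1))).1
      obtain ⟨g', hg'⟩ := exists_smul_of_img_eq (himg ψ)
      exact ⟨(g * g') • ψ, Subtype.ext (by
        change mapY i ((g * g') • ψ.1) = g • ρ
        rw [map_smul, mul_smul, hg'])⟩

theorem img_mapY [DecidableEq B] (f : A → B) (ρ : setY 𝔛 A) :
    img (lc (mapY f ρ)) = (img (lc ρ)).image f := by
  ext b
  simp only [mem_img, Finset.mem_image]
  constructor
  · rintro ⟨t, rfl⟩
    exact ⟨_, ⟨t, rfl⟩, rfl⟩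
  · rintro ⟨_, ⟨t, rfl⟩, rfl⟩
    exact ⟨t, rfl⟩

/-- This is the quotient of the values of the two orbits; the overall minus signs cancel, and a sign
is its own inverse. -/
theorem IsNu.orbVal_mapY [DecidableEq B] {ν : GMeasure (HomeoGroup 𝔛) ℚ} (h : IsNu ν) (f : A → B)
    (ρ : setY 𝔛 A) :
    ν.orbVal (mapY f) ρ = (-1) ^ (img (lc ρ)).card * (-1) ^ ((img (lc ρ)).image f).card := by
  have h1 := ν.value_orb_mul_orbVal (mapY f) ρ
  rw [h.value_orb, h.value_orb, img_mapY] at h1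
  have h3 : ((-1 : ℚ) ^ ((img (lc ρ)).image f).card) * (-1) ^ ((img (lc ρ)).image f).card = 1 := by
    rw [← mul_pow]; norm_num
  calc _ = ((-1 : ℚ) ^ ((img (lc ρ)).image f).card * (-1) ^ ((img (lc ρ)).image f).card) *
        ν.orbVal (mapY f) ρ := by rw [h3, one_mul]
    _ = - (-1) ^ ((img (lc ρ)).image f).card *
        (-(-1) ^ ((img (lc ρ)).image f).card * ν.orbVal (mapY f) ρ) := by ring
    _ = _ := by rw [h1]; ring

theorem orbSum_setY {k : Type w} [CommRing k] (F : Finset A → k) :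
    (setY 𝔛 A).orbSum (fun ρ => F (img (lc ρ))) =
      ∑ S : Finset A, if S.Nonempty then F S else 0 := by
  classical
  rw [← Finset.sum_filter, orbSum]
  refine Finset.sum_bij (fun q _ => img (lc q.out)) (fun q _ => ?_) (fun q _ q' _ e => ?_)
    (fun S hS => ?_) fun _ _ => rfl
  · exact Finset.mem_filter.2 ⟨Finset.mem_univ _, img_nonempty _⟩
  · exact ((mem_orb_out q q'.out).1 (mem_orb_setY.2 e.symm)).trans (Quotient.out_eq q')
  · obtain ⟨ρ, hρ⟩ := exists_img_eq (𝔛 := 𝔛) (Finset.mem_filter.1 hS).2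
    refine ⟨Quotient.mk'' (yv ρ), Finset.mem_univ _, ?_⟩
    rw [← hρ]
    exact (mem_orb_setY.1 ((mem_orb_out _ (yv ρ)).2 rfl)).symm

variable {k : Type w} [Field k] [CharZero k]

/-- At a point with image `T`, the push-forward of `1` is the sum of `(-1)^|S| (-1)^|T|` over the
non-empty `S` with `f(S) = T`, and `sum_image_eq_sign` evaluates it. -/
theorem IsNu.pushforward_mapY {ν : GMeasure (HomeoGroup 𝔛) ℚ} (h : IsNu ν) (f : A → B) :
    (ν.map (algebraMap ℚ k)).pushforward (mapY f) (indicator k ⊤) =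
      indicator k (subY 𝔛 (Set.range f)) := by
  classical
  refine Subtype.ext (funext fun ψ => ?_)
  have e1 : ∀ ρ : setY 𝔛 A, (if ψ ∈ (setY 𝔛 B).orb (mapY f ρ) then
      (if ρ ∈ (⊤ : SubMulAction (HomeoGroup 𝔛) (setY 𝔛 A)) then (1 : k) else 0) *
        (ν.map (algebraMap ℚ k)).orbVal (mapY f) ρ else 0) =
      (if (img (lc ρ)).image f = img (lc ψ) then (-1 : k) ^ (img (lc ρ)).card *
        (-1) ^ (img (lc ψ)).card else 0) := by
    intro ρ
    have ht : ρ ∈ (⊤ : SubMulAction (HomeoGroup 𝔛) (setY 𝔛 A)) := trivial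
    rw [if_pos ht, one_mul]
    have e2 : (ν.map (algebraMap ℚ k)).orbVal (mapY f) ρ =
        algebraMap ℚ k (ν.orbVal (mapY f) ρ) := rfl
    rw [e2, h.orbVal_mapY, mem_orb_setY, img_mapY]
    by_cases h3 : (img (lc ρ)).image f = img (lc ψ)
    · rw [if_pos h3, if_pos h3.symm, h3]
      simp
    · rw [if_neg h3, if_neg (Ne.symm h3)]
  refine (orbSum_congr e1).trans ((orbSum_setY (fun S => if S.image f = img (lc ψ) then
    (-1 : k) ^ S.card * (-1) ^ (img (lc ψ)).card else 0)).trans ?_)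
  -- Here `T` is not empty, so `f(S) = T` already forces `S` to be non-empty. The vacuous condition
  -- `S ⊆ univ` matches the form of `sum_image_eq_sign`.
  have e3 : ∀ S : Finset A, (if S.Nonempty then (if S.image f = img (lc ψ) then
      (-1 : k) ^ S.card * (-1) ^ (img (lc ψ)).card else 0) else 0) =
      (if S.image f = img (lc ψ) then (if S ⊆ Finset.univ then (-1 : k) ^ S.card else 0) else 0) *
        (-1) ^ (img (lc ψ)).card := by
    intro S
    by_cases hS : S.image f = img (lc ψ)
    · have : S.Nonempty := by
        have := img_nonempty (lc ψ)
        rw [← hS] at this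
        exact Finset.image_nonempty.1 this
      simp [hS, this]
    · simp [hS]
  rw [Finset.sum_congr rfl fun S _ => e3 S, ← Finset.sum_mul, sum_image_eq_sign]
  have h4 : img (lc ψ) ⊆ Finset.univ.image f ↔ ψ ∈ subY 𝔛 (Set.range f) := by
    simp only [Finset.subset_iff, mem_img, Finset.mem_image]
    constructor
    · intro h t
      obtain ⟨a, _, ha⟩ := h ⟨t, rfl⟩
      exact ⟨a, ha⟩
    · rintro h _ ⟨t, rfl⟩
      obtain ⟨a, ha⟩ := h t
      exact ⟨a, Finset.mem_univ _, ha⟩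
  change _ = if ψ ∈ subY 𝔛 (Set.range f) then 1 else 0
  simp only [h4]
  split_ifs
  · rw [← mul_pow]; norm_num
  · rw [zero_mul]

end PushY
end CantorPerm
end

noncomputable section
namespace CantorPerm
set_option linter.unusedSectionVars false
-- Disjoint unions as biproducts of permutation modules
section PermBiproducts
open MulAction FinGSet
universe w
variable {G : Type} [Group G] [TopologicalSpace G]

/-- The disjoint union of a finite family of finitary `G`-sets. -/
def FinGSet.sigma {ι : Type} [Finite ι] (V : ι → FinGSet G) : FinGSet G where
  carrier := Σ i, V i
  action :=
    { smul := fun g x => ⟨x.1, g • x.2⟩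
      one_smul := fun x => congrArg (Sigma.mk x.1) (one_smul G x.2)
      mul_smul := fun g h x => congrArg (Sigma.mk x.1) (mul_smul g h x.2) }
  smooth x := by
    let _ : MulAction G (Σ i, V i) :=
      { smul := fun g x => ⟨x.1, g • x.2⟩
        one_smul := fun x => congrArg (Sigma.mk x.1) (one_smul G x.2)
        mul_smul := fun g h x => congrArg (Sigma.mk x.1) (mul_smul g h x.2) }
    have h : stabilizer G x = stabilizer G x.2 := by
      ext g
      rw [mem_stabilizer_iff, mem_stabilizer_iff]
      exact ⟨fun h => eq_of_heq (Sigma.mk.inj h).2, fun h => congrArg (Sigma.mk x.1) h⟩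
    rw [h]
    exact (V x.1).smooth x.2
  finitary := by
    let _ : MulAction G (Σ i, V i) :=
      { smul := fun g x => ⟨x.1, g • x.2⟩
        one_smul := fun x => congrArg (Sigma.mk x.1) (one_smul G x.2)
        mul_smul := fun g h x => congrArg (Sigma.mk x.1) (mul_smul g h x.2) }
    let F : (Σ i, orbitRel.Quotient G (V i)) → orbitRel.Quotient G (Σ i, V i) := fun q =>
      Quotient.map' (fun x => ⟨q.1, x⟩) (by
        rintro a b ⟨g, rfl⟩
        exact ⟨g, rfl⟩) q.2
    have := fun i => (V i).finitary
    refine Finite.of_surjective F fun q => ?_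
    induction q using Quotient.inductionOn' with | _ x =>
    exact ⟨⟨x.1, Quotient.mk'' x.2⟩, rfl⟩

/-- The inclusion of a member of a family into the disjoint union. -/
def FinGSet.sigmaIncl {ι : Type} [Finite ι] (V : ι → FinGSet G) (i : ι) :
    V i →[G] FinGSet.sigma V where
  toFun x := ⟨i, x⟩
  map_smul' _ _ := rfl

theorem FinGSet.sigmaIncl_injective {ι : Type} [Finite ι] (V : ι → FinGSet G) (i : ι) :
    Function.Injective (sigmaIncl V i) := fun _ _ h => eq_of_heq (Sigma.mk.inj h).2

variable {k : Type w} [CommRing k] [RoelckePrecompact G] {μ : GMeasure G k}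

namespace Perm

open scoped Classical in
/-- The matrix of a map of `G`-sets. -/
def mapMat {X Y : FinGSet G} (f : X →[G] Y) : Mat k Y X :=
  ⟨fun t => if t.1 = f t.2 then 1 else 0, fun g t => by
    refine if_congr ?_ rfl rfl
    change g • t.1 = f (g • t.2) ↔ _
    rw [map_smul, smul_left_cancel_iff]⟩

open scoped Classical in
/-- The transpose of the matrix of a map of `G`-sets, with its columns multiplied by an invariant
function. -/
def comapMat {X Y : FinGSet G} (f : X →[G] Y) (w : InvFun k Y) : Mat k X Y :=
  ⟨fun t => if t.2 = f t.1 then w.1 t.2 else 0, fun g t => by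
    refine if_congr ?_ (w.2 g t.2) rfl
    change g • t.2 = f (g • t.1) ↔ _
    rw [map_smul, smul_left_cancel_iff]⟩

/-- The constant function `1`. -/
def invOne (k : Type w) [CommRing k] (X : FinGSet G) : InvFun k X := ⟨fun _ => 1, fun _ _ => rfl⟩

/-- The integrand is supported on a section of the projection `p₁₃`, so the measure does not enter.
-/
theorem matMul_mapMat {X Y Z : FinGSet G} (f : X →[G] Y) (A : Mat k Z Y) (z : Z) (x : X) :
    (matMul μ A (mapMat f)).1 (z, x) = A.1 (z, f x) := by
  classical
  let i : Z.prod X →[G] Z.prod (Y.prod X) :=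
    ⟨fun t => (t.1, f t.2, t.2), fun g t => Prod.ext rfl (Prod.ext (map_smul f g t.2) rfl)⟩
  refine (μ.push_section (p13 Z Y X) i (fun _ => rfl) (matProd A (mapMat f)).2 ?_ (z, x)).trans ?_
  · rintro ⟨z, y, x⟩ h
    change _ * ite _ _ _ = _
    rw [if_neg, mul_zero]
    intro hy
    change y = f x at hy
    subst hy
    exact h rfl
  · exact (congrArg _ (if_pos rfl)).trans (mul_one _)

theorem comapMat_matMul {X Y Z : FinGSet G} (f : Y →[G] Z) (A : Mat k Z X) (y : Y) (x : X) :
    (matMul μ (comapMat f (invOne k Z)) A).1 (y, x) = A.1 (f y, x) := by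
  classical
  let i : Y.prod X →[G] Y.prod (Z.prod X) :=
    ⟨fun t => (t.1, f t.1, t.2), fun g t => Prod.ext rfl (Prod.ext (map_smul f g t.1) rfl)⟩
  refine (μ.push_section (p13 Y Z X) i (fun _ => rfl)
    (matProd (comapMat f (invOne k Z)) A).2 ?_ (y, x)).trans ?_
  · rintro ⟨y, z, x⟩ h
    change ite _ _ _ * _ = _
    rw [if_neg, zero_mul]
    intro hy
    change z = f y at hy
    subst hy
    exact h rfl
  · exact (congrArg (fun s => s * A.1 (f y, x)) (if_pos rfl)).trans (one_mul _)

/-- The morphism `Vec_X ⟶ Vec_Y` of a map of `G`-sets. -/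
def ofMap {X Y : Perm μ} (f : X.set →[G] Y.set) : X ⟶ Y := mapMat f

/-- The morphism `Vec_Y ⟶ Vec_X` given by the transpose of a map `X → Y`. -/
def ofComap {X Y : Perm μ} (f : X.set →[G] Y.set) : Y ⟶ X := comapMat f (invOne k Y.set)

theorem ofMap_comp_apply {X Y Z : Perm μ} (f : X.set →[G] Y.set) (A : Y ⟶ Z) (z : Z.set)
    (x : X.set) : (mat (ofMap f ≫ A)).1 (z, x) = (mat A).1 (z, f x) := matMul_mapMat f A z x

theorem comp_ofComap_apply {X Y Z : Perm μ} (f : Y.set →[G] Z.set) (A : X ⟶ Z) (y : Y.set)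
    (x : X.set) : (mat (A ≫ ofComap f)).1 (y, x) = (mat A).1 (f y, x) := comapMat_matMul f A y x

theorem ofMap_comp_ofComap_self {X Y : Perm μ} {f : X.set →[G] Y.set}
    (hf : Function.Injective f) : ofMap f ≫ ofComap f = 𝟙 X := by
  classical
  refine hom_ext fun x x' => ?_
  rw [comp_ofComap_apply]
  exact if_congr hf.eq_iff rfl rfl

theorem ofMap_comp_ofComap_of_ne {X X' Y : Perm μ} {f : X.set →[G] Y.set} {f' : X'.set →[G] Y.set}
    (h : ∀ x x', f x ≠ f' x') : ofMap f ≫ ofComap f' = 0 := by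
  classical
  refine hom_ext fun x' x => ?_
  rw [comp_ofComap_apply]
  exact if_neg (h x x').symm

theorem hom_ext_of_cover {ι : Type} {X : ι → Perm μ} {Y Z : Perm μ}
    (f : ∀ i, (X i).set →[G] Y.set) (hf : ∀ y, ∃ i x, f i x = y) {A B : Y ⟶ Z}
    (h : ∀ i, ofMap (f i) ≫ A = ofMap (f i) ≫ B) : A = B := by
  refine hom_ext fun z y => ?_
  obtain ⟨i, x, rfl⟩ := hf y
  rw [← ofMap_comp_apply, h i, ofMap_comp_apply]

/-- The disjoint union of a finite family. -/
abbrev sum {ι : Type} [Finite ι] (X : ι → Perm μ) : Perm μ := vec (FinGSet.sigma fun i => (X i).set)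

/-- The inclusion of a summand. -/
def inj {ι : Type} [Finite ι] (X : ι → Perm μ) (i : ι) : X i ⟶ sum X :=
  ofMap (X := X i) (Y := sum X) (sigmaIncl (fun i => (X i).set) i)

/-- The projection to a summand. -/
def proj {ι : Type} [Finite ι] (X : ι → Perm μ) (i : ι) : sum X ⟶ X i :=
  ofComap (X := X i) (Y := sum X) (sigmaIncl (fun i => (X i).set) i)

theorem inj_proj_self {ι : Type} [Finite ι] (X : ι → Perm μ) (i : ι) :
    inj X i ≫ proj X i = 𝟙 (X i) := ofMap_comp_ofComap_self (sigmaIncl_injective _ i)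

theorem inj_proj_ne {ι : Type} [Finite ι] (X : ι → Perm μ) {i j : ι} (h : i ≠ j) :
    inj X i ≫ proj X j = 0 :=
  ofMap_comp_ofComap_of_ne fun _ _ e => h (congrArg Sigma.fst e)

theorem sum_proj_inj {ι : Type} [Fintype ι] (X : ι → Perm μ) :
    ∑ i, proj X i ≫ inj X i = 𝟙 (sum X) := by
  refine hom_ext_of_cover (X := X) (Y := sum X) (fun i => sigmaIncl (fun i => (X i).set) i)
    (fun y => ⟨y.1, y.2, rfl⟩) fun j => ?_
  change inj X j ≫ _ = inj X j ≫ _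
  rw [Preadditive.comp_sum, Finset.sum_eq_single j, ← Category.assoc, inj_proj_self,
    Category.id_comp, Category.comp_id]
  · intro i _ hi
    rw [← Category.assoc, inj_proj_ne X hi.symm, Limits.zero_comp]
  · simp

theorem comp_eq_sum {ι : Type} [Fintype ι] (X : ι → Perm μ) {A B : Perm μ} (f : A ⟶ sum X)
    (g : sum X ⟶ B) : f ≫ g = ∑ j, (f ≫ proj X j) ≫ (inj X j ≫ g) := by
  simp only [Category.assoc]
  rw [← Preadditive.comp_sum]
  congr 1
  have : ∀ j, proj X j ≫ inj X j ≫ g = (proj X j ≫ inj X j) ≫ g := fun j =>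
    (Category.assoc _ _ _).symm
  rw [Finset.sum_congr rfl fun j _ => this j, ← Preadditive.sum_comp, sum_proj_inj,
    Category.id_comp]

instance : Limits.HasFiniteBiproducts (Perm μ) where
  out n := ⟨fun X => ⟨⟨{ pt := sum X
                         π := proj X
                         ι := inj X
                         ι_π := fun i j => by
                          by_cases h : i = j
                          · subst h
                            rw [dif_pos rfl, inj_proj_self]
                            rfl
                          · rw [dif_neg h, inj_proj_ne X h] }, 
    Limits.isBilimitOfTotal _ (sum_proj_inj X)⟩⟩⟩

end Perm
end PermBiproducts
end CantorPerm
end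

noncomputable section
namespace CantorPerm
set_option linter.unusedSectionVars false
-- Monoidal functors between Karoubi envelopes
section KaroubiFunctor
open Idempotents
universe v₁ v₂ u₁ u₂ w
variable {C : Type u₁} [Category.{v₁} C] {D : Type u₂} [Category.{v₂} D]

/-- The functor between Karoubi envelopes induced by a functor. -/
abbrev karMap (F : C ⥤ D) : Karoubi C ⥤ Karoubi D where
  obj P := ⟨F.obj P.X, F.map P.p, by rw [← F.map_comp, P.idem]⟩
  map {P Q} f := ⟨F.map f.f, by
    change F.map P.p ≫ F.map f.f ≫ F.map Q.p = F.map f.f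
    rw [← F.map_comp, ← F.map_comp, f.comm]⟩
  map_id _ := rfl
  map_comp f g := Karoubi.hom_ext _ _ (F.map_comp f.f g.f)

/-- A morphism `g` of the Karoubi envelope is the restriction of a morphism `x` commuting with the
idempotents. -/
structure Lifts {P Q : Karoubi C} (g : P ⟶ Q) (x : P.X ⟶ Q.X) : Prop where
  eq : g.f = P.p ≫ x
  comm : P.p ≫ x = x ≫ Q.p

namespace Lifts
variable {P Q R : Karoubi C} {g g' : P ⟶ Q} {x : P.X ⟶ Q.X}

/-- Reduces a coherence equation in the Karoubi envelope to the one in `C`: its two sides lift the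
two sides of the latter. -/
theorem unique (h : Lifts g x) (h' : Lifts g' x) : g = g' :=
  Karoubi.hom_ext _ _ (h.eq.trans h'.eq.symm)

theorem comp (h : Lifts g x) {g₂ : Q ⟶ R} {x₂ : Q.X ⟶ R.X} (h₂ : Lifts g₂ x₂) :
    Lifts (g ≫ g₂) (x ≫ x₂) where
  eq := by
    change g.f ≫ g₂.f = _
    rw [h.eq, h₂.eq, Category.assoc, ← reassoc_of% h.comm, P.idem_assoc]
  comm := by rw [← Category.assoc, h.comm, Category.assoc, h₂.comm, Category.assoc]

theorem karIso_hom (e : P.X ≅ Q.X) (h : P.p ≫ e.hom = e.hom ≫ Q.p) :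
    Lifts (karIso e h).hom e.hom := ⟨rfl, h⟩

theorem map (F : C ⥤ D) (h : Lifts g x) : Lifts ((karMap F).map g) (F.map x) where
  eq := (congrArg F.map h.eq).trans (F.map_comp _ _)
  comm := by
    change F.map P.p ≫ F.map x = F.map x ≫ F.map Q.p
    rw [← F.map_comp, h.comm, F.map_comp]

variable [MonoidalCategory C]

theorem whiskerRight (h : Lifts g x) (R : Karoubi C) : Lifts (g ▷ R) (x ▷ R.X) where
  eq := by
    change g.f ⊗ₘ R.p = (P.p ⊗ₘ R.p) ≫ (x ▷ R.X)
    rw [h.eq, ← tensorHom_id, tensorHom_comp_tensorHom, Category.comp_id]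
  comm := by
    change (P.p ⊗ₘ R.p) ≫ (x ▷ R.X) = (x ▷ R.X) ≫ (Q.p ⊗ₘ R.p)
    rw [← tensorHom_id, tensorHom_comp_tensorHom, tensorHom_comp_tensorHom, h.comm,
      Category.comp_id, Category.id_comp]

theorem whiskerLeft (h : Lifts g x) (R : Karoubi C) : Lifts (R ◁ g) (R.X ◁ x) where
  eq := by
    change R.p ⊗ₘ g.f = (R.p ⊗ₘ P.p) ≫ (R.X ◁ x)
    rw [h.eq, ← id_tensorHom, tensorHom_comp_tensorHom, Category.comp_id]
  comm := by
    change (R.p ⊗ₘ P.p) ≫ (R.X ◁ x) = (R.X ◁ x) ≫ (R.p ⊗ₘ Q.p)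
    rw [← id_tensorHom, tensorHom_comp_tensorHom, tensorHom_comp_tensorHom, h.comm,
      Category.comp_id, Category.id_comp]

end Lifts

variable [MonoidalCategory C] [MonoidalCategory D] (F : C ⥤ D)

/-- The extension of a monoidal functor to the Karoubi envelopes is monoidal. -/
def karMapCore [F.Monoidal] : (karMap F).CoreMonoidal where
  εIso := karIso (Functor.Monoidal.εIso F) (by
    change 𝟙 _ ≫ Functor.LaxMonoidal.ε F = Functor.LaxMonoidal.ε F ≫ F.map (𝟙 _)
    simp)
  μIso P Q := karIso (Functor.Monoidal.μIso F P.X Q.X)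
    (Functor.LaxMonoidal.μ_natural F P.p Q.p)
  μIso_hom_natural_left {P Q} f R := Karoubi.hom_ext _ _ (by
    change (F.map f.f ⊗ₘ F.map R.p) ≫ (F.map Q.p ⊗ₘ F.map R.p) ≫ Functor.LaxMonoidal.μ F _ _ =
      ((F.map P.p ⊗ₘ F.map R.p) ≫ Functor.LaxMonoidal.μ F _ _) ≫ F.map (f.f ⊗ₘ R.p)
    simp only [Functor.LaxMonoidal.μ_natural, Category.assoc, ← F.map_comp,
      tensorHom_comp_tensorHom, Karoubi.idem, Functor.LaxMonoidal.μ_natural_assoc]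
    simp)
  μIso_hom_natural_right {P Q} R f := Karoubi.hom_ext _ _ (by
    change (F.map R.p ⊗ₘ F.map f.f) ≫ (F.map R.p ⊗ₘ F.map Q.p) ≫ Functor.LaxMonoidal.μ F _ _ =
      ((F.map R.p ⊗ₘ F.map P.p) ≫ Functor.LaxMonoidal.μ F _ _) ≫ F.map (R.p ⊗ₘ f.f)
    simp only [Functor.LaxMonoidal.μ_natural, Category.assoc, ← F.map_comp,
      tensorHom_comp_tensorHom, Karoubi.idem, Functor.LaxMonoidal.μ_natural_assoc]
    simp)
  associativity P Q R := by
    refine Lifts.unique (((Lifts.karIso_hom _ _).whiskerRight _).comp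
      ((Lifts.karIso_hom _ _).comp ((Lifts.karIso_hom _ _).map F))) ?_
    -- The associativity of `F` identifies the underlying morphisms, so the lift built for one side
    -- serves for the other. The unit and braiding axioms are treated in the same way.
    refine cast (congrArg _ (Functor.LaxMonoidal.associativity F P.X Q.X R.X).symm)
      ((Lifts.karIso_hom _ _).comp
      (((Lifts.karIso_hom _ _).whiskerLeft _).comp (Lifts.karIso_hom _ _)))
  left_unitality P := by
    refine Lifts.unique (Lifts.karIso_hom _ _) ?_
    refine cast (congrArg _ (Functor.LaxMonoidal.left_unitality F P.X).symm)
      (((Lifts.karIso_hom _ _).whiskerRight _).comp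
      ((Lifts.karIso_hom _ _).comp ((Lifts.karIso_hom _ _).map F)))
  right_unitality P := by
    refine Lifts.unique (Lifts.karIso_hom _ _) ?_
    refine cast (congrArg _ (Functor.LaxMonoidal.right_unitality F P.X).symm)
      (((Lifts.karIso_hom _ _).whiskerLeft _).comp
      ((Lifts.karIso_hom _ _).comp ((Lifts.karIso_hom _ _).map F)))

instance karMapMonoidal [F.Monoidal] : (karMap F).Monoidal := (karMapCore F).toMonoidal

theorem lifts_μ [F.Monoidal] (P Q : Karoubi C) :
    Lifts (Functor.LaxMonoidal.μ (karMap F) P Q) (Functor.LaxMonoidal.μ F P.X Q.X) :=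
  ⟨rfl, Functor.LaxMonoidal.μ_natural F P.p Q.p⟩

instance karMapBraided [SymmetricCategory C] [SymmetricCategory D] [F.Braided] :
    (karMap F).Braided where
  braided P Q := by
    refine Lifts.unique ((lifts_μ F P Q).comp ((Lifts.karIso_hom _ _).map F)) ?_
    exact cast (congrArg _ (Functor.LaxBraided.braided (F := F) P.X Q.X).symm)
      ((Lifts.karIso_hom _ _).comp (lifts_μ F Q P))

end KaroubiFunctor

/-! ### Monoidal functors on a full subcategory with its own unit -/

section LocalUnitFunctor
universe v₁ v₂ u₁ u₂
variable {D : Type u₁} [Category.{v₁} D] [MonoidalCategory D]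
variable {E : Type u₂} [Category.{v₂} E] [MonoidalCategory E]
variable {P : ObjectProperty D} (u : LocalUnit P) (K : D ⥤ E)

namespace LocalUnit
open Functor.LaxMonoidal

/-- The restriction of a monoidal functor inverting `U ⟶ 𝟙` is monoidal. -/
def core [K.Monoidal] [IsIso (K.map u.j)] :
    letI := u.monoidal
    (P.ι ⋙ K).CoreMonoidal :=
  letI := u.monoidal
  -- The unit of the subcategory is `U`, so the unit constraint of `K` is followed by the inverse of
  -- `K(j)`.
  { εIso := Functor.Monoidal.εIso K ≪≫ (asIso (K.map u.j)).symm
    μIso := fun X Y => Functor.Monoidal.μIso K X.obj Y.obj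
    μIso_hom_natural_left := fun f X => μ_natural_left K f.hom X.obj
    μIso_hom_natural_right := fun X f => μ_natural_right K X.obj f.hom
    associativity := fun X Y Z => associativity K X.obj Y.obj Z.obj
    left_unitality := fun X => by
      change (λ_ (K.obj X.obj)).hom = (ε K ≫ inv (K.map u.j)) ▷ K.obj X.obj ≫ μ K _ _ ≫
        K.map ((u.j ▷ X.obj) ≫ (λ_ X.obj).hom)
      rw [K.map_comp, ← μ_natural_left_assoc, ← comp_whiskerRight_assoc, Category.assoc,
        IsIso.inv_hom_id, Category.comp_id]
      exact left_unitality K X.obj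
    right_unitality := fun X => by
      change (ρ_ (K.obj X.obj)).hom = K.obj X.obj ◁ (ε K ≫ inv (K.map u.j)) ≫ μ K _ _ ≫
        K.map ((X.obj ◁ u.j) ≫ (ρ_ X.obj).hom)
      rw [K.map_comp, ← μ_natural_right_assoc, ← whiskerLeft_comp_assoc, Category.assoc,
        IsIso.inv_hom_id, Category.comp_id]
      exact right_unitality K X.obj }

abbrev functorMonoidal [K.Monoidal] [IsIso (K.map u.j)] :
    letI := u.monoidal
    (P.ι ⋙ K).Monoidal :=
  letI := u.monoidal
  (u.core K).toMonoidal

abbrev functorBraided [SymmetricCategory D] [SymmetricCategory E] [K.Braided]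
    [IsIso (K.map u.j)] :
    letI := u.monoidal
    letI := u.symmetric
    (P.ι ⋙ K).Braided :=
  letI := u.monoidal
  letI := u.symmetric
  { u.functorMonoidal K with
    braided := fun X Y => Functor.LaxBraided.braided (F := K) X.obj Y.obj }

end LocalUnit
end LocalUnitFunctor
end CantorPerm
end

noncomputable section
namespace CantorPerm
set_option linter.unusedSectionVars false
-- Arithmetic of the Boolean semiring
section BoolMatrices

theorem BoolSemiring.zero_ne_one : (0 : BoolSemiring) ≠ 1 := by decide

theorem BoolSemiring.add_eq_one {a b : BoolSemiring} : a + b = 1 ↔ a = 1 ∨ b = 1 := by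
  revert a b; decide

theorem BoolSemiring.mul_eq_one {a b : BoolSemiring} : a * b = 1 ↔ a = 1 ∧ b = 1 := by
  revert a b; decide

theorem BoolSemiring.eq_zero_iff {a : BoolSemiring} : a = 0 ↔ a ≠ 1 := by
  revert a; decide

theorem BoolSemiring.sum_eq_one {ι : Type} (s : Finset ι) (f : ι → BoolSemiring) :
    ∑ i ∈ s, f i = 1 ↔ ∃ i ∈ s, f i = 1 := by
  classical
  induction s using Finset.induction_on with
  | empty => simp [BoolSemiring.zero_ne_one]
  | insert i s hi ih =>
    rw [Finset.sum_insert hi, BoolSemiring.add_eq_one, ih]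
    simp

theorem WCat.perm_eq_one {X Y : WCat} (e : X.A ≃ Y.A) (b : Y.A) (a : X.A) :
    mat (perm e : X ⟶ Y) b a = 1 ↔ b = e a := by
  classical
  change (1 : Matrix Y.A Y.A BoolSemiring) b (e a) = 1 ↔ _
  rw [Matrix.one_apply]
  by_cases h : b = e a
  · rw [if_pos h]
    exact iff_of_true rfl h
  · rw [if_neg h]
    exact iff_of_false BoolSemiring.zero_ne_one h

end BoolMatrices

/-! ### Linear extension of a functor -/

section FreeLift
universe v u v' u' w
variable {k : Type w} [CommRing k] {C : Type u} [Category.{v} C] {D : Type u'} [Category.{v'} D]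
  [Preadditive D] [Linear k D]

/-- The `k`-linear extension of a functor on morphisms. -/
def freeLiftMap (F : C ⥤ D) (X Y : C) : (Free.of k X ⟶ Free.of k Y) →ₗ[k] (F.obj X ⟶ F.obj Y) :=
  Finsupp.linearCombination k (fun f : X ⟶ Y => F.map f)

theorem freeLiftMap_fsingle (F : C ⥤ D) {X Y : C} (f : X ⟶ Y) (r : k) :
    freeLiftMap F X Y (fsingle f r) = r • F.map f := Finsupp.linearCombination_single k r f

theorem freeLiftMap_comp (F : C ⥤ D) {X Y Z : C} (f : Free.of k X ⟶ Free.of k Y)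
    (g : Free.of k Y ⟶ Free.of k Z) :
    freeLiftMap F X Z (f ≫ g) = freeLiftMap F X Y f ≫ freeLiftMap F Y Z g := by
  induction f using free_induction with
  | h0 => simp only [Limits.zero_comp, map_zero]
  | ha a b ha hb => simp only [Preadditive.add_comp, map_add, ha, hb]
  | hs f r =>
  induction g using free_induction with
  | h0 => simp only [Limits.comp_zero, map_zero]
  | ha a b ha hb => simp only [Preadditive.comp_add, map_add, ha, hb]
  | hs g s =>
  simp only [fsingle_comp, freeLiftMap_fsingle, F.map_comp, Linear.smul_comp, Linear.comp_smul,
    mul_smul]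
  rw [smul_comm]

theorem freeLiftMap_id (F : C ⥤ D) (X : C) :
    freeLiftMap F X X (𝟙 (Free.of k X)) = 𝟙 (F.obj X) := by
  rw [← fsingle_id, freeLiftMap_fsingle, one_smul, F.map_id]

/-- The `k`-linear extension of a functor. -/
def freeLift (F : C ⥤ D) : Free k C ⥤ D where
  obj X := F.obj X
  map {X Y} f := freeLiftMap (k := k) F X Y f
  map_id X := freeLiftMap_id (C := C) F X
  map_comp f g := freeLiftMap_comp (k := k) F f g

theorem freeLift_additive (F : C ⥤ D) : (freeLift (k := k) F).Additive :=
  ⟨fun {X Y} f g => map_add (freeLiftMap (k := k) F X Y) f g⟩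

theorem freeLift_linear (F : C ⥤ D) : (freeLift (k := k) F).Linear k :=
  ⟨fun {X Y} f r => map_smul (freeLiftMap (k := k) F X Y) r f⟩

theorem freeLift_fsingle (F : C ⥤ D) {X Y : C} (f : X ⟶ Y) (r : k) :
    (freeLift (k := k) F).map (fsingle f r) = r • F.map f := freeLiftMap_fsingle F f r

end FreeLift

/-! ### From Boolean matrices to permutation modules -/

section RelMat
open MulAction FinGSet GMeasure
universe w
variable {𝔛 : Type} [TopologicalSpace 𝔛] [IsCantorSpace 𝔛] {k : Type w} [CommRing k]
variable {A B C : Type} [Fintype A] [Fintype B] [Fintype C]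

theorem exists_codRestrict {p : A → Prop} (ρ : LocallyConstant 𝔛 A) (h : ∀ t, p (ρ t)) :
    ∃ ψ : LocallyConstant 𝔛 {a // p a}, ψ.map Subtype.val = ρ :=
  ⟨⟨fun t => ⟨ρ t, h t⟩, IsLocallyConstant.desc (fun t => (⟨ρ t, h t⟩ : {a // p a})) Subtype.val
    ρ.isLocallyConstant Subtype.val_injective⟩, rfl⟩

open scoped Classical in
/-- The matrix whose entries are the indicators of the pairs of maps related at each point by
a Boolean matrix. -/
def relMat (R : Matrix B A BoolSemiring) : Perm.Mat k (setY 𝔛 B) (setY 𝔛 A) :=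
  ⟨fun t => if ∀ x, R (lc t.1 x) (lc t.2 x) = 1 then 1 else 0, fun g t => by
    refine if_congr ⟨fun h x => ?_, fun h x => h (g⁻¹ • x)⟩ rfl rfl
    have := h (g • x)
    change R (lc t.1 (g⁻¹ • g • x)) (lc t.2 (g⁻¹ • g • x)) = 1 at this
    rwa [inv_smul_smul] at this⟩

/-- The measure `μ` satisfies `Y(f)_* 1 = 1_{Y(im f)}`. -/
def PushY (μ : GMeasure (HomeoGroup 𝔛) k) : Prop :=
  ∀ (A B : Type) [Fintype A] [Fintype B] (f : A → B), μ.pushforward (mapY f) (indicator k ⊤) =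
    indicator k (subY 𝔛 (Set.range f))

/-- A map to a product as a pair of maps. -/
def splitY (A B : Type) [Finite A] [Finite B] :
    setY 𝔛 (A × B) →[HomeoGroup 𝔛] (setY 𝔛 A).prod (setY 𝔛 B) where
  toFun ψ := (mapY Prod.fst ψ, mapY Prod.snd ψ)
  map_smul' _ _ := rfl

/-- A map to a product of three sets as a triple of maps. -/
def splitY₃ (A B C : Type) [Finite A] [Finite B] [Finite C] :
    setY 𝔛 (A × B × C) →[HomeoGroup 𝔛] (setY 𝔛 A).prod ((setY 𝔛 B).prod (setY 𝔛 C)) where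
  toFun ψ := (mapY Prod.fst ψ, mapY (fun p => p.2.1) ψ, mapY (fun p => p.2.2) ψ)
  map_smul' _ _ := rfl

theorem splitY_injective : Function.Injective (splitY (𝔛 := 𝔛) A B) := fun _ _ e =>
  lc_ext fun t => Prod.ext (congrArg (fun r => lc r t) (Prod.mk.inj e).1)
    (congrArg (fun r => lc r t) (Prod.mk.inj e).2)

theorem splitY₃_injective : Function.Injective (splitY₃ (𝔛 := 𝔛) A B C) := fun _ _ e =>
  lc_ext fun t => Prod.ext (congrArg (fun r => lc r t) (Prod.mk.inj e).1)
    (Prod.ext (congrArg (fun r => lc r t) (Prod.mk.inj (Prod.mk.inj e).2).1)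
      (congrArg (fun r => lc r t) (Prod.mk.inj (Prod.mk.inj e).2).2))

theorem splitY₃_surjective : Function.Surjective (splitY₃ (𝔛 := 𝔛) A B C) := fun t =>
  ⟨yv (pairLC (lc t.1) (pairLC (lc t.2.1) (lc t.2.2))), rfl⟩

theorem mapY_injective {f : A → B} (hf : Function.Injective f) :
    Function.Injective (mapY (𝔛 := 𝔛) f) := fun _ _ e =>
  lc_ext fun t => hf (congrArg (fun r => lc r t) e)

/-- The composable triples of a pair of Boolean matrices. -/
abbrev Triples (S : Matrix C B BoolSemiring) (R : Matrix B A BoolSemiring) : Type :=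
  {p : C × B × A // S p.1 p.2.1 = 1 ∧ R p.2.1 p.2.2 = 1}

/-- The product of the two indicators is the indicator of the maps with values in the composable
triples. Writing it as the push-forward of `1` along an injection brings it into the range of
`PushY`. -/
theorem matProd_relMat (S : Matrix C B BoolSemiring) (R : Matrix B A BoolSemiring)
    (μ : GMeasure (HomeoGroup 𝔛) k) (t : (setY 𝔛 C).prod ((setY 𝔛 B).prod (setY 𝔛 A))) :
    (Perm.matProd (relMat S) (relMat R)).1 t =
      μ.push ((splitY₃ C B A).comp (mapY (Subtype.val : Triples S R → _)))
        (indicator k ⊤).1 t := by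
  classical
  have hj : Function.Injective ((splitY₃ (𝔛 := 𝔛) C B A).comp
      (mapY (Subtype.val : Triples S R → _))) :=
    splitY₃_injective.comp (mapY_injective Subtype.val_injective)
  obtain ⟨ρ, rfl⟩ := splitY₃_surjective t
  by_cases h : ∀ t, S (lc ρ t).1 (lc ρ t).2.1 = 1 ∧ R (lc ρ t).2.1 (lc ρ t).2.2 = 1
  · obtain ⟨ψ, hψ⟩ := exists_codRestrict (p := fun p : C × B × A => S p.1 p.2.1 = 1 ∧
      R p.2.1 p.2.2 = 1) (lc ρ) h
    have e : ρ = mapY (Subtype.val : Triples S R → _) (yv ψ) := hψ.symm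
    refine (congrArg₂ (· * ·) (if_pos fun x => (h x).1) (if_pos fun x => (h x).2)).trans
      ((one_mul 1).trans ?_)
    have e2 := push_injective_apply μ _ hj
      (indicator k (⊤ : SubMulAction (HomeoGroup 𝔛) (setY 𝔛 (Triples S R)))).2 (yv ψ)
    rw [e]
    exact (e2.trans (if_pos trivial)).symm
  · rw [push_of_notMem]
    · change ite _ _ _ * ite _ _ _ = _
      split_ifs with h1 h2
      · exact absurd (fun t => ⟨h1 t, h2 t⟩) h
      all_goals simp
    · intro ψ hψ
      have e : mapY (Subtype.val : Triples S R → _) ψ = ρ := splitY₃_injective hψ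
      subst e
      exact h fun t => (lc ψ t).2

/-- On composable triples the projection `p₁₃` is `Y(f)` followed by the injection `splitY`, where
`f` forgets the middle entry. `PushY` turns the push-forward of `1` into the indicator of the range
of `f`, and this range is the support of the Boolean product: since `1 + 1 = 1`, only the existence
of a middle entry matters. -/
theorem PushY.relMat_mul {μ : GMeasure (HomeoGroup 𝔛) k} (hμ : PushY μ)
    (S : Matrix C B BoolSemiring) (R : Matrix B A BoolSemiring) :
    Perm.matMul μ (relMat S) (relMat R) = relMat (S * R) := by
  classical
  let f : Triples S R → C × A := fun p => (p.1.1, p.1.2.2)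
  let u : InvFun k (setY 𝔛 (Triples S R)) := indicator k ⊤
  refine Perm.mat_ext fun z x => ?_
  have e1 : (Perm.matMul μ (relMat S) (relMat R)).1 (z, x) =
      μ.push ((splitY C A).comp (mapY f)) u.1 (z, x) :=
    (μ.push_congr _ (matProd_relMat S R μ) _).trans (μ.push_comp _ _ _ _)
  have e2 : μ.push (mapY f) u.1 = (indicator k (subY 𝔛 (Set.range f))).1 :=
    congrArg Subtype.val (hμ _ _ f)
  refine e1.trans ((μ.push_comp _ _ _ _).symm.trans ?_)
  rw [e2]
  refine (push_injective_apply μ (splitY C A) splitY_injective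
    (indicator k (subY 𝔛 (Set.range f))).2 (yv (pairLC (lc z) (lc x)))).trans
    (if_congr (forall_congr' fun t => ?_) rfl rfl)
  change (lc z t, lc x t) ∈ Set.range f ↔ (S * R) (lc z t) (lc x t) = 1
  rw [Matrix.mul_apply, BoolSemiring.sum_eq_one]
  constructor
  · rintro ⟨⟨⟨c, b, a⟩, h1, h2⟩, e⟩
    obtain ⟨e1, e2⟩ := Prod.mk.inj e
    rw [← e1, ← e2]
    exact ⟨b, Finset.mem_univ _, BoolSemiring.mul_eq_one.2 ⟨h1, h2⟩⟩
  · rintro ⟨b, _, hb⟩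
    exact ⟨⟨(_, b, _), BoolSemiring.mul_eq_one.1 hb⟩, rfl⟩

theorem relMat_perm {X Y : WCat} (e : X.A ≃ Y.A) (ψ : setY 𝔛 Y.A) (φ : setY 𝔛 X.A)
    [Decidable (ψ = mapY e φ)] :
    (relMat (k := k) (WCat.mat (WCat.perm e : X ⟶ Y))).1 (ψ, φ) =
      if ψ = mapY e φ then 1 else 0 := by
  classical
  refine if_congr ⟨fun h => lc_ext fun t => (WCat.perm_eq_one e _ _).1 (h t), ?_⟩ rfl rfl
  rintro rfl t
  exact (WCat.perm_eq_one e _ _).2 rfl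

theorem relMat_kron {X Y X' Y' : WCat} (R : X ⟶ Y) (R' : X' ⟶ Y') (ψ : setY 𝔛 (Y.A × Y'.A))
    (φ : setY 𝔛 (X.A × X'.A)) :
    (relMat (k := k) (WCat.mat (WCat.kron R R'))).1 (ψ, φ) =
      (relMat (WCat.mat R)).1 (mapY Prod.fst ψ, mapY Prod.fst φ) *
        (relMat (WCat.mat R')).1 (mapY Prod.snd ψ, mapY Prod.snd φ) := by
  classical
  refine (Perm.ite_mul_ite_of_iff ?_).symm
  rw [← forall_and]
  exact forall_congr' fun t => BoolSemiring.mul_eq_one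

variable {μ : GMeasure (HomeoGroup 𝔛) k} (hμ : PushY μ)

/-- The functor `W(A) ↦ Vec_{Y(A)}`. -/
def relFunctor : WCat ⥤ Perm μ where
  obj X := Perm.vec (setY 𝔛 X.A)
  map {X Y} R := (relMat (WCat.mat R) : Perm.Mat k (setY 𝔛 Y.A) (setY 𝔛 X.A))
  map_id X := by
    classical
    refine Perm.hom_ext fun ψ φ => ?_
    exact relMat_perm (Equiv.refl X.A) ψ φ
  map_comp R S := (hμ.relMat_mul (WCat.mat S) (WCat.mat R)).symm

/-- The `k`-linear extension of `W(A) ↦ Vec_{Y(A)}`. -/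
def freeFunctor : Free k WCat ⥤ Perm μ := freeLift (relFunctor hμ)

instance : (freeFunctor hμ).Additive := freeLift_additive _
instance : (freeFunctor hμ).Linear k := freeLift_linear _

theorem freeFunctor_fsingle {X Y : WCat} (R : X ⟶ Y) (r : k) :
    (freeFunctor hμ).map (fsingle R r) = r • (relFunctor hμ).map R :=
  freeLift_fsingle _ R r

/-- The value at a pair of points of the image of a morphism. -/
def entry {X Y : WCat} (ψ : setY 𝔛 Y.A) (φ : setY 𝔛 X.A) :
    (Free.of k X ⟶ Free.of k Y) →ₗ[k] k where
  toFun f := (Perm.mat ((freeFunctor hμ).map f)).1 (ψ, φ)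
  map_add' f g := by rw [(freeFunctor hμ).map_add]; rfl
  map_smul' r f := by rw [(freeFunctor hμ).map_smul]; rfl

theorem entry_fsingle {X Y : WCat} (ψ : setY 𝔛 Y.A) (φ : setY 𝔛 X.A) (R : X ⟶ Y) (r : k) :
    entry hμ ψ φ (fsingle R r) = r * (relMat (WCat.mat R)).1 (ψ, φ) := by
  change (Perm.mat ((freeFunctor hμ).map (fsingle R r))).1 (ψ, φ) = _
  rw [freeFunctor_fsingle]
  rfl

theorem entry_tensor {X Y X' Y' : WCat} (ψ : setY 𝔛 (Y.A × Y'.A)) (φ : setY 𝔛 (X.A × X'.A))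
    (f : Free.of k X ⟶ Free.of k Y) (g : Free.of k X' ⟶ Free.of k Y') :
    entry hμ (X := X ⊗ X') (Y := Y ⊗ Y') ψ φ (freeTensorHom f g) =
      entry hμ (mapY Prod.fst ψ) (mapY Prod.fst φ) f *
        entry hμ (mapY Prod.snd ψ) (mapY Prod.snd φ) g := by
  induction f using free_induction with
  | h0 => rw [zero_freeTensorHom, map_zero, map_zero, zero_mul]
  | ha a b ha hb => rw [add_freeTensorHom, map_add, map_add, ha, hb, add_mul]
  | hs f r =>
  induction g using free_induction with
  | h0 => rw [freeTensorHom_zero, map_zero, map_zero, mul_zero]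
  | ha a b ha hb => rw [freeTensorHom_add, map_add, map_add, ha, hb, mul_add]
  | hs g s =>
  rw [freeTensorHom_fsingle, entry_fsingle, entry_fsingle, entry_fsingle, mul_mul_mul_comm]
  exact congrArg _ (relMat_kron f g ψ φ)

end RelMat
end CantorPerm
end

noncomputable section
namespace CantorPerm
set_option linter.unusedSectionVars false
-- Extension of an additive functor to the additive envelope
section MatLift
open MulAction FinGSet Perm
universe v u w
variable {G : Type} [Group G] [TopologicalSpace G] [RoelckePrecompact G]
variable {k : Type w} [CommRing k] {μ : GMeasure G k}

theorem Perm.inj_comp_proj_apply {ι κ : Type} [Finite ι] [Finite κ] (X : ι → Perm μ)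
    (Y : κ → Perm μ) (A : Perm.sum X ⟶ Perm.sum Y) (i : ι) (j : κ) (y : (Y j).set) (x : (X i).set) :
    (mat (inj X i ≫ A ≫ proj Y j)).1 (y, x) = (mat A).1 (⟨j, y⟩, ⟨i, x⟩) :=
  (ofMap_comp_apply (X := X i) (Y := Perm.sum X) _ _ _ _).trans
    (comp_ofComap_apply (Y := Y j) (Z := Perm.sum Y) _ _ _ _)

theorem Perm.sum_hom_ext {ι κ : Type} [Finite ι] [Finite κ] {X : ι → Perm μ}
    {Y : κ → Perm μ} {A B : Perm.sum X ⟶ Perm.sum Y}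
    (h : ∀ i j, inj X i ≫ A ≫ proj Y j = inj X i ≫ B ≫ proj Y j) : A = B := by
  refine hom_ext ?_
  rintro ⟨j, y⟩ ⟨i, x⟩
  rw [← Perm.inj_comp_proj_apply X Y A, h, Perm.inj_comp_proj_apply]

variable {C : Type u} [Category.{v} C] [Preadditive C] (F : C ⥤ Perm μ)

/-- The matrix of blocks given by the images of the entries of a morphism of `Mat_ C`. -/
def matLiftMap {M N : Mat_ C} (f : M ⟶ N) :
    Perm.sum (fun i => F.obj (M.X i)) ⟶ Perm.sum (fun j => F.obj (N.X j)) :=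
  (⟨fun t => (mat (F.map (f t.2.1 t.1.1))).1 (t.1.2, t.2.2),
    fun g t => (mat (F.map (f t.2.1 t.1.1))).2 g (t.1.2, t.2.2)⟩ :
    Perm.Mat k (FinGSet.sigma fun j => (F.obj (N.X j)).set)
      (FinGSet.sigma fun i => (F.obj (M.X i)).set))

theorem matLiftMap_block {M N : Mat_ C} (f : M ⟶ N) (i : M.ι) (j : N.ι) :
    inj (fun i => F.obj (M.X i)) i ≫ matLiftMap F f ≫ proj (fun j => F.obj (N.X j)) j =
      F.map (f i j) := by
  refine hom_ext fun y x => ?_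
  rw [Perm.inj_comp_proj_apply]
  rfl

variable [F.Additive]

/-- The extension of an additive functor to the additive envelope. -/
def matLift : Mat_ C ⥤ Perm μ where
  obj M := Perm.sum fun i => F.obj (M.X i)
  map f := matLiftMap F f
  map_id M := by
    refine Perm.sum_hom_ext fun i j => ?_
    rw [matLiftMap_block, Category.id_comp]
    by_cases h : i = j
    · subst h
      rw [Mat_.id_apply_self, F.map_id, inj_proj_self]
    · rw [Mat_.id_apply_of_ne _ _ _ h, F.map_zero, inj_proj_ne _ h]
  map_comp {M N K} f g := by
    refine Perm.sum_hom_ext fun i l => ?_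
    rw [matLiftMap_block, Mat_.comp_apply, F.map_sum,
      comp_eq_sum (fun j => F.obj (N.X j)) (matLiftMap F f) (matLiftMap F g), Preadditive.sum_comp,
      Preadditive.comp_sum]
    refine Finset.sum_congr rfl fun j _ => ?_
    rw [F.map_comp, ← matLiftMap_block, ← matLiftMap_block]
    simp only [Category.assoc]

theorem matLiftMap_add {M N : Mat_ C} (f g : M ⟶ N) :
    matLiftMap F (f + g) = matLiftMap F f + matLiftMap F g := by
  refine Perm.sum_hom_ext fun i j => ?_
  rw [Preadditive.add_comp, Preadditive.comp_add, matLiftMap_block, matLiftMap_block,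
    matLiftMap_block]
  exact F.map_add

theorem matLiftMap_smul [Linear k C] [F.Linear k] {M N : Mat_ C} (r : k) (f : M ⟶ N) :
    matLiftMap F (r • f) = r • matLiftMap F f := by
  refine Perm.sum_hom_ext fun i j => ?_
  rw [Linear.smul_comp, Linear.comp_smul, matLiftMap_block, matLiftMap_block]
  exact F.map_smul r (f i j)

instance : (matLift F).Additive := ⟨matLiftMap_add F _ _⟩

instance [Linear k C] [F.Linear k] : (matLift F).Linear k := ⟨fun f r => matLiftMap_smul F r f⟩

end MatLift

/-! ### Tensor structure of the functor -/

section MonoidalFunctor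
open MulAction FinGSet Perm
universe w
variable {𝔛 : Type} [TopologicalSpace 𝔛] [IsCantorSpace 𝔛] {k : Type w} [CommRing k]
variable {μ : GMeasure (HomeoGroup 𝔛) k} (hμ : PushY μ)

/-- The functor from the additive envelope of the linearization of `WCat` to permutation modules. -/
def matFunctor : Mat_ (Free k WCat) ⥤ Perm μ := matLift (freeFunctor hμ)

instance : (matFunctor hμ).Additive := inferInstanceAs (matLift (freeFunctor hμ)).Additive
instance : (matFunctor hμ).Linear k := inferInstanceAs ((matLift (freeFunctor hμ)).Linear k)

/-- The underlying set of an object of the linearization of `WCat`. -/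
abbrev wSet (X : Free k WCat) : Type := WCat.A X

instance (X : Free k WCat) : Fintype (wSet X) := WCat.fintype X

variable (𝔛) in
/-- The disjoint union of the sets `Y(Aᵢ)`. -/
abbrev matSet (M : Mat_ (Free k WCat)) : FinGSet (HomeoGroup 𝔛) :=
  FinGSet.sigma fun i => setY 𝔛 (wSet (M.X i))

theorem matFunctor_map_apply {M N : Mat_ (Free k WCat)} (f : M ⟶ N) (i : M.ι) (j : N.ι)
    (ψ : setY 𝔛 (wSet (N.X j))) (φ : setY 𝔛 (wSet (M.X i))) :
    (mat ((matFunctor hμ).map f)).1 (⟨j, ψ⟩, ⟨i, φ⟩) =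
      entry hμ (X := M.X i) (Y := N.X j) ψ φ (f i j) := rfl

/-- The associators, unitors and braidings of the additive envelope all have this monomial form.
Their images are matrices of bijections, for which coherence can be checked on points. -/
theorem matFunctor_mono {M N : Mat_ (Free k WCat)} (σ : M.ι → N.ι)
    (e : ∀ i, wSet (M.X i) ≃ wSet (N.X (σ i))) (E : GEquiv (matSet 𝔛 M) (matSet 𝔛 N))
    (hE : ∀ i φ, E.e ⟨i, φ⟩ = ⟨σ i, mapY (e i) φ⟩) :
    (matFunctor hμ).map (mono σ fun i =>
      fsingle (C := WCat) (WCat.perm (X := M.X i) (Y := N.X (σ i)) (e i)) (1 : k)) =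
      (Perm.perm E : (Perm.vec (matSet 𝔛 M) : Perm μ) ⟶ Perm.vec (matSet 𝔛 N)) := by
  classical
  refine hom_ext ?_
  rintro ⟨j, ψ⟩ ⟨i, φ⟩
  refine (matFunctor_map_apply hμ _ i j ψ φ).trans ?_
  refine Eq.trans ?_ (if_congr (iff_of_eq (congrArg (fun t => (⟨j, ψ⟩ : matSet 𝔛 N) = t)
    (hE i φ).symm)) rfl rfl)
  by_cases h : σ i = j
  · subst h
    refine (congrArg (entry hμ (X := M.X i) (Y := N.X (σ i)) ψ φ) (mono_self σ _ i)).trans ?_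
    refine (entry_fsingle hμ (X := M.X i) (Y := N.X (σ i)) ψ φ _ 1).trans ((one_mul _).trans ?_)
    refine (relMat_perm (X := M.X i) (Y := N.X (σ i)) (e i) ψ φ).trans (if_congr ?_ rfl rfl)
    exact ⟨fun h => congrArg (Sigma.mk (σ i)) h, fun h => eq_of_heq (Sigma.mk.inj h).2⟩
  · refine (congrArg (entry hμ (X := M.X i) (Y := N.X j) ψ φ) (mono_ne σ _ h)).trans
      ((map_zero _).trans (if_neg fun e => h (congrArg Sigma.fst e).symm).symm)

/-- The compatibility of the disjoint unions of the sets `Y(Aᵢ)` with products. -/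
def matSetProd (M N : Mat_ (Free k WCat)) :
    GEquiv ((matSet 𝔛 M).prod (matSet 𝔛 N)) (matSet 𝔛 (M ⊗ N)) where
  e :=
    { toFun := fun t => ⟨(t.1.1, t.2.1), yv (pairLC (lc t.1.2) (lc t.2.2))⟩
      invFun := fun s => (⟨s.1.1, mapY Prod.fst s.2⟩, ⟨s.1.2, mapY Prod.snd s.2⟩)
      left_inv := fun _ => rfl
      right_inv := fun _ => rfl }
  map_smul _ _ := rfl

/-- The set `Y(pt)` is a point. -/
def matSetUnit : GEquiv (pt (HomeoGroup 𝔛)) (matSet 𝔛 (𝟙_ (Mat_ (Free k WCat)))) where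
  e :=
    { toFun := fun _ => ⟨(), yv (LocallyConstant.const 𝔛 ())⟩
      invFun := fun _ => ()
      left_inv := fun _ => rfl
      right_inv := fun _ => rfl }
  map_smul _ _ := rfl

/-- Naturality of the tensor constraint: by `entry_tensor`, the entry of a Kronecker product at a
pair of maps is the product of the entries. -/
theorem matFunctor_tensor {M N M' N' : Mat_ (Free k WCat)} (f : M ⟶ N) (f' : M' ⟶ N') :
    Perm.tensorMap ((matFunctor hμ).map f) ((matFunctor hμ).map f') ≫
      (Perm.perm (matSetProd N N') : Perm.tensor ((matFunctor hμ).obj N) ((matFunctor hμ).obj N') ⟶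
        (matFunctor hμ).obj (N ⊗ N')) =
      (Perm.perm (matSetProd M M') : Perm.tensor ((matFunctor hμ).obj M) ((matFunctor hμ).obj M') ⟶
        (matFunctor hμ).obj (M ⊗ M')) ≫ (matFunctor hμ).map (f ⊗ₘ f') := by
  refine hom_ext ?_
  rintro ⟨⟨j, j'⟩, ψ⟩ ⟨⟨i, φ⟩, ⟨i', φ'⟩⟩
  refine (comp_perm _ _ _ _).trans (Eq.trans ?_ (perm_comp _ _ _ _).symm)
  exact (entry_tensor hμ (X := M.X i) (Y := N.X j) (X' := M'.X i') (Y' := N'.X j') ψ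
    (yv (pairLC (lc φ) (lc φ'))) (f i j) (f' i' j')).symm

/-- The associator of `Mat_ (Free k WCat)` on the underlying sets. -/
def matSetAssoc (M N K : Mat_ (Free k WCat)) :
    GEquiv (matSet 𝔛 ((M ⊗ N) ⊗ K)) (matSet 𝔛 (M ⊗ (N ⊗ K))) where
  e :=
    { toFun := fun t => ⟨(t.1.1.1, (t.1.1.2, t.1.2)), mapY (Equiv.prodAssoc _ _ _) t.2⟩
      invFun := fun t => ⟨((t.1.1, t.1.2.1), t.1.2.2), mapY (Equiv.prodAssoc _ _ _).symm t.2⟩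
      left_inv := fun _ => rfl
      right_inv := fun _ => rfl }
  map_smul _ _ := rfl

/-- The left unitor of `Mat_ (Free k WCat)` on the underlying sets. -/
def matSetLeft (M : Mat_ (Free k WCat)) :
    GEquiv (matSet 𝔛 (𝟙_ (Mat_ (Free k WCat)) ⊗ M)) (matSet 𝔛 M) where
  e :=
    { toFun := fun t => ⟨t.1.2, mapY (Equiv.punitProd _) t.2⟩
      invFun := fun t => ⟨((), t.1), mapY (Equiv.punitProd _).symm t.2⟩
      left_inv := fun _ => rfl
      right_inv := fun _ => rfl }
  map_smul _ _ := rfl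

/-- The right unitor of `Mat_ (Free k WCat)` on the underlying sets. -/
def matSetRight (M : Mat_ (Free k WCat)) :
    GEquiv (matSet 𝔛 (M ⊗ 𝟙_ (Mat_ (Free k WCat)))) (matSet 𝔛 M) where
  e :=
    { toFun := fun t => ⟨t.1.1, mapY (Equiv.prodPUnit _) t.2⟩
      invFun := fun t => ⟨(t.1, ()), mapY (Equiv.prodPUnit _).symm t.2⟩
      left_inv := fun _ => rfl
      right_inv := fun _ => rfl }
  map_smul _ _ := rfl

/-- The braiding of `Mat_ (Free k WCat)` on the underlying sets. -/
def matSetSwap (M N : Mat_ (Free k WCat)) : GEquiv (matSet 𝔛 (M ⊗ N)) (matSet 𝔛 (N ⊗ M)) where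
  e :=
    { toFun := fun t => ⟨(t.1.2, t.1.1), mapY (Equiv.prodComm _ _) t.2⟩
      invFun := fun t => ⟨(t.1.2, t.1.1), mapY (Equiv.prodComm _ _).symm t.2⟩
      left_inv := fun _ => rfl
      right_inv := fun _ => rfl }
  map_smul _ _ := rfl

theorem matFunctor_associator (M N K : Mat_ (Free k WCat)) :
    (matFunctor hμ).map (α_ M N K).hom = (Perm.perm (matSetAssoc M N K) :
      (vec (matSet 𝔛 ((M ⊗ N) ⊗ K)) : Perm μ) ⟶ vec (matSet 𝔛 (M ⊗ (N ⊗ K)))) :=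
  matFunctor_mono hμ (M := (M ⊗ N) ⊗ K) (N := M ⊗ (N ⊗ K)) (fun p => (p.1.1, (p.1.2, p.2)))
    (fun _ => Equiv.prodAssoc _ _ _) (matSetAssoc M N K) fun _ _ => rfl

theorem matFunctor_leftUnitor (M : Mat_ (Free k WCat)) :
    (matFunctor hμ).map (λ_ M).hom = (Perm.perm (matSetLeft M) :
      (vec (matSet 𝔛 (𝟙_ _ ⊗ M)) : Perm μ) ⟶ vec (matSet 𝔛 M)) :=
  matFunctor_mono hμ (M := 𝟙_ _ ⊗ M) (N := M) (fun p => p.2)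
    (fun _ => Equiv.punitProd _) (matSetLeft M) fun _ _ => rfl

theorem matFunctor_rightUnitor (M : Mat_ (Free k WCat)) :
    (matFunctor hμ).map (ρ_ M).hom = (Perm.perm (matSetRight M) :
      (vec (matSet 𝔛 (M ⊗ 𝟙_ _)) : Perm μ) ⟶ vec (matSet 𝔛 M)) :=
  matFunctor_mono hμ (M := M ⊗ 𝟙_ _) (N := M) (fun p => p.1)
    (fun _ => Equiv.prodPUnit _) (matSetRight M) fun _ _ => rfl

theorem matFunctor_braiding (M N : Mat_ (Free k WCat)) :
    (matFunctor hμ).map (β_ M N).hom = (Perm.perm (matSetSwap M N) :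
      (vec (matSet 𝔛 (M ⊗ N)) : Perm μ) ⟶ vec (matSet 𝔛 (N ⊗ M))) :=
  matFunctor_mono hμ (M := M ⊗ N) (N := N ⊗ M) (fun p => (p.2, p.1))
    (fun _ => Equiv.prodComm _ _) (matSetSwap M N) fun _ _ => rfl

/-- The monoidal structure of the functor `matFunctor`. -/
def matFunctorCore : (matFunctor hμ).CoreMonoidal where
  εIso := permIso (X := vec (pt (HomeoGroup 𝔛))) (Y := vec (matSet 𝔛 (𝟙_ (Mat_ (Free k WCat)))))
    matSetUnit
  μIso M N := permIso (X := vec ((matSet 𝔛 M).prod (matSet 𝔛 N)))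
    (Y := vec (matSet 𝔛 (M ⊗ N))) (matSetProd M N)
  μIso_hom_natural_left f M := by
    have := matFunctor_tensor hμ f (𝟙 M)
    rw [(matFunctor hμ).map_id] at this
    exact this
  μIso_hom_natural_right M f := by
    have := matFunctor_tensor hμ (𝟙 M) f
    rw [(matFunctor hμ).map_id] at this
    exact this
  associativity M N K := by
    rw [matFunctor_associator]
    change tensorMap (X := vec ((matSet 𝔛 M).prod (matSet 𝔛 N))) (Y := vec (matSet 𝔛 (M ⊗ N)))
      (X' := vec (matSet 𝔛 K)) (Y' := vec (matSet 𝔛 K)) (perm _) (perm (GEquiv.refl _)) ≫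
      perm (X := vec ((matSet 𝔛 (M ⊗ N)).prod (matSet 𝔛 K))) (Y := vec (matSet 𝔛 ((M ⊗ N) ⊗ K))) _ ≫
      perm (Y := vec (matSet 𝔛 (M ⊗ (N ⊗ K)))) _ = perm (X := vec (((matSet 𝔛 M).prod (matSet 𝔛 N)).prod (matSet 𝔛 K)))
        (Y := vec ((matSet 𝔛 M).prod ((matSet 𝔛 N).prod (matSet 𝔛 K)))) (assocE _ _ _) ≫
      tensorMap (X := vec (matSet 𝔛 M)) (Y := vec (matSet 𝔛 M))
        (X' := vec ((matSet 𝔛 N).prod (matSet 𝔛 K))) (Y' := vec (matSet 𝔛 (N ⊗ K)))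
        (perm (GEquiv.refl _)) (perm _) ≫ perm (X := vec ((matSet 𝔛 M).prod (matSet 𝔛 (N ⊗ K))))
        (Y := vec (matSet 𝔛 (M ⊗ (N ⊗ K)))) _
    -- Every morphism is now the matrix of a bijection, and the two composite bijections agree by
    -- definition.
    rw [perm_tensorMap, perm_tensorMap, perm_perm, perm_perm, perm_perm, perm_perm]
    exact perm_congr fun _ => rfl
  left_unitality M := by
    rw [matFunctor_leftUnitor]
    change perm (X := vec ((pt _).prod (matSet 𝔛 M))) (Y := vec (matSet 𝔛 M)) _ =
      tensorMap (X := vec (pt _)) (Y := vec (matSet 𝔛 (𝟙_ (Mat_ (Free k WCat)))))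
        (X' := vec (matSet 𝔛 M)) (Y' := vec (matSet 𝔛 M)) (perm _) (perm (GEquiv.refl _)) ≫
        perm (X := vec ((matSet 𝔛 (𝟙_ (Mat_ (Free k WCat)))).prod (matSet 𝔛 M)))
          (Y := vec (matSet 𝔛 (𝟙_ _ ⊗ M))) _ ≫ perm _
    rw [perm_tensorMap, perm_perm, perm_perm]
    exact perm_congr fun _ => rfl
  right_unitality M := by
    rw [matFunctor_rightUnitor]
    change perm (X := vec ((matSet 𝔛 M).prod (pt _))) (Y := vec (matSet 𝔛 M)) _ =
      tensorMap (X := vec (matSet 𝔛 M)) (Y := vec (matSet 𝔛 M))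
        (X' := vec (pt _)) (Y' := vec (matSet 𝔛 (𝟙_ (Mat_ (Free k WCat)))))
        (perm (GEquiv.refl _)) (perm _) ≫
        perm (X := vec ((matSet 𝔛 M).prod (matSet 𝔛 (𝟙_ (Mat_ (Free k WCat))))))
          (Y := vec (matSet 𝔛 (M ⊗ 𝟙_ _))) _ ≫ perm _
    rw [perm_tensorMap, perm_perm, perm_perm]
    exact perm_congr fun _ => rfl

instance matFunctorMonoidal : (matFunctor hμ).Monoidal := (matFunctorCore hμ).toMonoidal

instance matFunctorBraided : (matFunctor hμ).Braided where
  braided M N := by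
    rw [matFunctor_braiding]
    change perm (X := vec ((matSet 𝔛 M).prod (matSet 𝔛 N))) (Y := vec (matSet 𝔛 (M ⊗ N))) _ ≫
      perm (Y := vec (matSet 𝔛 (N ⊗ M))) _ =
      perm (X := vec ((matSet 𝔛 M).prod (matSet 𝔛 N)))
        (Y := vec ((matSet 𝔛 N).prod (matSet 𝔛 M))) (swapE _ _) ≫
      perm (Y := vec (matSet 𝔛 (N ⊗ M))) _
    rw [perm_perm, perm_perm]
    exact perm_congr fun _ => rfl

end MonoidalFunctor
end CantorPerm
end

noncomputable section
namespace CantorPerm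
set_option linter.unusedSectionVars false
-- Inversion of sums over supersets
section UpperSums
universe w
variable {k : Type w} [Field k] {D : Type} [Fintype D] [DecidableEq D]

/-- The sums of a function on the finite subsets over the supersets of a subset. -/
def upperSum (k : Type w) [Field k] (D : Type) [Fintype D] [DecidableEq D] :
    (Finset D → k) →ₗ[k] (Finset D → k) where
  toFun c S := ∑ R : Finset D, if S ⊆ R then c R else 0
  map_add' c c' := funext fun S => by
    change (∑ R, if S ⊆ R then c R + c' R else 0) =
      (∑ R, if S ⊆ R then c R else 0) + ∑ R, if S ⊆ R then c' R else 0
    rw [← Finset.sum_add_distrib]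
    exact Finset.sum_congr rfl fun R _ => by split_ifs <;> simp
  map_smul' r c := funext fun S => by
    change (∑ R, if S ⊆ R then r * c R else 0) = r * ∑ R, if S ⊆ R then c R else 0
    rw [Finset.mul_sum]
    exact Finset.sum_congr rfl fun R _ => by split_ifs <;> simp

/-- The system is triangular for inclusion. By induction from the larger sets down, only the term at
`S` is left; `P` is closed upwards so that the induction stays inside it. -/
theorem eq_zero_of_upperSum_eq_zero (P : Finset D → Prop) (hP : ∀ S R, P S → S ⊆ R → P R)
    (c : Finset D → k) (h : ∀ S, P S → upperSum k D c S = 0) (S : Finset D) : P S → c S = 0 := by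
  induction S using WellFoundedGT.induction with | ind S ih =>
  intro hS
  have h1 : ∑ R : Finset D, (if S ⊆ R then c R else 0) = 0 := h S hS
  rw [Finset.sum_eq_single S, if_pos (Finset.Subset.refl S)] at h1
  · exact h1
  · intro R _ hR
    split_ifs with h2
    · exact ih R (lt_of_le_of_ne h2 hR.symm) (hP S R hS h2)
    · rfl
  · simp

/-- An injective endomorphism of a finite-dimensional space is surjective. -/
theorem upperSum_surjective : Function.Surjective (upperSum k D) :=
  LinearMap.injective_iff_surjective.1 ((injective_iff_map_eq_zero _).2 fun c hc => funext fun S =>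
    eq_zero_of_upperSum_eq_zero (fun _ => True) (fun _ _ _ _ => trivial) c
      (fun S _ => congrFun hc S) S trivial)

end UpperSums

/-! ### Fullness and kernel of the functor -/

section Full
open MulAction FinGSet Perm
universe w
variable {𝔛 : Type} [TopologicalSpace 𝔛] [IsCantorSpace 𝔛] {k : Type w} [Field k]
variable {μ : GMeasure (HomeoGroup 𝔛) k} (hμ : PushY μ)

open scoped Classical in
/-- The morphism of `WCat` whose matrix has its ones at a given set of places. -/
def ofSupport {X Y : WCat} (S : Finset (Y.A × X.A)) : X ⟶ Y :=
  WCat.mk fun b a => if (b, a) ∈ S then 1 else 0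

theorem ofSupport_eq_one {X Y : WCat} (S : Finset (Y.A × X.A)) (b : Y.A) (a : X.A) :
    WCat.mat (ofSupport S) b a = 1 ↔ (b, a) ∈ S := by
  classical
  change (if (b, a) ∈ S then (1 : BoolSemiring) else 0) = 1 ↔ _
  by_cases h : (b, a) ∈ S
  · rw [if_pos h]
    exact iff_of_true rfl h
  · rw [if_neg h]
    exact iff_of_false BoolSemiring.zero_ne_one h

theorem exists_ofSupport {X Y : WCat} (R : X ⟶ Y) : ∃ S, ofSupport S = R := by
  classical
  refine ⟨Finset.univ.filter fun p => WCat.mat R p.1 p.2 = 1, Matrix.ext fun b a => ?_⟩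
  by_cases h : WCat.mat R b a = 1
  · exact ((ofSupport_eq_one _ b a).2 (by simpa using h)).trans h.symm
  · refine (BoolSemiring.eq_zero_iff.2 fun h' => h ?_).trans (BoolSemiring.eq_zero_iff.2 h).symm
    simpa using (ofSupport_eq_one _ b a).1 h'

theorem ofSupport_empty (X Y : WCat) : (ofSupport ∅ : X ⟶ Y) = WCat.zero X Y := by
  classical
  refine Matrix.ext fun b a => ?_
  change (if (b, a) ∈ (∅ : Finset (Y.A × X.A)) then (1 : BoolSemiring) else 0) = 0
  exact if_neg (Finset.notMem_empty _)

/-- The linear combination of the matrices with given coefficients. -/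
def combination {X Y : WCat} (c : Finset (Y.A × X.A) → k) : Free.of k X ⟶ Free.of k Y :=
  ∑ S, fsingle (ofSupport S) (c S)

theorem exists_combination {X Y : WCat} (f : Free.of k X ⟶ Free.of k Y) :
    ∃ c, combination c = f := by
  classical
  induction f using free_induction with
  | h0 => exact ⟨0, Finset.sum_eq_zero fun S _ => Finsupp.single_zero _⟩
  | ha f g hf hg =>
    obtain ⟨c, rfl⟩ := hf
    obtain ⟨d, rfl⟩ := hg
    exact ⟨c + d, (Finset.sum_congr rfl fun S _ => Finsupp.single_add _ _ _).trans
      Finset.sum_add_distrib⟩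
  | hs R r =>
    obtain ⟨S, rfl⟩ := exists_ofSupport R
    refine ⟨Pi.single S r, (Finset.sum_eq_single S (fun T _ hT => ?_) (by simp)).trans
      (by rw [Pi.single_eq_same])⟩
    rw [Pi.single_eq_of_ne hT]
    exact Finsupp.single_zero _

/-- A matrix with support `S` has entry `1` at `(ψ, φ)` exactly when the pair takes its values in
`S`, so the contributing supports are those that contain its joint image. -/
theorem entry_combination {X Y : WCat} [DecidableEq (Y.A × X.A)] (ψ : setY 𝔛 Y.A)
    (φ : setY 𝔛 X.A) (c : Finset (Y.A × X.A) → k) : entry hμ ψ φ (combination c) =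
      upperSum k _ c (img (pairLC (lc ψ) (lc φ))) := by
  classical
  rw [combination, map_sum]
  refine Finset.sum_congr rfl fun S _ => ?_
  rw [entry_fsingle]
  have : (∀ x, WCat.mat (ofSupport (X := X) (Y := Y) S) (lc ψ x) (lc φ x) = 1) ↔
      img (pairLC (lc ψ) (lc φ)) ⊆ S := by
    simp only [ofSupport_eq_one, Finset.subset_iff, mem_img]
    exact ⟨fun h p ⟨x, hx⟩ => hx ▸ h x, fun h x => h ⟨x, rfl⟩⟩
  refine (congrArg (fun t => c S * t) (if_congr this rfl rfl)).trans ?_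
  split_ifs <;> simp

/-- An invariant function of pairs depends only on the joint image, a non-empty subset of `Y.A ×
X.A`; the coefficients are found by inverting the triangular system. -/
theorem exists_entry_eq {X Y : WCat} (A : Perm.Mat k (setY 𝔛 Y.A) (setY 𝔛 X.A)) :
    ∃ f : Free.of k X ⟶ Free.of k Y, ∀ ψ φ, entry hμ ψ φ f = A.1 (ψ, φ) := by
  classical
  -- No pair has an empty joint image, so the value at the empty set is a free choice.
  let H : Finset (Y.A × X.A) → k := fun S => if h : S.Nonempty then
    A.1 (splitY _ _ (yv (exists_img_eq (𝔛 := 𝔛) h).choose)) else 0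
  obtain ⟨c, hc⟩ := upperSum_surjective H
  refine ⟨combination c, fun ψ φ => ?_⟩
  rw [entry_combination, hc]
  have hne := img_nonempty (pairLC (lc ψ) (lc φ))
  obtain ⟨g, hg⟩ := exists_smul_of_img_eq (ρ := yv (pairLC (lc ψ) (lc φ)))
    (ρ' := yv (exists_img_eq (𝔛 := 𝔛) hne).choose) (exists_img_eq hne).choose_spec.symm
  refine (dif_pos hne).trans ?_
  rw [← hg, map_smul]
  exact A.2 g _

/-- Triangularity kills the coefficients of all non-empty supports. The coefficient of the empty
support, that is, of the zero matrix, is invisible to the functor. -/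
theorem eq_fsingle_zero {X Y : WCat} (f : Free.of k X ⟶ Free.of k Y)
    (hf : ∀ ψ φ, entry hμ ψ φ f = 0) : ∃ r, f = fsingle (WCat.zero X Y) r := by
  classical
  obtain ⟨c, rfl⟩ := exists_combination f
  have h := eq_zero_of_upperSum_eq_zero Finset.Nonempty (fun _ _ h h' => h.mono h') c
    fun S hS => by
      obtain ⟨ρ, rfl⟩ := exists_img_eq (𝔛 := 𝔛) hS
      have := hf (mapY Prod.fst (yv ρ)) (mapY Prod.snd (yv ρ))
      rwa [entry_combination] at this
  refine ⟨c ∅, (Finset.sum_eq_single ∅ (fun S _ hS => ?_) (by simp)).trans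
    (by rw [ofSupport_empty])⟩
  rw [h S (Finset.nonempty_iff_ne_empty.2 hS)]
  exact Finsupp.single_zero _

theorem matFunctor_full {M N : Mat_ (Free k WCat)}
    (g : (matFunctor hμ).obj M ⟶ (matFunctor hμ).obj N) : ∃ f, (matFunctor hμ).map f = g := by
  have h : ∀ i j, ∃ f : M.X i ⟶ N.X j, ∀ ψ φ, entry hμ (X := M.X i) (Y := N.X j) ψ φ f =
      (mat g).1 (⟨j, ψ⟩, ⟨i, φ⟩) := fun i j =>
    exists_entry_eq hμ (X := M.X i) (Y := N.X j)
      ⟨fun t => (mat g).1 (⟨j, t.1⟩, ⟨i, t.2⟩), fun a t => (mat g).2 a (⟨j, t.1⟩, ⟨i, t.2⟩)⟩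
  choose f hf using h
  refine ⟨matMk f, hom_ext ?_⟩
  rintro ⟨j, ψ⟩ ⟨i, φ⟩
  exact hf i j ψ φ

theorem fsingle_zero_comp {X Y : WCat} (r : k) :
    fsingle (WCat.zero X X) (1 : k) ≫ fsingle (WCat.zero X Y) r = fsingle (WCat.zero X Y) r := by
  rw [fsingle_comp, WCat.zero_comp, one_mul]

/-- Every entry is a multiple of a zero matrix, on which composition with `[0]` is the identity. So
`1 - [0]` cuts away all of the kernel. -/
theorem matFunctor_kernel {M N : Mat_ (Free k WCat)} (f : M ⟶ N)
    (hf : (matFunctor hμ).map f = 0) : zeroMat M ≫ f = f := by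
  refine Mat_.hom_ext _ _ fun i j => ?_
  obtain ⟨r, hr⟩ := eq_fsingle_zero hμ (X := M.X i) (Y := N.X j) (f i j) fun ψ φ =>
    congrArg (fun A => (mat (X := vec (matSet 𝔛 M)) (Y := vec (matSet 𝔛 N)) A).1
      ((⟨j, ψ⟩ : matSet 𝔛 N), (⟨i, φ⟩ : matSet 𝔛 M))) hf
  refine (mono_comp_apply _ _ _ _ _).trans ?_
  have := fsingle_zero_comp (X := M.X i) (Y := N.X j) r
  exact (congrArg (fun t => zeroFree (M.X i) ≫ t) hr).trans (this.trans hr.symm)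

/-- The Cantor space is not empty, so no pair of maps is related at every point by the zero matrix.
-/
theorem matFunctor_zeroMat (M : Mat_ (Free k WCat)) : (matFunctor hμ).map (zeroMat M) = 0 := by
  refine hom_ext ?_
  rintro ⟨j, ψ⟩ ⟨i, φ⟩
  refine (matFunctor_map_apply hμ _ i j ψ φ).trans ?_
  by_cases h : i = j
  · subst h
    refine (congrArg (entry hμ (X := M.X i) (Y := M.X i) ψ φ)
      (mono_self (fun i => i) _ i)).trans ?_
    refine (entry_fsingle hμ (X := M.X i) (Y := M.X i) ψ φ _ 1).trans ((one_mul _).trans ?_)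
    refine if_neg fun h => ?_
    obtain ⟨x⟩ := nonempty_cantor 𝔛
    exact BoolSemiring.zero_ne_one (h x)
  · exact (congrArg (entry hμ (X := M.X i) (Y := M.X j) ψ φ) (mono_ne (fun i => i) _ h)).trans
      (map_zero _)

end Full
end CantorPerm
end

noncomputable section
namespace CantorPerm
set_option linter.unusedSectionVars false
-- Sections of covers in the category of permutation modules
section Retracts
open MulAction FinGSet Perm
universe w
variable {G : Type} [Group G] [TopologicalSpace G] [RoelckePrecompact G]
variable {k : Type w} [Field k] (μ : GMeasure G k)

/-- The assumption says that a single orbit lies over that of `f x`, so the push-forward has a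
single term. -/
theorem GMeasure.push_one_eq_orbVal {X Y : FinGSet G} (f : X →[G] Y) (x : X)
    (h : ∀ x', f x' ∈ Y.orb (f x) → x' ∈ X.orb x) :
    μ.push f (fun _ => 1) (f x) = μ.orbVal f x := by
  classical
  refine Eq.trans (orbSum_congr fun z => ?_) (orbSum_ite (μ.orbVal_inv f) x)
  rw [one_mul]
  refine if_congr ⟨fun hz => ?_, map_mem_orb f⟩ rfl rfl
  exact mem_orb_symm.1 (h z (mem_orb_symm.1 hz))

theorem GMeasure.Regular.isUnit_orbVal {μ : GMeasure G k} (h : μ.Regular) {X Y : FinGSet G}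
    (f : X →[G] Y) (x : X) : IsUnit (μ.orbVal f x) :=
  h _ _ (orb_transitive X x) (orb_transitive Y (f x)) (orbMap f x)

theorem GMeasure.Regular.map {k' : Type*} [CommRing k'] {μ : GMeasure G k} (h : μ.Regular)
    (φ : k →+* k') : (μ.map φ).Regular := fun X Y hX hY f => (h X Y hX hY f).map φ

/-- The integrand lives on the triples `(f e, e, f e)`, a copy of `E`, on which `p₁₃` is `f`
followed by the diagonal. The product is therefore diagonal, with entries given by the push-forward
along `f`. -/
theorem mapMat_matMul_comapMat {E X : FinGSet G} (f : E →[G] X) (u : InvFun k X) (y x : X)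
    [Decidable (y = x)] : (matMul μ (mapMat f) (comapMat f u)).1 (y, x) =
      if y = x then μ.push f (fun _ => 1) x * u.1 x else 0 := by
  classical
  let s : E →[G] X.prod (E.prod X) := ⟨fun e => (f e, e, f e), fun g e =>
    Prod.ext (map_smul f g e) (Prod.ext rfl (map_smul f g e))⟩
  have hs : Function.Injective s := fun a b h => congrArg (fun t => t.2.1) h
  let δ : X →[G] X.prod X := ⟨fun x => (x, x), fun _ _ => rfl⟩
  have hδ : Function.Injective δ := fun a b h => congrArg Prod.fst h
  let v : E → k := fun e => u.1 (f e)
  have hv : Inv v := Inv.comp u.2 f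
  have h1 : ∀ t, (matProd (mapMat f) (comapMat f u)).1 t = μ.push s v t := by
    rintro ⟨y, e, x⟩
    by_cases h : y = f e ∧ x = f e
    · obtain ⟨rfl, rfl⟩ := h
      exact ((congrArg₂ (· * ·) (if_pos rfl) (if_pos rfl)).trans (one_mul _)).trans
        (μ.push_injective_apply s hs hv e).symm
    · refine Eq.trans ?_ (μ.push_of_notMem s v _ fun e' he => ?_).symm
      · change ite _ _ _ * ite _ _ _ = _
        split_ifs with h1 h2
        · exact absurd ⟨h1, h2⟩ h
        all_goals simp
      · have e1 : e' = e := congrArg (fun t => t.2.1) he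
        subst e1
        exact h ⟨(congrArg Prod.fst he).symm, (congrArg (fun t => t.2.2) he).symm⟩
  refine (μ.push_congr _ h1 _).trans ((μ.push_comp _ _ _ _).trans ?_)
  refine Eq.trans (μ.push_comp f δ v (y, x)).symm ?_
  have h2 : ∀ x, μ.push f v x = μ.push f (fun _ => 1) x * u.1 x := fun x =>
    (μ.push_congr f (fun e => (one_mul (v e)).symm) x).trans (μ.push_projection f _ u.2 x)
  by_cases h : y = x
  · subst h
    rw [if_pos rfl, ← h2]
    exact μ.push_injective_apply δ hδ (μ.push_inv f v) y
  · rw [if_neg h]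
    refine μ.push_of_notMem δ _ _ fun z hz => h ?_
    exact (congrArg Prod.fst hz).symm.trans (congrArg Prod.snd hz)

variable {μ}

/-- The section is the transpose of the graph of `f`, divided by the push-forward of `1`. -/
theorem Perm.exists_section {E X : Perm μ} (f : E.set →[G] X.set)
    (h : ∀ x, IsUnit (μ.push f (fun _ => 1) x)) : ∃ i : X ⟶ E, i ≫ ofMap f = 𝟙 X := by
  classical
  let u : InvFun k X.set := ⟨fun x => (μ.push f (fun _ => 1) x)⁻¹, fun g x =>
    congrArg _ (μ.push_inv f _ g x)⟩
  refine ⟨(comapMat f u : Mat k E.set X.set), hom_ext fun y x => ?_⟩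
  refine (mapMat_matMul_comapMat μ f u y x).trans (if_congr Iff.rfl ?_ rfl)
  exact mul_inv_cancel₀ (h x).ne_zero

end Retracts

/-! ### Permutation modules as retracts of sums of `Vec_{Y(A)}` -/

section EssSurj
open MulAction FinGSet Perm Idempotents
universe w
variable {𝔛 : Type} [TopologicalSpace 𝔛] [IsCantorSpace 𝔛] {k : Type w} [Field k]
variable {μ : GMeasure (HomeoGroup 𝔛) k} (hμ : PushY μ)

/-- Each orbit of `X` is covered by some `X(n)`. By regularity the push-forward of `1` along these
covers is invertible, so `Vec_X` is a retract of the module of their disjoint union. As `X(n)` is a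
stable subset of `Y(n)`, that module is in turn a summand of an object in the image of the functor.
-/
theorem exists_retract (hr : μ.Regular) (X : FinGSet (HomeoGroup 𝔛)) :
    ∃ (M : Mat_ (Free k WCat)) (i : (vec X : Perm μ) ⟶ (matFunctor hμ).obj M)
      (r : (matFunctor hμ).obj M ⟶ vec X), i ≫ r = 𝟙 _ := by
  classical
  have c := fun q : orbitRel.Quotient (HomeoGroup 𝔛) X => (exists_exactCover q.out).some
  let V := fun q : orbitRel.Quotient (HomeoGroup 𝔛) X =>
    (setY 𝔛 (Fin (c q).n)).sub (subX 𝔛 (Fin (c q).n))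
  let M : Mat_ (Free k WCat) := ⟨orbitRel.Quotient (HomeoGroup 𝔛) X, fun q =>
    Free.of k (WCat.of (Fin (c q).n))⟩
  let f : FinGSet.sigma V →[HomeoGroup 𝔛] X :=
    ⟨fun t => (c t.1).q t.2, fun g t => map_smul (c t.1).q g t.2⟩
  let j : FinGSet.sigma V →[HomeoGroup 𝔛] matSet 𝔛 M := ⟨fun t => ⟨t.1, t.2.1⟩, fun _ _ => rfl⟩
  have hj : Function.Injective j := by
    rintro ⟨q, x⟩ ⟨q', x'⟩ h
    obtain rfl : q = q' := congrArg Sigma.fst h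
    exact congrArg (Sigma.mk q) (Subtype.ext (eq_of_heq (Sigma.mk.inj h).2))
  have htr : ∀ q (a b : V q), ∃ g : HomeoGroup 𝔛, g • a = b := fun q a b =>
    (c q).transitive.2.exists_smul_eq a b
  have hq : ∀ t, f t ∈ X.orb t.1.out := by
    rintro ⟨q, x⟩
    obtain ⟨g, rfl⟩ := htr q ⟨yv (c q).φ, (c q).surj⟩ x
    exact ⟨g, ((map_smul (c q).q g _).trans (congrArg (fun t => g • t) (c q).q_apply)).symm⟩
  -- A single orbit of the cover lies over each orbit of `X`, so `GMeasure.push_one_eq_orbVal`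
  -- applies.
  have hf : ∀ t t', f t' ∈ X.orb (f t) → t' ∈ (FinGSet.sigma V).orb t := by
    intro t t' h
    have e1 := (mem_orb_out t.1 (f t')).1 (by rw [← orb_eq (hq t)]; exact h)
    have e2 := (mem_orb_out t'.1 (f t')).1 (hq t')
    obtain ⟨q, x⟩ := t
    obtain ⟨q', x'⟩ := t'
    obtain rfl : q = q' := e1.trans e2.symm
    obtain ⟨g, hg⟩ := htr q x x'
    exact ⟨g, congrArg (Sigma.mk q) hg⟩
  have hs : ∀ x, ∃ t, f t = x := by
    intro x
    obtain ⟨g, hg⟩ := (mem_orb_out (Quotient.mk'' x : orbitRel.Quotient (HomeoGroup 𝔛) X) x).2 rfl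
    let t : FinGSet.sigma V := ⟨Quotient.mk'' x, ⟨yv (c _).φ, (c _).surj⟩⟩
    exact ⟨g • t, (map_smul f g t).trans ((congrArg (fun s => g • s) (c _).q_apply).trans hg)⟩
  obtain ⟨i, hi⟩ := Perm.exists_section (μ := μ) (E := vec (FinGSet.sigma V)) (X := vec X) f
    fun x => by
      obtain ⟨t, rfl⟩ := hs x
      rw [μ.push_one_eq_orbVal f t (hf t)]
      exact hr.isUnit_orbVal f t
  refine ⟨M, i ≫ ofMap (X := vec (FinGSet.sigma V)) (Y := vec (matSet 𝔛 M)) j,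
    ofComap (X := vec (FinGSet.sigma V)) (Y := vec (matSet 𝔛 M)) j ≫
      ofMap (X := vec (FinGSet.sigma V)) (Y := vec X) f, ?_⟩
  have h2 := ofMap_comp_ofComap_self (X := (vec (FinGSet.sigma V) : Perm μ))
    (Y := vec (matSet 𝔛 M)) hj
  refine (Category.assoc _ _ _).trans ((congrArg (fun t => i ≫ t)
    ((Category.assoc _ _ _).symm.trans ((congrArg (fun t => t ≫ _) h2).trans
      (Category.id_comp _)))).trans hi)

end EssSurj

/-! ### The equivalence of tensor categories -/

section Equivalence
open MulAction FinGSet Perm Idempotents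
universe w
variable {𝔛 : Type} [TopologicalSpace 𝔛] [IsCantorSpace 𝔛] {k : Type w} [Field k]
variable {μ : GMeasure (HomeoGroup 𝔛) k} (hμ : PushY μ)

/-- The functor from `k[W]^♯₁` to the Karoubi envelope of the permutation modules. -/
def oneFunctor : WSharpOne k ⥤ Karoubi (Perm μ) := (IsOne k).ι ⋙ karMap (matFunctor hμ)

theorem matFunctor_one_sub_zeroMat (M : Mat_ (Free k WCat)) :
    (matFunctor hμ).map (𝟙 M - zeroMat M) = 𝟙 _ := by
  rw [Functor.map_sub, matFunctor_zeroMat, sub_zero, CategoryTheory.Functor.map_id]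

theorem isIso_karMap_map {C D : Type*} [Category C] [Category D] (F : C ⥤ D) {P Q : Karoubi C}
    (f : P ⟶ Q) (g : Q ⟶ P) (h : F.map (f.f ≫ g.f) = F.map P.p)
    (h' : F.map (g.f ≫ f.f) = F.map Q.p) : IsIso ((karMap F).map f) :=
  ⟨(karMap F).map g, Karoubi.hom_ext _ _ ((F.map_comp _ _).symm.trans h),
    Karoubi.hom_ext _ _ ((F.map_comp _ _).symm.trans h')⟩

variable (k) in
/-- The projection of the unit object of `k[W]^♯` onto that of `k[W]^♯₁`. -/
def oneProj : 𝟙_ (WSharp k) ⟶ (onePart (𝟙_ (WSharp k))).obj :=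
  ⟨(onePart (𝟙_ (WSharp k))).obj.p, by
    have h : (𝟙_ (WSharp k)).p ≫ (onePart (𝟙_ (WSharp k))).obj.p =
        (onePart (𝟙_ (WSharp k))).obj.p := Category.id_comp _
    exact (congrArg (fun t => (𝟙_ (WSharp k)).p ≫ t)
      (Karoubi.idem (onePart (𝟙_ (WSharp k))).obj)).trans h⟩

/-- The functor kills `[0]`, so it inverts the inclusion of the image of `1 - [0]` into the unit.
This makes the restricted functor monoidal. -/
instance : IsIso ((karMap (matFunctor hμ)).map (oneUnit k).j) := by
  have h := Karoubi.idem (onePart (𝟙_ (WSharp k))).obj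
  refine isIso_karMap_map (matFunctor hμ) (oneIncl k) (oneProj k) (congrArg _ h)
    ((congrArg _ (h.trans (oneIncl_f (k := k)))).trans ?_)
  exact (matFunctor_one_sub_zeroMat hμ _).trans ((matFunctor hμ).map_id _).symm

instance oneFunctorBraided : (oneFunctor hμ).Braided :=
  (oneUnit k).functorBraided (karMap (matFunctor hμ))

instance : (oneFunctor hμ).Additive :=
  ⟨fun {_ _ f g} => Karoubi.hom_ext _ _ ((matFunctor hμ).map_add (f := f.hom.f) (g := g.hom.f))⟩

instance : (oneFunctor hμ).Linear k :=
  ⟨fun f r => Karoubi.hom_ext _ _ ((matFunctor hμ).map_smul r f.hom.f)⟩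

/-- The difference is in the kernel, hence unchanged by composition with `[0]`, whereas `[0]`
vanishes on `X`. -/
theorem IsOne.eq_of_map_eq {X Y : WSharp k} (hX : IsOne k X) {f g : X ⟶ Y}
    (h : (matFunctor hμ).map f.f = (matFunctor hμ).map g.f) : f = g := by
  have h1 : zeroMat X.X ≫ (f.f - g.f) = f.f - g.f := matFunctor_kernel hμ _
    (((matFunctor hμ).map_sub).trans (sub_eq_zero.2 h))
  have h2 : X.p ≫ (f.f - g.f) = f.f - g.f := by
    rw [Preadditive.comp_sub, Karoubi.p_comp, Karoubi.p_comp]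
  refine Karoubi.hom_ext _ _ (sub_eq_zero.1 ?_)
  rw [← h2, ← h1, ← Category.assoc, (isOne_iff _).1 hX, Limits.zero_comp]

instance : (oneFunctor hμ).Faithful :=
  ⟨fun {X _} _ _ h => ObjectProperty.hom_ext _
    (IsOne.eq_of_map_eq hμ X.property (congrArg Karoubi.Hom.f h))⟩

instance : (oneFunctor hμ).Full where
  map_surjective {X Y} g := by
    obtain ⟨h, hh⟩ := matFunctor_full hμ g.f
    refine ⟨ObjectProperty.homMk ⟨X.obj.p ≫ h ≫ Y.obj.p, by simp⟩, Karoubi.hom_ext _ _ ?_⟩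
    change (matFunctor hμ).map (X.obj.p ≫ h ≫ Y.obj.p) = g.f
    rw [Functor.map_comp, Functor.map_comp, hh]
    exact g.comm

/-- An object of the target is an idempotent on a retract of an object in the image of `matFunctor`.
By fullness this idempotent lifts to some `h`, and `h² - h` is in the kernel. Composition with the
central idempotent `1 - [0]` removes the error and also makes `[0]` vanish. -/
theorem oneFunctor_essSurj (hr : μ.Regular) : (oneFunctor hμ).EssSurj where
  mem_essImage Q := by
    obtain ⟨M, i, r, hir⟩ := exists_retract hμ hr Q.X.set
    have hir : i ≫ r = 𝟙 Q.X := hir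
    obtain ⟨h, hh⟩ := matFunctor_full hμ (r ≫ Q.p ≫ i)
    have e1 : (matFunctor hμ).map (h ≫ h - h) = 0 := by
      rw [Functor.map_sub, Functor.map_comp, hh]
      simp only [Category.assoc]
      rw [reassoc_of% hir, Karoubi.idem_assoc, sub_self]
    have e2 := matFunctor_kernel hμ _ e1
    have e3 : (𝟙 M - zeroMat M) ≫ h ≫ h = (𝟙 M - zeroMat M) ≫ h := by
      rw [← sub_eq_zero, ← Preadditive.comp_sub, Preadditive.sub_comp, e2, Category.id_comp,
        sub_self]
    have e4 : h ≫ (𝟙 M - zeroMat M) = (𝟙 M - zeroMat M) ≫ h := by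
      rw [Preadditive.sub_comp, Preadditive.comp_sub, zeroMat_comm, Category.id_comp,
        Category.comp_id]
    have e5 : (𝟙 M - zeroMat M) ≫ zeroMat M = 0 := by
      rw [Preadditive.sub_comp, zeroMat_idem, Category.id_comp, sub_self]
    have e6 : (𝟙 M - zeroMat M) ≫ (𝟙 M - zeroMat M) = 𝟙 M - zeroMat M := by
      rw [Preadditive.comp_sub, e5, sub_zero, Category.comp_id]
    let p := (𝟙 M - zeroMat M) ≫ h
    have hp : p ≫ p = p := by
      change ((𝟙 M - zeroMat M) ≫ h) ≫ (𝟙 M - zeroMat M) ≫ h = (𝟙 M - zeroMat M) ≫ h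
      rw [Category.assoc, reassoc_of% e4, reassoc_of% e6, e3]
    have hp0 : p ≫ zeroMat M = 0 := by
      change ((𝟙 M - zeroMat M) ≫ h) ≫ zeroMat M = 0
      rw [Category.assoc, ← zeroMat_comm, reassoc_of% e5, Limits.zero_comp]
    have hF : (matFunctor hμ).map p = r ≫ Q.p ≫ i := by
      rw [Functor.map_comp, matFunctor_one_sub_zeroMat, hh, Category.id_comp]
    let P : WSharpOne k := ⟨⟨M, p, hp⟩, (isOne_iff _).2 hp0⟩
    -- The retraction and its section, cut down by `Q.p`, are mutually inverse between the image of
    -- `p` and `Q`.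
    refine ⟨P, ⟨⟨⟨r ≫ Q.p, ?_⟩, ⟨Q.p ≫ i, ?_⟩, ?_, ?_⟩⟩⟩
    · change (matFunctor hμ).map p ≫ (r ≫ Q.p) ≫ Q.p = r ≫ Q.p
      rw [hF]
      simp only [Category.assoc]
      rw [reassoc_of% hir, Karoubi.idem_assoc, Karoubi.idem]
    · change Q.p ≫ (Q.p ≫ i) ≫ (matFunctor hμ).map p = Q.p ≫ i
      rw [hF]
      simp only [Category.assoc]
      rw [reassoc_of% hir, Karoubi.idem_assoc, Karoubi.idem_assoc]
    · refine Karoubi.hom_ext _ _ (Eq.trans ?_ hF.symm)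
      change (r ≫ Q.p) ≫ (Q.p ≫ i) = r ≫ Q.p ≫ i
      rw [Category.assoc, Karoubi.idem_assoc]
    · refine Karoubi.hom_ext _ _ ?_
      change (Q.p ≫ i) ≫ (r ≫ Q.p) = Q.p
      rw [Category.assoc, reassoc_of% hir, Karoubi.idem]

theorem oneFunctor_isEquivalence (hr : μ.Regular) : (oneFunctor hμ).IsEquivalence :=
  have := oneFunctor_essSurj hμ hr
  ⟨inferInstance, inferInstance, this⟩

/-- The images of the objects `[W(A)]₁`. -/
def oneFunctorObj (A : Type) [Fintype A] :
    (oneFunctor hμ).obj (objWOne k A) ≅ (toKaroubi (Perm μ)).obj (vec (setY 𝔛 A)) := by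
  refine karIso (permIso (X := vec (matSet 𝔛 ((Mat_.embedding _).obj (Free.of k (WCat.of A)))))
    (Y := vec (setY 𝔛 A)) ⟨⟨fun t => t.2, fun x => ⟨⟨⟩, x⟩, fun _ => rfl, fun _ => rfl⟩,
      fun _ _ => rfl⟩) ?_
  have h : (matFunctor hμ).map (objWOne k A).obj.p = 𝟙 _ := by
    change (matFunctor hμ).map (𝟙 _ ≫ (𝟙 _ - zeroMat _)) = 𝟙 _
    rw [Category.id_comp]
    exact matFunctor_one_sub_zeroMat hμ _
  exact ((congrArg (fun t => t ≫ _) h).trans (Category.id_comp _)).trans (Category.comp_id _).symm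

theorem hasFiniteBiproducts_karoubi_perm {G : Type} [Group G] [TopologicalSpace G]
    [RoelckePrecompact G] {k : Type w} [CommRing k] (μ : GMeasure G k) :
    Limits.HasFiniteBiproducts (Karoubi (Perm μ)) :=
  Karoubi.karoubi_hasFiniteBiproducts

/-- Finite products are transported along the equivalence, and in a preadditive category they are
biproducts. -/
theorem hasFiniteBiproducts_wSharpOne (hμ : PushY μ) (hr : μ.Regular) :
    Limits.HasFiniteBiproducts (WSharpOne k) := by
  have := oneFunctor_isEquivalence hμ hr
  have := hasFiniteBiproducts_karoubi_perm μ
  have : Limits.HasFiniteProducts (WSharpOne k) :=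
    ⟨fun n => Adjunction.hasLimitsOfShape_of_equivalence (oneFunctor hμ)⟩
  exact Limits.HasFiniteBiproducts.of_hasFiniteProducts

theorem IsNu.pushY [CharZero k] {ν : GMeasure (HomeoGroup 𝔛) ℚ} (h : IsNu ν) :
    PushY (ν.map (algebraMap ℚ k)) := fun _ _ _ _ f => h.pushforward_mapY f

end Equivalence
end CantorPerm
end

/-- The equivalence is taken in the direction in which it is easy to define, from Boolean matrices
to permutation modules. Of `ν` it uses only regularity and the push-forward formula `PushY`. -/
theorem mainTheorem5 {𝔛 : Type} [TopologicalSpace 𝔛] [CantorPerm.IsCantorSpace 𝔛]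
    {k : Type*} [Field k] [CharZero k] :
    (∃! ν : CantorPerm.GMeasure (CantorPerm.HomeoGroup 𝔛) ℚ, CantorPerm.IsNu ν) ∧
    ∀ ν : CantorPerm.GMeasure (CantorPerm.HomeoGroup 𝔛) ℚ, CantorPerm.IsNu ν →
      (∃ (Φ : CantorPerm.WSharpOne k ⥤
            CategoryTheory.Idempotents.Karoubi (CantorPerm.Perm (ν.map (algebraMap ℚ k))))
          (_ : Φ.Braided) (_ : Φ.Additive),
          Φ.IsEquivalence ∧ Φ.Linear k ∧
          ∀ (A : Type) [Fintype A], Nonempty (Φ.obj (CantorPerm.objWOne k A) ≅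
            (CategoryTheory.Idempotents.toKaroubi _).obj
              (CantorPerm.Perm.vec (CantorPerm.setY 𝔛 A)))) ∧
      CategoryTheory.Limits.HasFiniteBiproducts (CantorPerm.WSharpOne k) ∧
      CategoryTheory.Limits.HasFiniteBiproducts
        (CategoryTheory.Idempotents.Karoubi (CantorPerm.Perm (ν.map (algebraMap ℚ k)))) ∧
      ∀ (A B : Type) [Fintype A] [Fintype B] (f : A → B),
        (ν.map (algebraMap ℚ k)).pushforward (CantorPerm.mapY f)
            (CantorPerm.indicator k (⊤ : SubMulAction (CantorPerm.HomeoGroup 𝔛) (CantorPerm.setY 𝔛 A))) =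
          CantorPerm.indicator k (CantorPerm.subY 𝔛 (Set.range f)) := by
  refine ⟨CantorPerm.existsUnique_isNu, fun ν h => ?_⟩
  have hr := h.1.map (algebraMap ℚ k)
  exact ⟨⟨CantorPerm.oneFunctor h.pushY, CantorPerm.oneFunctorBraided h.pushY, inferInstance,
    CantorPerm.oneFunctor_isEquivalence h.pushY hr, inferInstance,
    fun A _ => ⟨CantorPerm.oneFunctorObj h.pushY A⟩⟩,
    CantorPerm.hasFiniteBiproducts_wSharpOne h.pushY hr,
    CantorPerm.hasFiniteBiproducts_karoubi_perm _, h.pushY⟩
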